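/- Let $\Sigma=\{1,\dots,\sigma\}$ be a non-empty finite alphabet. A $(k-1)$-tuple of gap constraints ($k\ge 1$) is a tuple $gc=(C_1,\dots,C_{k-1})$ of languages $C_i\subseteq\Sigma^*$. For $w\in\Sigma^*$, let $\mathrm{Subseq}_{gc}(w)\subseteq\Sigma^k$ be the set of all words $w[e(1)]w[e(2)]\cdots w[e(k)]$, where $e:\{1,\dots,k\}\to\{1,\dots,|w|\}$ is strictly increasing and $w[e(i)+1..e(i+1)-1]\in C_i$ for all $i\le k-1$. The problem $\mathrm{Uni}$ asks, given $w$ and $gc$, whether $\mathrm{Subseq}_{gc}(w)=\Sigma^k$; $\mathrm{Con}$ and $\mathrm{Equ}$ ask, given $w,w'$ and $gc$, whether $\mathrm{Subseq}_{gc}(w)\subseteq\mathrm{Subseq}_{gc}(w')$, respectively $\mathrm{Subseq}_{gc}(w)=\mathrm{Subseq}_{gc}(w')$. Let $\ell=|w|$ for $\mathrm{Uni}$ and $\ell=\max\{|w|,|w'|\}$ for $\mathrm{Con}$ and $\mathrm{Equ}$. A length constraint is $C_i=\{v : L_i^-\le |v|\le L_i^+\}$ with $L_i^-\le L_i^+$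 in $\{0,1,2,\dots\}\cup\{+\infty\}$, given by the pair $(L_i^-,L_i^+)$ in binary. A reg-len constraint is the intersection of a length constraint, given in this way, with a regular language given by a DFA (with its full transition table). Let $\mathrm{nz}(gc)$ be the number of $i$ with $C_i\ne\{\varepsilon\}$, let $\mathrm{states}(gc)$ be the total number of states of the DFAs for those $i$, and let $\mathrm{size}(gc)$ be the total size of the DFAs for all $i$, where a DFA with $q$ states has size $q(\sigma+1)$. In the bounds below, $\mathrm{nz}(gc)$, $\mathrm{states}(gc)$ and $\ell$ are to be replaced by $1$ when they are $0$. The computational model is the unit-cost RAM whose words have $O(\log N)$ bits, where $N$ is the input size (number of input cells plus the largest number in an input cell). (1) $\mathrm{Uni}$, $\mathrm{Con}$ and $\mathrm{Equ}$ (where $\Sigma$ is part of the input) can be solved in time $O(|\Sigma|^k\cdot\mathrm{nz}(gc)\cdot\ell)$ with length constraints, and in time $O(|\Sigma|^k\cdot\mathrm{states}(gc)\cdot\ell+\mathrm{size}(gc))$ with reg-len constraints. (2) For every fixed alphabet $\Sigma$, the problems $\mathrm{Uni}_\Sigma$, $\mathrm{Con}_\Sigma$ and $\mathrm{Equ}_\Sigma$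 (all instances over $\Sigma$) can be solved in time $2^{O(k)}\cdot\mathrm{nz}(gc)\cdot\ell$ with length constraints, and in time $2^{O(k)}\cdot\mathrm{states}(gc)\cdot\ell+O(\mathrm{size}(gc))$ with reg-len constraints; the constants may depend on $\Sigma$. -/

import Mathlib

/-! ## Subsequences with gap constraints -/

namespace GapSubseq

/-- The gap `w[i+1..j-1]` of `w` strictly between the positions `i` and `j`. -/
def gap {α : Type} (w : List α) (i j : ℕ) : List α :=
  (w.take j).drop (i + 1)

/-- `e : [k] → [|w|]` is an embedding satisfying the `(k-1)`-tuple `gc` of gap constraints with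
respect to `w`: it is strictly increasing and its `j`-th gap belongs to the `j`-th constraint.
The tuple has `gc.length = k - 1` entries, so `k = gc.length + 1`. -/
def Satisfies {α : Type} (gc : List (Language α)) (w : List α)
    (e : Fin (gc.length + 1) → Fin w.length) : Prop :=
  StrictMono e ∧ ∀ j : Fin gc.length, gap w (e j.castSucc) (e j.succ) ∈ gc.get j

/-- The set of all `gc`-subsequences of `w`. -/
def subseqSet {α : Type} (gc : List (Language α)) (w : List α) : Set (List α) :=
  {u | ∃ e : Fin (gc.length + 1) → Fin w.length,
    Satisfies gc w e ∧ u = List.ofFn fun i => w.get (e i)}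

/-- A length constraint `(L⁻, L⁺)` with `L⁻, L⁺ ∈ {0, 1, 2, …} ∪ {+∞}` and `L⁻ ≤ L⁺`. -/
structure LenConstraint where
  lo : ℕ∞
  hi : ℕ∞
  le : lo ≤ hi

/-- The words whose length obeys the length constraint. -/
def LenConstraint.lang (σ : ℕ) (c : LenConstraint) : Language (Fin σ) :=
  {v : List (Fin σ) | c.lo ≤ (v.length : ℕ∞) ∧ (v.length : ℕ∞) ≤ c.hi}

/-- A reg-len constraint over the alphabet `Fin σ`: a length constraint together with a DFA. -/
structure RegLenConstraint (σ : ℕ) where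
  len : LenConstraint
  numStates : ℕ
  dfa : DFA (Fin σ) (Fin numStates)

/-- The words accepted by the DFA whose length obeys the length constraint. -/
def RegLenConstraint.lang (σ : ℕ) (c : RegLenConstraint σ) : Language (Fin σ) :=
  {v : List (Fin σ) | v ∈ c.dfa.accepts ∧ v ∈ c.len.lang σ}

open Classical in
/-- The non-zero gaps of a tuple of constraints: those whose language is not `{ε}`. -/
noncomputable def nonZeroGaps {γ : ℕ → Type} (lang : (σ : ℕ) → γ σ → Language (Fin σ)) {σ : ℕ}
    (gc : List (γ σ)) : List (γ σ) :=
  gc.filter fun c => decide (lang σ c ≠ {[]})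

/-- `nz(gc)`: the number of non-zero gaps. -/
noncomputable def nz {γ : ℕ → Type} (lang : (σ : ℕ) → γ σ → Language (Fin σ)) {σ : ℕ}
    (gc : List (γ σ)) : ℕ :=
  (nonZeroGaps lang gc).length

/-- `states(gc)`: the total number of states of the DFAs of the non-zero gaps. -/
noncomputable def states {σ : ℕ} (gc : List (RegLenConstraint σ)) : ℕ :=
  ((nonZeroGaps RegLenConstraint.lang gc).map fun c => c.numStates).sum

/-- `size(gc)`: the total size of all the DFAs, where a DFA with `q` states has `q` acceptance
flags and `q * σ` transitions. -/
def size {σ : ℕ} (gc : List (RegLenConstraint σ)) : ℕ :=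
  (gc.map fun c => c.numStates * (σ + 1)).sum

/-! ## The problems -/

/-- The three analysis problems: universality, containment, equivalence. -/
inductive Problem
  | uni
  | con
  | equ

/-- The strings in an instance: one string for universality, otherwise a pair of strings. -/
def Problem.Words (α : Type) : Problem → Type
  | uni => List α
  | con => List α × List α
  | equ => List α × List α

/-- The question asked, for given gap constraints and given strings. -/
def Problem.Answer {α : Type} (gc : List (Language α)) : (p : Problem) → p.Words α → Prop
  | uni, w => subseqSet gc w = {u | u.length = gc.length + 1}
  | con, (w, w') => subseqSet gc w ⊆ subseqSet gc w'
  | equ, (w, w') => subseqSet gc w = subseqSet gc w'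

/-- The maximal length `ℓ` of the given strings. -/
def Problem.maxLen {α : Type} : (p : Problem) → p.Words α → ℕ
  | uni, w => w.length
  | con, (w, w') => max w.length w'.length
  | equ, (w, w') => max w.length w'.length

/-- An instance of a problem: a non-empty integer alphabet of size `σ` (with letters
`0, …, σ - 1`), the string or strings, and the tuple of gap constraints.  Here `γ σ` is the
type of the representations of gap constraints over the alphabet of size `σ`. -/
structure Instance (p : Problem) (γ : ℕ → Type) where
  σ : ℕ
  σ_pos : 0 < σ
  words : p.Words (Fin σ)
  gc : List (γ σ)

namespace Instance

variable {p : Problem} {γ : ℕ → Type}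

/-- The length `k` of the subsequences; `gc` is a `(k-1)`-tuple. -/
def k (I : Instance p γ) : ℕ := I.gc.length + 1

/-- The maximal length `ℓ` of the input strings. -/
def ell (I : Instance p γ) : ℕ := p.maxLen I.words

/-- `I` is a yes-instance. -/
def IsYes (lang : (σ : ℕ) → γ σ → Language (Fin σ)) (I : Instance p γ) : Prop :=
  p.Answer (I.gc.map (lang I.σ)) I.words

end Instance

/-! ## Representation of instances as sequences of numbers -/

/-- A string: its length followed by its letters. -/
def encodeWord {σ : ℕ} (w : List (Fin σ)) : List ℕ :=
  w.length :: w.map fun a => (a : ℕ)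

def Problem.encodeWords {σ : ℕ} : (p : Problem) → p.Words (Fin σ) → List ℕ
  | uni, w => encodeWord w
  | con, (w, w') => encodeWord w ++ encodeWord w'
  | equ, (w, w') => encodeWord w ++ encodeWord w'

/-- A bound in `ℕ ∪ {+∞}`: the flag `1` for `+∞`; otherwise the flag `0`, the number of binary
digits, and the binary digits, least significant first and without leading zeros. -/
def encodeBound : ℕ∞ → List ℕ
  | ⊤ => [1]
  | (n : ℕ) => 0 :: n.bits.length :: n.bits.map Bool.toNat

def LenConstraint.encode (_σ : ℕ) (c : LenConstraint) : List ℕ :=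
  encodeBound c.lo ++ encodeBound c.hi

open Classical in
/-- A DFA: number of states, initial state, the list of acceptance flags, and the transition
table row by row. -/
noncomputable def encodeDFA {σ q : ℕ} (A : DFA (Fin σ) (Fin q)) : List ℕ :=
  [q, (A.start : ℕ)] ++ (List.finRange q).map (fun s => if s ∈ A.accept then 1 else 0) ++
    (List.finRange q).flatMap fun s => (List.finRange σ).map fun a => (A.step s a : ℕ)

noncomputable def RegLenConstraint.encode (σ : ℕ) (c : RegLenConstraint σ) : List ℕ :=
  c.len.encode σ ++ encodeDFA c.dfa

/-- An instance: alphabet size, string(s), number of constraints, constraints. -/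
def Instance.encode {p : Problem} {γ : ℕ → Type} (enc : (σ : ℕ) → γ σ → List ℕ)
    (I : Instance p γ) : List ℕ :=
  [I.σ] ++ p.encodeWords I.words ++ [I.gc.length] ++ I.gc.flatMap (enc I.σ)

end GapSubseq

/-! ## The unit-cost RAM with logarithmic word size -/

namespace RAM

/-- Arithmetic, comparison and bitwise operations. -/
inductive Op
  | add | sub | mul | div | mod | eq | lt | land | lor | xor | shl | shr

/-- The value of an operation on words of `b` bits (subtraction is truncated at `0`). -/
def Op.eval (b : ℕ) (o : Op) (x y : ℕ) : ℕ :=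
  (match o with
    | add => x + y
    | sub => x - y
    | mul => x * y
    | div => x / y
    | mod => x % y
    | eq => if x = y then 1 else 0
    | lt => if x < y then 1 else 0
    | land => x &&& y
    | lor => x ||| y
    | xor => x ^^^ y
    | shl => x <<< y
    | shr => x >>> y) % 2 ^ b

/-- Programs of the random access machine.  Variables `r, x, y, …` name registers. -/
inductive Prog
  /-- put the constant `c` into register `r` -/
  | const (r c : ℕ)
  /-- apply an operation to registers `x` and `y`, result in register `r` -/
  | op (o : Op) (r x y : ℕ)
  /-- indirect read: put the memory cell whose address is in register `a` into register `r` -/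
  | load (r a : ℕ)
  /-- indirect write: put register `x` into the memory cell whose address is in register `a` -/
  | store (a x : ℕ)
  /-- sequential composition -/
  | seq (P Q : Prog)
  /-- branch on whether register `x` is non-zero -/
  | ite (x : ℕ) (P Q : Prog)
  /-- repeat `P` as long as register `x` is non-zero -/
  | loop (x : ℕ) (P : Prog)

/-- Contents of the registers and of the memory. -/
structure State where
  reg : ℕ → ℕ
  mem : ℕ → ℕ

/-- Write a register. -/
def State.setReg (s : State) (r v : ℕ) : State := ⟨Function.update s.reg r v, s.mem⟩

/-- Write a memory cell. -/
def State.setMem (s : State) (a v : ℕ) : State := ⟨s.reg, Function.update s.mem a v⟩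

/-- `Exec b P s t s'`: with words of `b` bits, the program `P` started in the state `s` halts in
the state `s'` after exactly `t` steps.  Every elementary instruction and every test of a
branch or of a loop costs one step. -/
inductive Exec (b : ℕ) : Prog → State → ℕ → State → Prop
  | const (r c : ℕ) (s : State) : Exec b (.const r c) s 1 (s.setReg r (c % 2 ^ b))
  | op (o : Op) (r x y : ℕ) (s : State) :
      Exec b (.op o r x y) s 1 (s.setReg r (o.eval b (s.reg x) (s.reg y)))
  | load (r a : ℕ) (s : State) : Exec b (.load r a) s 1 (s.setReg r (s.mem (s.reg a)))
  | store (a x : ℕ) (s : State) : Exec b (.store a x) s 1 (s.setMem (s.reg a) (s.reg x))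
  | seq {P Q : Prog} {s s' s'' : State} {t t' : ℕ} :
      Exec b P s t s' → Exec b Q s' t' s'' → Exec b (.seq P Q) s (t + t') s''
  | ite_true {x : ℕ} {P Q : Prog} {s s' : State} {t : ℕ} :
      s.reg x ≠ 0 → Exec b P s t s' → Exec b (.ite x P Q) s (t + 1) s'
  | ite_false {x : ℕ} {P Q : Prog} {s s' : State} {t : ℕ} :
      s.reg x = 0 → Exec b Q s t s' → Exec b (.ite x P Q) s (t + 1) s'
  | loop_true {x : ℕ} {P : Prog} {s s' s'' : State} {t t' : ℕ} :
      s.reg x ≠ 0 → Exec b P s t s' → Exec b (.loop x P) s' t' s'' →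
        Exec b (.loop x P) s (t + t' + 1) s''
  | loop_false {x : ℕ} {P : Prog} {s : State} :
      s.reg x = 0 → Exec b (.loop x P) s 1 s

/-- The start state: the input occupies the first memory cells; everything else is `0`. -/
def startState (input : List ℕ) : State := ⟨fun _ => 0, fun i => input.getD i 0⟩

/-- The word size: `d` times the number of bits of `N`, where `N` is the number of input cells
plus the largest input number. -/
def wordBits (d : ℕ) (input : List ℕ) : ℕ :=
  d * Nat.size (input.length + input.foldr max 0)

/-- On the domain `D` of inputs `x`, encoded by `enc x`, the problem `Q` is solved in time
`T x` by one program on the unit-cost RAM whose words have `O(log N)` bits.  The output, `1` for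
yes and `0` for no, is left in register `0`. -/
def SolvableInTime {ι : Type} (D : Set ι) (enc : ι → List ℕ) (Q : ι → Prop) (T : ι → ℕ) : Prop :=
  ∃ (P : Prog) (d : ℕ), ∀ x ∈ D, ∃ (t : ℕ) (s : State),
    Exec (wordBits d (enc x)) P (startState (enc x)) t s ∧ t ≤ T x ∧
      ((Q x ∧ s.reg 0 = 1) ∨ (¬ Q x ∧ s.reg 0 = 0))

end RAM

namespace GapSubseq

/-- Problem `p` with length constraints, restricted to the instances in `D`, can be solved in
time `T`. -/
def LenSolvable (p : Problem) (D : Set (Instance p fun _ => LenConstraint))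
    (T : (Instance p fun _ => LenConstraint) → ℕ) : Prop :=
  RAM.SolvableInTime D (Instance.encode LenConstraint.encode)
    (Instance.IsYes LenConstraint.lang) T

/-- Problem `p` with reg-len constraints, restricted to the instances in `D`, can be solved in
time `T`. -/
def RegLenSolvable (p : Problem) (D : Set (Instance p RegLenConstraint))
    (T : Instance p RegLenConstraint → ℕ) : Prop :=
  RAM.SolvableInTime D (Instance.encode RegLenConstraint.encode)
    (Instance.IsYes RegLenConstraint.lang) T

end GapSubseq

set_option linter.constructorNameAsVariable false
set_option linter.unusedSimpArgs false
set_option linter.unusedVariables false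

/-! ## A structured language with named arrays, and its compilation to the RAM -/

namespace While

open GapSubseq

/-! All words of `Σ^k` are enumerated by a depth-first search. For the current prefix and each
string a row is kept: the set of positions where the next letter may be placed. If `C` is the row at
some depth, `a` the next letter and `L` the next constraint, then the next row is `advance w L a C`.
A full word is a subsequence iff its last letter occurs at a position of its last row. All three
problems ask for a condition on every word of length `k`, given whether it is a subsequence of each
string.

A row is computed in time `O(|w| * q)`, where `q` is the number of states of the automaton, whatever
the length bounds are. While the string is scanned, every state remembers only the latest start that
leads to it and whose gap has reached the lower length bound. Runs in the same state never separate
again, and the latest start has the shortest gap, so it alone matters for the upper bound. A start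
enters this table as soon as `lo` letters have been read behind it, and then its state is needed in
constant time. For this the string is cut into blocks of length `lo`. A window of length `lo`
crosses exactly one block border, so its run is composed of a run to the end of a block (table `tt`,
filled from the right) and a run from the beginning of a block (table `pp`, updated on the way).

For `C_i = {ε}` a row costs only `O(|w|)`, independently of the automaton. Such constraints do not
count in `nz` and `states`; for `σ ≥ 2` their cost is absorbed by the geometric growth of the search
tree (`dfsCost_le`). For `σ = 1` this argument fails. There only one word has to be tested, and it
is a subsequence iff its `k` letters and the shortest admissible gaps fit into the string
(`matches_unary`).

The preparation must respect the same bounds. If `k > ℓ` there are no subsequences, and the answer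
is given without looking at the constraints. Otherwise each constraint is skipped in constant time,
because the number of digits and the number of states are stored. Whether a constraint is `{ε}` is
decided by a breadth-first search in time linear in the size of its automaton, and only the other
constraints have their bounds decoded, cut off at `ℓ + 1`. Length constraints are treated as reg-len
constraints whose common automaton has a single accepting state, so that `states` becomes `nz`.

The algorithm is written in a small language with named variables and arrays; `exec_cmd` compiles it
to the RAM with a constant factor in time. The arrays lie at distance `Z = M ^ 3` in memory, where
`M` is the input length plus `σ + 16`, and words of nine times the bit length of `N` can hold all
addresses. For a fixed alphabet, `C * σ ^ k` is bounded by `2 ^ ((C + σ) * k)`. -/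

/-- Program variables. -/
inductive Var
  | sig | g | ell | n0 | n1 | b0 | b1 | p | i | q | act | big | res | go | t | h | n | wb | rin
  | rout | a | st | ac | tr | lo | hi | lm | x | y | u | s | d | j | f | m | nb | val | ptr | z
  | fnd | lop | hip | head | tail | c | lim | sum | two | k | w
  deriving DecidableEq

/-- Named arrays. -/
inductive Arr
  | inp | wbase | wlen | lop | hip | qq | st | ac | zf | lo | hi | row | v | tt | pp | bb | b2
  | vis | que | dst | ans
  deriving DecidableEq

def Var.idx : Var → ℕ
  | sig => 0 | g => 1 | ell => 2 | n0 => 3 | n1 => 4 | b0 => 5 | b1 => 6 | p => 7 | i => 8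
  | q => 9 | act => 10 | big => 11 | res => 12 | go => 13 | t => 14 | h => 15 | n => 16
  | wb => 17 | rin => 18 | rout => 19 | a => 20 | st => 21 | ac => 22 | tr => 23 | lo => 24
  | hi => 25 | lm => 26 | x => 27 | y => 28 | u => 29 | s => 30 | d => 31 | j => 32 | f => 33
  | m => 34 | nb => 35 | val => 36 | ptr => 37 | z => 38 | fnd => 39 | lop => 40 | hip => 41
  | head => 42 | tail => 43 | c => 44 | lim => 45 | sum => 46
  | two => 47 | k => 48 | w => 49

/-- The number 0 of `inp` matters: array number `i` begins at address `i * Z`, so `inp` coincides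
with the input cells of the start state and can be read before `Z` is known. -/
def Arr.idx : Arr → ℕ
  | inp => 0 | wbase => 1 | wlen => 2 | lop => 3 | hip => 4 | qq => 5 | st => 6 | ac => 7
  | zf => 8 | lo => 9 | hi => 10 | row => 11 | v => 12 | tt => 13 | pp => 14 | bb => 15
  | b2 => 16 | vis => 17 | que => 18 | dst => 19 | ans => 20

/-- The numbering follows the order of the constructors, so injectivity needs no case distinction
over pairs. -/
theorem Var.idx_eq_ctorIdx (x : Var) : x.idx = x.ctorIdx := by cases x <;> rfl

theorem Arr.idx_eq_ctorIdx (x : Arr) : x.idx = x.ctorIdx := by cases x <;> rfl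

theorem Var.idx_inj {x y : Var} (h : x.idx = y.idx) : x = y := by
  rw [Var.idx_eq_ctorIdx, Var.idx_eq_ctorIdx] at h
  rw [← Var.ofNat_ctorIdx x, ← Var.ofNat_ctorIdx y, h]

theorem Arr.idx_inj {x y : Arr} (h : x.idx = y.idx) : x = y := by
  rw [Arr.idx_eq_ctorIdx, Arr.idx_eq_ctorIdx] at h
  rw [← Arr.ofNat_ctorIdx x, ← Arr.ofNat_ctorIdx y, h]

theorem Var.idx_lt (x : Var) : x.idx < 64 := by cases x <;> decide

theorem Arr.idx_lt (x : Arr) : x.idx < 32 := by cases x <;> decide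

inductive BOp
  | add | sub | mul | mod | eq | lt

def BOp.fn : BOp → ℕ → ℕ → ℕ
  | add, x, y => x + y
  | sub, x, y => x - y
  | mul, x, y => x * y
  | mod, x, y => x % y
  | eq, x, y => if x = y then 1 else 0
  | lt, x, y => if x < y then 1 else 0

def BOp.toOp : BOp → RAM.Op
  | add => .add
  | sub => .sub
  | mul => .mul
  | mod => .mod
  | eq => .eq
  | lt => .lt

inductive Expr
  | var (x : Var)
  | lit (n : ℕ)
  | get (c : Arr) (e : Expr)
  | bin (o : BOp) (e₁ e₂ : Expr)

instance : Coe Var Expr := ⟨Expr.var⟩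
instance (n : ℕ) : OfNat Expr n := ⟨Expr.lit n⟩
instance : Add Expr := ⟨Expr.bin .add⟩
instance : Sub Expr := ⟨Expr.bin .sub⟩
instance : Mul Expr := ⟨Expr.bin .mul⟩
instance : Mod Expr := ⟨Expr.bin .mod⟩

/-- Equality test. -/
def Expr.eqq (a b : Expr) : Expr := .bin .eq a b

/-- Comparison test. -/
def Expr.ltt (a b : Expr) : Expr := .bin .lt a b

/-- States: contents of the variables and of the arrays. -/
structure St where
  var : Var → ℕ
  arr : Arr → ℕ → ℕ

def St.set (s : St) (x : Var) (v : ℕ) : St := ⟨Function.update s.var x v, s.arr⟩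

def St.put (s : St) (c : Arr) (i v : ℕ) : St :=
  ⟨s.var, Function.update s.arr c (Function.update (s.arr c) i v)⟩

@[simp] theorem St.set_var (s : St) (x y : Var) (v : ℕ) :
    (s.set x v).var y = if y = x then v else s.var y := by
  simp [St.set, Function.update_apply]

@[simp] theorem St.set_arr (s : St) (x : Var) (v : ℕ) : (s.set x v).arr = s.arr := rfl

@[simp] theorem St.put_var (s : St) (c : Arr) (i v : ℕ) : (s.put c i v).var = s.var := rfl

theorem St.put_arr (s : St) (c : Arr) (i v : ℕ) (c' : Arr) (i' : ℕ) :
    (s.put c i v).arr c' i' = if c' = c then (if i' = i then v else s.arr c i') else s.arr c' i' := by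
  unfold St.put
  by_cases hc : c' = c
  · subst hc; simp [Function.update_apply]
  · simp [hc]

theorem St.put_arr_self (s : St) (c : Arr) (i v : ℕ) :
    (s.put c i v).arr c = Function.update (s.arr c) i v := by
  simp [St.put]

theorem St.put_arr_ne (s : St) (c : Arr) (i v : ℕ) (c' : Arr) (h : c' ≠ c) :
    (s.put c i v).arr c' = s.arr c' := by
  simp [St.put, h]

def Expr.eval (s : St) : Expr → ℕ
  | var x => s.var x
  | lit n => n
  | get c e => s.arr c (e.eval s)
  | bin o a b => o.fn (a.eval s) (b.eval s)

/-- All intermediate results stay below `Z`. -/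
def Expr.Ok (Z : ℕ) (s : St) : Expr → Prop
  | var _ => True
  | lit n => n < Z
  | get _ e => e.Ok Z s
  | bin .add a b => a.Ok Z s ∧ b.Ok Z s ∧ a.eval s + b.eval s < Z
  | bin .mul a b => a.Ok Z s ∧ b.Ok Z s ∧ a.eval s * b.eval s < Z
  | bin _ a b => a.Ok Z s ∧ b.Ok Z s

section
variable (Z : ℕ) (s : St) (x : Var) (n : ℕ) (c : Arr) (a b : Expr)
@[simp] theorem Expr.eval_var : (Expr.var x).eval s = s.var x := rfl
@[simp] theorem Expr.eval_zero : (0 : Expr).eval s = 0 := rfl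
@[simp] theorem Expr.eval_one : (1 : Expr).eval s = 1 := rfl
@[simp] theorem Expr.eval_two : (2 : Expr).eval s = 2 := rfl
@[simp] theorem Expr.eval_lit : (Expr.lit n).eval s = n := rfl
@[simp] theorem Expr.eval_get : (Expr.get c a).eval s = s.arr c (a.eval s) := rfl
@[simp] theorem Expr.eval_add : (a + b).eval s = a.eval s + b.eval s := rfl
@[simp] theorem Expr.eval_sub : (a - b).eval s = a.eval s - b.eval s := rfl
@[simp] theorem Expr.eval_mul : (a * b).eval s = a.eval s * b.eval s := rfl
@[simp] theorem Expr.eval_mod : (a % b).eval s = a.eval s % b.eval s := rfl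
@[simp] theorem Expr.eval_eqq :
    (a.eqq b).eval s = if a.eval s = b.eval s then 1 else 0 := rfl
@[simp] theorem Expr.eval_ltt :
    (a.ltt b).eval s = if a.eval s < b.eval s then 1 else 0 := rfl
@[simp] theorem Expr.ok_var : (Expr.var x).Ok Z s ↔ True := Iff.rfl
@[simp] theorem Expr.ok_zero : (0 : Expr).Ok Z s ↔ 0 < Z := Iff.rfl
@[simp] theorem Expr.ok_one : (1 : Expr).Ok Z s ↔ 1 < Z := Iff.rfl
@[simp] theorem Expr.ok_two : (2 : Expr).Ok Z s ↔ 2 < Z := Iff.rfl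
@[simp] theorem Expr.ok_lit : (Expr.lit n).Ok Z s ↔ n < Z := Iff.rfl
@[simp] theorem Expr.ok_get : (Expr.get c a).Ok Z s ↔ a.Ok Z s := Iff.rfl
@[simp] theorem Expr.ok_add :
    (a + b).Ok Z s ↔ a.Ok Z s ∧ b.Ok Z s ∧ a.eval s + b.eval s < Z := Iff.rfl
@[simp] theorem Expr.ok_mul :
    (a * b).Ok Z s ↔ a.Ok Z s ∧ b.Ok Z s ∧ a.eval s * b.eval s < Z := Iff.rfl
@[simp] theorem Expr.ok_sub : (a - b).Ok Z s ↔ a.Ok Z s ∧ b.Ok Z s := Iff.rfl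
@[simp] theorem Expr.ok_mod : (a % b).Ok Z s ↔ a.Ok Z s ∧ b.Ok Z s := Iff.rfl
@[simp] theorem Expr.ok_eqq : (a.eqq b).Ok Z s ↔ a.Ok Z s ∧ b.Ok Z s := Iff.rfl
@[simp] theorem Expr.ok_ltt : (a.ltt b).Ok Z s ↔ a.Ok Z s ∧ b.Ok Z s := Iff.rfl
end

/-! ### Commands, their execution, and rules for weakest preconditions -/

inductive Cmd
  | skip
  | assign (x : Var) (e : Expr)
  | store (c : Arr) (i e : Expr)
  | seq (a b : Cmd)
  | ite (e : Expr) (a b : Cmd)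
  | loop (e : Expr) (a : Cmd)

infixr:60 " ;; " => Cmd.seq
infix:61 " ::= " => Cmd.assign

/-- `x` runs from `0` to `y - 1`. -/
def Cmd.for (x y : Var) (a : Cmd) : Cmd :=
  x ::= 0 ;; .loop (Expr.ltt x y) (a ;; x ::= (x : Expr) + 1)

/-- Whether the variable `y` is assigned. -/
def Cmd.wr (y : Var) : Cmd → Bool
  | skip => false
  | assign x _ => x == y
  | store _ _ _ => false
  | seq a b => a.wr y || b.wr y
  | ite _ a b => a.wr y || b.wr y
  | loop _ a => a.wr y

/-- Whether the array `d` is written. -/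
def Cmd.awr (d : Arr) : Cmd → Bool
  | skip => false
  | assign _ _ => false
  | store c _ _ => c == d
  | seq a b => a.awr d || b.awr d
  | ite _ a b => a.awr d || b.awr d
  | loop _ a => a.awr d

/-- `Run Z c s t s'`: from `s` the command `c` halts in `s'` after `t` steps, and no value ever
reaches `Z`. -/
inductive Run (Z : ℕ) : Cmd → St → ℕ → St → Prop
  | skip (s : St) : Run Z .skip s 1 s
  | assign {x : Var} {e : Expr} {s : St} : e.Ok Z s → Run Z (.assign x e) s 1 (s.set x (e.eval s))
  | store {c : Arr} {i e : Expr} {s : St} : i.Ok Z s → e.Ok Z s →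
      Run Z (.store c i e) s 1 (s.put c (i.eval s) (e.eval s))
  | seq {a b : Cmd} {s s' s'' : St} {t t' : ℕ} :
      Run Z a s t s' → Run Z b s' t' s'' → Run Z (.seq a b) s (t + t') s''
  | ite_true {e : Expr} {a b : Cmd} {s s' : St} {t : ℕ} : e.Ok Z s → e.eval s ≠ 0 →
      Run Z a s t s' → Run Z (.ite e a b) s (t + 1) s'
  | ite_false {e : Expr} {a b : Cmd} {s s' : St} {t : ℕ} : e.Ok Z s → e.eval s = 0 →
      Run Z b s t s' → Run Z (.ite e a b) s (t + 1) s'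
  | loop_true {e : Expr} {a : Cmd} {s s' s'' : St} {t t' : ℕ} : e.Ok Z s → e.eval s ≠ 0 →
      Run Z a s t s' → Run Z (.loop e a) s' t' s'' → Run Z (.loop e a) s (t + t' + 1) s''
  | loop_false {e : Expr} {a : Cmd} {s : St} : e.Ok Z s → e.eval s = 0 →
      Run Z (.loop e a) s 1 s

/-- The states `s` and `s'` agree outside of what the command `c` may write. -/
structure Frame (c : Cmd) (s s' : St) : Prop where
  var : ∀ y, c.wr y = false → s'.var y = s.var y
  arr : ∀ d, c.awr d = false → s'.arr d = s.arr d

theorem Frame.trans {c : Cmd} {s s' s'' : St} (h : Frame c s s') (h' : Frame c s' s'') :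
    Frame c s s'' :=
  ⟨fun y hy => (h'.var y hy).trans (h.var y hy), fun y hy => (h'.arr y hy).trans (h.arr y hy)⟩

theorem Frame.refl (c : Cmd) (s : St) : Frame c s s := ⟨fun _ _ => rfl, fun _ _ => rfl⟩

/-- Write sets are computed from the syntax. Hence specifications need not list what stays
unchanged; such facts are recovered from the frame, mostly with a proof by `rfl` that the variable
or array is not written. -/
theorem Run.frame {Z : ℕ} {c : Cmd} {s s' : St} {t : ℕ} (h : Run Z c s t s') : Frame c s s' := by
  induction h with
  | skip | loop_false => exact Frame.refl _ _
  | assign h =>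
    refine ⟨fun y hy => ?_, fun _ _ => rfl⟩
    simp only [Cmd.wr, beq_eq_false_iff_ne] at hy
    simp [St.set_var, Ne.symm hy]
  | store h h' =>
    refine ⟨fun y hy => rfl, fun d hd => ?_⟩
    simp only [Cmd.awr, beq_eq_false_iff_ne] at hd
    exact St.put_arr_ne _ _ _ _ _ (Ne.symm hd)
  | seq _ _ ih ih' =>
    refine ⟨fun y hy => ?_, fun y hy => ?_⟩
    · simp only [Cmd.wr, Bool.or_eq_false_iff] at hy
      rw [ih'.var y hy.2, ih.var y hy.1]
    · simp only [Cmd.awr, Bool.or_eq_false_iff] at hy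
      rw [ih'.arr y hy.2, ih.arr y hy.1]
  | ite_true _ _ _ ih =>
    refine ⟨fun y hy => ?_, fun y hy => ?_⟩
    · simp only [Cmd.wr, Bool.or_eq_false_iff] at hy
      exact ih.var y hy.1
    · simp only [Cmd.awr, Bool.or_eq_false_iff] at hy
      exact ih.arr y hy.1
  | ite_false _ _ _ ih =>
    refine ⟨fun y hy => ?_, fun y hy => ?_⟩
    · simp only [Cmd.wr, Bool.or_eq_false_iff] at hy
      exact ih.var y hy.2
    · simp only [Cmd.awr, Bool.or_eq_false_iff] at hy
      exact ih.arr y hy.2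
  | loop_true _ _ _ _ ih ih' =>
    exact Frame.trans (c := .loop _ _) ⟨fun y hy => ih.var y hy, fun y hy => ih.arr y hy⟩ ih'

/-- Weakest precondition with an accumulated step count. -/
def wp (Z : ℕ) (c : Cmd) (Q : St → ℕ → Prop) (s : St) (t₀ : ℕ) : Prop :=
  ∃ t s', Run Z c s t s' ∧ Q s' (t₀ + t)

section
variable {Z : ℕ} {Q : St → ℕ → Prop} {s : St} {t₀ : ℕ}

@[simp] theorem wp_skip : wp Z .skip Q s t₀ ↔ Q s (t₀ + 1) := by
  constructor
  · rintro ⟨t, s', h, hQ⟩; cases h; exact hQ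
  · intro h; exact ⟨_, _, .skip _, h⟩

@[simp] theorem wp_assign {x : Var} {e : Expr} :
    wp Z (x ::= e) Q s t₀ ↔ e.Ok Z s ∧ Q (s.set x (e.eval s)) (t₀ + 1) := by
  constructor
  · rintro ⟨t, s', h, hQ⟩; cases h with | assign h => exact ⟨h, hQ⟩
  · rintro ⟨h, hQ⟩; exact ⟨_, _, .assign h, hQ⟩

@[simp] theorem wp_store {c : Arr} {i e : Expr} :
    wp Z (.store c i e) Q s t₀ ↔
      i.Ok Z s ∧ e.Ok Z s ∧ Q (s.put c (i.eval s) (e.eval s)) (t₀ + 1) := by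
  constructor
  · rintro ⟨t, s', h, hQ⟩; cases h with | store h h' => exact ⟨h, h', hQ⟩
  · rintro ⟨h, h', hQ⟩; exact ⟨_, _, .store h h', hQ⟩

@[simp] theorem wp_seq {a b : Cmd} :
    wp Z (a ;; b) Q s t₀ ↔ wp Z a (fun s' t => wp Z b Q s' t) s t₀ := by
  constructor
  · rintro ⟨t, s', h, hQ⟩
    cases h with | seq h h' => exact ⟨_, _, h, _, _, h', by rwa [Nat.add_assoc]⟩
  · rintro ⟨_, _, h, _, _, h', hQ⟩
    exact ⟨_, _, .seq h h', by rwa [← Nat.add_assoc]⟩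

@[simp] theorem wp_ite {e : Expr} {a b : Cmd} :
    wp Z (.ite e a b) Q s t₀ ↔
      e.Ok Z s ∧ (e.eval s ≠ 0 → wp Z a Q s (t₀ + 1)) ∧ (e.eval s = 0 → wp Z b Q s (t₀ + 1)) := by
  constructor
  · rintro ⟨t, s', h, hQ⟩
    cases h with
    | ite_true h h1 h2 =>
      exact ⟨h, fun _ => ⟨_, _, h2, by rwa [Nat.add_right_comm, Nat.add_assoc]⟩, fun h => absurd h h1⟩
    | ite_false h h1 h2 =>
      exact ⟨h, fun h => absurd h1 h, fun _ => ⟨_, _, h2, by rwa [Nat.add_right_comm, Nat.add_assoc]⟩⟩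
  · rintro ⟨h, h1, h2⟩
    by_cases h0 : e.eval s = 0
    · obtain ⟨t, s', h', hQ⟩ := h2 h0
      exact ⟨_, _, .ite_false h h0 h', by rwa [Nat.add_comm t, ← Nat.add_assoc]⟩
    · obtain ⟨t, s', h', hQ⟩ := h1 h0
      exact ⟨_, _, .ite_true h h0 h', by rwa [Nat.add_comm t, ← Nat.add_assoc]⟩

theorem wp_loop_true {e : Expr} {a : Cmd} (h : e.Ok Z s) (h0 : e.eval s ≠ 0)
    (hw : wp Z a (fun s' t => wp Z (.loop e a) Q s' t) s (t₀ + 1)) : wp Z (.loop e a) Q s t₀ := by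
  obtain ⟨t, s', h1, t', s'', h2, hQ⟩ := hw
  exact ⟨_, _, .loop_true h h0 h1 h2, by convert hQ using 1; omega⟩

theorem wp_loop_false {e : Expr} {a : Cmd} (h : e.Ok Z s) (h0 : e.eval s = 0)
    (hQ : Q s (t₀ + 1)) : wp Z (.loop e a) Q s t₀ :=
  ⟨_, _, .loop_false h h0, hQ⟩

/-- Use of a specification of a command. -/
theorem wp_call {c : Cmd} {R : St → Prop} {T : ℕ}
    (h : wp Z c (fun s' t => t ≤ T ∧ R s') s 0)
    (hQ : ∀ s' t, Frame c s s' → t ≤ t₀ + T → R s' → Q s' t) : wp Z c Q s t₀ := by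
  obtain ⟨t, s', hr, ht, hR⟩ := h
  exact ⟨t, s', hr, hQ _ _ hr.frame (by omega) hR⟩

theorem wp_mono {c : Cmd} {Q' : St → ℕ → Prop} (h : wp Z c Q s t₀)
    (hQ : ∀ s' t, t₀ ≤ t → Frame c s s' → Q s' t → Q' s' t) : wp Z c Q' s t₀ := by
  obtain ⟨t, s', hr, h⟩ := h
  exact ⟨t, s', hr, hQ _ _ (by omega) hr.frame h⟩

/-- The rule for bounded loops: `I i` is the invariant before round `i`, and round `i` takes at most
`B i` steps. -/
theorem wp_for {x y : Var} {a : Cmd} (N : ℕ) (I : ℕ → St → Prop) (B : ℕ → ℕ)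
    (hy : s.var y = N) (hyx : x ≠ y) (hwy : a.wr y = false) (hwx : a.wr x = false) (hN : N < Z)
    (h0 : I 0 (s.set x 0))
    (hstep : ∀ i < N, ∀ s', Frame (.for x y a) s s' → s'.var x = i → I i s' →
      wp Z a (fun s'' t => t ≤ B i ∧ I (i + 1) (s''.set x (i + 1))) s' 0)
    (hQ : ∀ s' t, Frame (.for x y a) s s' → s'.var x = N → I N s' →
      t ≤ t₀ + ∑ i ∈ Finset.range N, (B i + 2) + 2 → Q s' t) :
    wp Z (.for x y a) Q s t₀ := by
  have hwf : ∀ z, (Cmd.for x y a).wr z = false ↔ (x ≠ z ∧ a.wr z = false) := by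
    intro z
    simp only [Cmd.for, Cmd.wr, Bool.or_eq_false_iff, beq_eq_false_iff_ne]
    tauto
  have haf : ∀ z, (Cmd.for x y a).awr z = a.awr z := by
    intro z
    simp [Cmd.for, Cmd.awr]
  -- Induction on the number `k` of remaining rounds. The 2 per round pays for the test and the
  -- increment, the final 1 for the initial assignment.
  have key : ∀ k i, N = i + k → ∀ s', Frame (.for x y a) s s' → s'.var x = i → I i s' →
      ∀ t, t ≤ t₀ + ∑ i ∈ Finset.range i, (B i + 2) + 1 →
      wp Z (.loop (Expr.ltt x y) (a ;; x ::= (x : Expr) + 1)) Q s' t := by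
    intro k
    induction k with
    | zero =>
      intro i hi s' hf hx hI t ht
      obtain rfl : N = i := by simpa using hi
      have hy' : s'.var y = N := by rw [hf.var y ((hwf y).2 ⟨hyx, hwy⟩), hy]
      refine wp_loop_false (by simp) (by simp [hx, hy']) (hQ _ _ hf hx hI (by omega))
    | succ k ih =>
      intro i hi s' hf hx hI t ht
      have hy' : s'.var y = N := by rw [hf.var y ((hwf y).2 ⟨hyx, hwy⟩), hy]
      have hlt : i < N := by omega
      refine wp_loop_true (by simp) (by simp [hx, hy', hlt]) ?_
      rw [wp_seq]
      have hs := hstep i hlt s' hf hx hI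
      refine wp_call (T := B i) (R := fun s'' => I (i + 1) (s''.set x (i + 1))) hs ?_
      intro s'' t'' hf'' ht'' hI''
      have hx'' : s''.var x = i := by rw [hf''.var x hwx, hx]
      simp only [wp_assign, Expr.ok_add, Expr.ok_var, Expr.ok_one, Expr.eval_add, Expr.eval_var,
        Expr.eval_one, hx'']
      refine ⟨⟨trivial, by omega, by omega⟩, ?_⟩
      refine ih (i + 1) (by omega) _ ?_ (by simp [St.set_var]) hI'' _ ?_
      · refine hf.trans ⟨fun z hz => ?_, fun d hd => ?_⟩
        · rw [hwf] at hz
          simp [St.set_var, Ne.symm hz.1, hf''.var z hz.2]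
        · rw [haf] at hd
          simp [hf''.arr d hd]
      · rw [Finset.sum_range_succ]; omega
  unfold Cmd.for
  rw [wp_seq, wp_assign]
  refine ⟨by simp; omega, ?_⟩
  refine key N 0 (by simp) (s.set x 0) ⟨fun z hz => ?_, fun _ _ => rfl⟩ (by simp [St.set_var]) h0 (t₀ + 1) (by simp)
  rw [hwf] at hz
  simp [St.set_var, Ne.symm hz.1]

/-- The rule for bounded loops with a uniform bound for the rounds. -/
theorem wp_for_const {x y : Var} {a : Cmd} (N : ℕ) (I : ℕ → St → Prop) (B : ℕ)
    (hy : s.var y = N) (hyx : x ≠ y) (hwy : a.wr y = false) (hwx : a.wr x = false) (hN : N < Z)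
    (h0 : I 0 (s.set x 0))
    (hstep : ∀ i < N, ∀ s', Frame (.for x y a) s s' → s'.var x = i → I i s' →
      wp Z a (fun s'' t => t ≤ B ∧ I (i + 1) (s''.set x (i + 1))) s' 0)
    (hQ : ∀ s' t, Frame (.for x y a) s s' → s'.var x = N → I N s' →
      t ≤ t₀ + N * (B + 2) + 2 → Q s' t) :
    wp Z (.for x y a) Q s t₀ :=
  wp_for N I (fun _ => B) hy hyx hwy hwx hN h0 hstep fun s' t h1 h2 h3 h4 =>
    hQ s' t h1 h2 h3 (by simpa using h4)

end

/-! ### Compilation -/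

/-- Register 0 is kept for the output and register 1 for the distance `Z` of the arrays. Variables
stay below 66; the registers from 66 on serve for intermediate results. -/
def Var.reg (x : Var) : ℕ := x.idx + 2

theorem Var.reg_inj {x y : Var} (h : x.reg = y.reg) : x = y :=
  Var.idx_inj (by simpa [Var.reg] using h)

theorem Var.reg_lt (x : Var) : x.reg < 66 := by
  have := x.idx_lt
  unfold Var.reg; omega

open RAM in
/-- Put the address of cell `i` of array `c` into register `r`, where `r` contains `i`.
Register `1` contains the distance `Z` of the arrays. -/
def address (c : Arr) (r : ℕ) : Prog :=
  .seq (.const (r + 1) c.idx) (.seq (.op .mul (r + 1) (r + 1) 1) (.op .add r r (r + 1)))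

-- The result goes to register `r`, and only registers from `r` on are overwritten. A bitwise `and`
-- of a register with itself serves as a move instruction. The array `inp` starts at address 0, so
-- it needs no address arithmetic.
open RAM in
def Expr.comp : Expr → ℕ → Prog
  | var x, r => .op .land r x.reg x.reg
  | lit n, r => .const r n
  | get .inp e, r => .seq (e.comp r) (.load r r)
  | get c e, r => .seq (e.comp r) (.seq (address c r) (.load r r))
  | bin o a b, r => .seq (a.comp r) (.seq (b.comp (r + 1)) (.op o.toOp r r (r + 1)))

def Expr.cost : Expr → ℕ
  | var _ => 1
  | lit _ => 1
  | get .inp e => e.cost + 1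
  | get _ e => e.cost + 4
  | bin _ a b => a.cost + b.cost + 1

/-- Whether an array other than the input is used. -/
def Expr.far : Expr → Bool
  | var _ => false
  | lit _ => false
  | get c e => c != .inp || e.far
  | bin _ a b => a.far || b.far

-- The machine tests a register, so the condition of a loop is evaluated once before the loop and
-- again at the end of every round.
open RAM in
def Cmd.comp : Cmd → Prog
  | skip => .const 66 0
  | assign x e => .seq (e.comp 66) (.op .land x.reg 66 66)
  | store c i e => .seq (e.comp 66) (.seq (i.comp 67) (.seq (address c 67) (.store 67 66)))
  | seq a b => .seq a.comp b.comp
  | ite e a b => .seq (e.comp 66) (.ite 66 a.comp b.comp)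
  | loop e a => .seq (e.comp 66) (.loop 66 (.seq a.comp (e.comp 66)))

/-- A bound for the number of RAM steps per step. -/
def Cmd.slow : Cmd → ℕ
  | skip => 1
  | assign _ e => e.cost + 1
  | store _ i e => e.cost + i.cost + 4
  | seq a b => max a.slow b.slow
  | ite e a b => max (e.cost + 1) (max a.slow b.slow)
  | loop e a => max (e.cost + 1) a.slow

/-- A store always counts, even into `inp`, since its address is computed with register 1. -/
def Cmd.far : Cmd → Bool
  | skip => false
  | assign _ e => e.far
  | store _ _ _ => true
  | seq a b => a.far || b.far
  | ite e a b => e.far || a.far || b.far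
  | loop e a => e.far || a.far

/-- The RAM state `r` represents the state `s`. -/
structure Rel (Z : ℕ) (r : RAM.State) (s : St) : Prop where
  var_eq : ∀ x : Var, r.reg x.reg = s.var x
  var_lt : ∀ x, s.var x < Z
  mem_eq : ∀ (c : Arr) (i : ℕ), i < Z → r.mem (c.idx * Z + i) = s.arr c i
  arr_lt : ∀ (c : Arr) (i : ℕ), i < Z → s.arr c i < Z

theorem Rel.of_eq {Z : ℕ} {r r' : RAM.State} {s : St} (h : Rel Z r s)
    (h1 : ∀ x < 66, r'.reg x = r.reg x) (h2 : r'.mem = r.mem) : Rel Z r' s :=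
  ⟨fun x => by rw [h1 _ x.reg_lt, h.var_eq], h.var_lt, fun c i hi => by rw [h2, h.mem_eq c i hi],
    h.arr_lt⟩

section
variable {Z b : ℕ} {r : RAM.State} {s : St}

theorem Expr.eval_lt (hZ : 2 ≤ Z) (h : Rel Z r s) {e : Expr} (he : e.Ok Z s) : e.eval s < Z := by
  induction e with
  | var x => exact h.var_lt x
  | lit n => exact he
  | get c e ih => exact h.arr_lt c _ (ih he)
  | bin o a b iha ihb =>
    cases o with
    | add => exact he.2.2
    | mul => exact he.2.2
    | sub =>
      have := iha he.1
      show a.eval s - b.eval s < Z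
      omega
    | mod => exact (Nat.mod_le _ _).trans_lt (iha he.1)
    | eq =>
      show (if a.eval s = b.eval s then 1 else 0) < Z
      split <;> omega
    | lt =>
      show (if a.eval s < b.eval s then 1 else 0) < Z
      split <;> omega

@[simp] theorem setReg_reg (r : RAM.State) (x v y : ℕ) :
    (r.setReg x v).reg y = if y = x then v else r.reg y := by
  simp [RAM.State.setReg, Function.update_apply]

@[simp] theorem setReg_mem (r : RAM.State) (x v : ℕ) : (r.setReg x v).mem = r.mem := rfl

@[simp] theorem setMem_reg (r : RAM.State) (x v : ℕ) : (r.setMem x v).reg = r.reg := rfl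

theorem Arr.address_lt (hb : 64 * Z ≤ 2 ^ b) (c : Arr) {i : ℕ} (hi : i < Z) :
    c.idx * Z + i < 2 ^ b := by
  have h1 := c.idx_lt
  have h2 : c.idx * Z ≤ 32 * Z := Nat.mul_le_mul_right _ h1.le
  omega

theorem exec_address (hb : 64 * Z ≤ 2 ^ b) (c : Arr) (k : ℕ) (hk : 66 ≤ k)
    (hz : r.reg 1 = Z) (hi : r.reg k < Z) :
    ∃ r', RAM.Exec b (address c k) r 3 r' ∧ r'.reg k = c.idx * Z + r.reg k ∧
      (∀ x < k, r'.reg x = r.reg x) ∧ r'.mem = r.mem := by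
  refine ⟨_, .seq (.const _ _ _) (.seq (t := 1) (t' := 1) (.op _ _ _ _ _) (.op _ _ _ _ _)), ?_, ?_, rfl⟩
  · have h1 := Arr.address_lt hb c hi
    have h2 := c.idx_lt
    have h3 : (1 : ℕ) ≠ k + 1 := by omega
    have hc : c.idx % 2 ^ b = c.idx := Nat.mod_eq_of_lt (by omega)
    have hc' : c.idx * Z % 2 ^ b = c.idx * Z := Nat.mod_eq_of_lt (by omega)
    simp only [RAM.Op.eval, setReg_reg, if_true, h3, if_false, hz, hc, hc',
      show k ≠ k + 1 by omega]
    rw [Nat.add_comm, Nat.mod_eq_of_lt h1]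
  · intro x hx
    simp [show x ≠ k by omega, show x ≠ k + 1 by omega]

/-- Evaluation follows a stack discipline: the second operand uses the registers from `k + 1` on and
leaves the first one in `k`. All values stay below `Z` and all addresses below `2 ^ b`, so the
reduction modulo `2 ^ b` never has an effect. -/
theorem exec_expr (hZ : 2 ≤ Z) (hb : 64 * Z ≤ 2 ^ b) (e : Expr) : ∀ (k : ℕ) (r : RAM.State),
    66 ≤ k → Rel Z r s → (e.far = true → r.reg 1 = Z) → e.Ok Z s →
    ∃ r', RAM.Exec b (e.comp k) r e.cost r' ∧ r'.reg k = e.eval s ∧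
      (∀ x < k, r'.reg x = r.reg x) ∧ r'.mem = r.mem := by
  induction e with
  | var x =>
    intro k r hk h hf he
    refine ⟨_, .op _ _ _ _ _, ?_, ?_, rfl⟩
    · have := h.var_lt x
      simp only [RAM.Op.eval, setReg_reg, if_true, h.var_eq, Nat.and_self]
      exact Nat.mod_eq_of_lt (by omega)
    · intro x hx; simp [show x ≠ k by omega]
  | lit n =>
    intro k r hk h hf he
    refine ⟨_, .const _ _ _, ?_, ?_, rfl⟩
    · have : n < Z := he
      simp only [setReg_reg, if_true]
      exact Nat.mod_eq_of_lt (by omega)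
    · intro x hx; simp [show x ≠ k by omega]
  | get c e ih =>
    intro k r hk h hf he
    obtain ⟨r1, e1, hv1, hr1, hm1⟩ := ih k r hk h (fun h' => hf (by simp [Expr.far, h'])) he
    have hlt := Expr.eval_lt hZ h (e := e) he
    have far : c ≠ .inp → ∃ r', RAM.Exec b
        (.seq (e.comp k) (.seq (address c k) (.load k k))) r (e.cost + 4) r' ∧
        r'.reg k = s.arr c (e.eval s) ∧ (∀ x < k, r'.reg x = r.reg x) ∧ r'.mem = r.mem := by
      intro hc
      obtain ⟨r2, e2, hv2, hr2, hm2⟩ := exec_address (r := r1) hb c k hk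
        (by rw [hr1 1 (by omega)]; exact hf (by simp [Expr.far, hc])) (by rw [hv1]; exact hlt)
      refine ⟨_, .seq e1 (.seq e2 (.load _ _ _)), ?_, ?_, ?_⟩
      · simp only [setReg_reg, if_true, hv2, hm2, hm1, hv1]
        exact h.mem_eq c _ hlt
      · intro x hx; simp [show x ≠ k by omega, hr2 x hx, hr1 x hx]
      · simp [hm2, hm1]
    cases c with
    | inp =>
      refine ⟨_, .seq e1 (.load _ _ _), ?_, ?_, ?_⟩
      · have := h.mem_eq .inp _ hlt
        simpa [Arr.idx, hv1, hm1] using this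
      · intro x hx; simp [show x ≠ k by omega, hr1 x hx]
      · simp [hm1]
    | _ => exact far (by simp)
  | bin o a c iha ihc =>
    intro k r hk h hf he
    have hao : a.Ok Z s := by cases o <;> exact he.1
    have hco : c.Ok Z s := by
      cases o with
      | add | mul => exact he.2.1
      | _ => exact he.2
    obtain ⟨r1, e1, hv1, hr1, hm1⟩ := iha k r hk h (fun h' => hf (by simp [Expr.far, h'])) hao
    have h1 : Rel Z r1 s := h.of_eq (fun x hx => hr1 x (by omega)) hm1
    obtain ⟨r2, e2, hv2, hr2, hm2⟩ := ihc (k + 1) r1 (by omega) h1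
      (fun h' => by rw [hr1 1 (by omega)]; exact hf (by simp [Expr.far, h'])) hco
    have e3 := RAM.Exec.seq e1 (.seq e2 (.op o.toOp k k (k + 1) _))
    rw [← Nat.add_assoc] at e3
    refine ⟨_, e3, ?_, ?_, ?_⟩
    · simp only [setReg_reg, if_true, hv2, hr2 k (by omega), hv1]
      have hlt := Expr.eval_lt hZ h (e := .bin o a c) he
      have : RAM.Op.eval b o.toOp (a.eval s) (c.eval s) = o.fn (a.eval s) (c.eval s) % 2 ^ b := by
        cases o <;> rfl
      rw [this, Nat.mod_eq_of_lt]
      · rfl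
      · exact hlt.trans_le (by omega)
    · intro x hx; simp [show x ≠ k by omega, hr2 x (by omega), hr1 x hx]
    · simp [hm2, hm1]

theorem Rel.set {x : Var} {v : ℕ} {r' : RAM.State} (h : Rel Z r s) (hv : v < Z)
    (h1 : ∀ y < 66, r'.reg y = if y = x.reg then v else r.reg y) (h2 : r'.mem = r.mem) :
    Rel Z r' (s.set x v) := by
  refine ⟨fun y => ?_, fun y => ?_, fun c i hi => by rw [h2, h.mem_eq c i hi]; rfl, h.arr_lt⟩
  · rw [h1 _ y.reg_lt, St.set_var]
    by_cases hy : y = x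
    · simp [hy]
    · have : y.reg ≠ x.reg := fun h' => hy (Var.reg_inj h')
      simp [hy, this, h.var_eq]
  · rw [St.set_var]
    split
    · exact hv
    · exact h.var_lt y

theorem Arr.address_inj {c c' : Arr} {i i' : ℕ} (hi : i < Z) (hi' : i' < Z)
    (h : c.idx * Z + i = c'.idx * Z + i') : c = c' ∧ i = i' := by
  have hZ : 0 < Z := by omega
  have h1 : (c.idx * Z + i) / Z = c.idx := by
    rw [Nat.mul_comm, Nat.mul_add_div hZ, Nat.div_eq_of_lt hi, Nat.add_zero]
  have h2 : (c'.idx * Z + i') / Z = c'.idx := by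
    rw [Nat.mul_comm, Nat.mul_add_div hZ, Nat.div_eq_of_lt hi', Nat.add_zero]
  have h3 : c.idx = c'.idx := by rw [← h1, ← h2, h]
  refine ⟨Arr.idx_inj h3, ?_⟩
  rw [h3] at h
  omega

theorem Rel.put {c : Arr} {i v : ℕ} {r' : RAM.State} (h : Rel Z r s) (hi : i < Z) (hv : v < Z)
    (h1 : ∀ y < 66, r'.reg y = r.reg y)
    (h2 : r'.mem = Function.update r.mem (c.idx * Z + i) v) : Rel Z r' (s.put c i v) := by
  refine ⟨fun y => ?_, h.var_lt, fun c' i' hi' => ?_, fun c' i' hi' => ?_⟩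
  · rw [h1 _ y.reg_lt, h.var_eq]; rfl
  · rw [h2, Function.update_apply, St.put_arr]
    by_cases hh : c'.idx * Z + i' = c.idx * Z + i
    · obtain ⟨rfl, rfl⟩ := Arr.address_inj hi' hi hh
      simp
    · rw [if_neg hh, h.mem_eq _ _ hi']
      by_cases hc : c' = c
      · subst hc
        have : i' ≠ i := fun h' => hh (by rw [h'])
        simp [this]
      · simp [hc]
  · rw [St.put_arr]
    split
    · split
      · exact hv
      · exact h.arr_lt _ _ hi'
    · exact h.arr_lt _ _ hi'

/-- Correctness of the compilation. -/
theorem exec_cmd (hZ : 2 ≤ Z) (hb : 64 * Z ≤ 2 ^ b) {c : Cmd} {s s' : St} {t : ℕ}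
    (hrun : Run Z c s t s') : ∀ r : RAM.State, Rel Z r s → (c.far = true → r.reg 1 = Z) →
    ∃ t' r', RAM.Exec b c.comp r t' r' ∧ t' ≤ c.slow * t ∧ Rel Z r' s' ∧ r'.reg 1 = r.reg 1 := by
  induction hrun with
  | skip s =>
    intro r h hf
    refine ⟨_, _, .const _ _ _, le_rfl, h.of_eq (fun x hx => ?_) rfl, by simp⟩
    simp [show x ≠ 66 by omega]
  | @assign x e s he =>
    intro r h hf
    obtain ⟨r1, e1, hv1, hr1, hm1⟩ := exec_expr hZ hb e 66 r le_rfl h hf he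
    have hlt := Expr.eval_lt hZ h he
    refine ⟨_, _, .seq e1 (.op _ _ _ _ _), by simp [Cmd.slow], h.set hlt (fun y hy => ?_) (by simp [hm1]), ?_⟩
    · simp only [setReg_reg, RAM.Op.eval, Nat.and_self, hv1]
      rw [Nat.mod_eq_of_lt (by omega), hr1 y hy]
    · have : (1 : ℕ) ≠ x.reg := by unfold Var.reg; omega
      simp [this, hr1]
  | @store c i e s hi he =>
    intro r h hf
    have hf : r.reg 1 = Z := hf rfl
    obtain ⟨r1, e1, hv1, hr1, hm1⟩ := exec_expr hZ hb e 66 r le_rfl h (fun _ => hf) he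
    have h1 : Rel Z r1 s := h.of_eq hr1 hm1
    obtain ⟨r2, e2, hv2, hr2, hm2⟩ := exec_expr hZ hb i 67 r1 (by omega) h1
      (fun _ => by rw [hr1 1 (by omega), hf]) hi
    have hlt := Expr.eval_lt hZ h hi
    obtain ⟨r3, e3, hv3, hr3, hm3⟩ := exec_address (r := r2) hb c 67 (by omega)
      (by rw [hr2 1 (by omega), hr1 1 (by omega), hf]) (by rw [hv2]; exact hlt)
    refine ⟨_, _, .seq e1 (.seq e2 (.seq e3 (.store _ _ _))), ?_,
      h.put hlt (Expr.eval_lt hZ h he) (fun y hy => ?_) ?_, ?_⟩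
    · simp only [Cmd.slow]; omega
    · simp [hr3 y (by omega), hr2 y (by omega), hr1 y hy]
    · simp [RAM.State.setMem, hv3, hm3, hm2, hm1, hv2, hr3 66 (by omega), hr2 66 (by omega), hv1]
    · simp [hr3 1 (by omega), hr2 1 (by omega), hr1 1]
  | @seq a c s s' s'' t t' _ _ iha ihb =>
    intro r h hf
    obtain ⟨t1, r1, e1, ht1, h1, hz1⟩ := iha r h (fun h' => hf (by simp [Cmd.far, h']))
    obtain ⟨t2, r2, e2, ht2, h2, hz2⟩ := ihb r1 h1 (fun h' => by rw [hz1]; exact hf (by simp [Cmd.far, h']))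
    refine ⟨_, _, .seq e1 e2, ?_, h2, by rw [hz2, hz1]⟩
    have ha : a.slow * t ≤ max a.slow c.slow * t := Nat.mul_le_mul_right _ (le_max_left _ _)
    have hc : c.slow * t' ≤ max a.slow c.slow * t' := Nat.mul_le_mul_right _ (le_max_right _ _)
    simp only [Cmd.slow, Nat.mul_add]
    omega
  | @ite_true e a c s s' t he h0 _ ih =>
    intro r h hf
    obtain ⟨r1, e1, hv1, hr1, hm1⟩ := exec_expr hZ hb e 66 r le_rfl h
      (fun h' => hf (by simp [Cmd.far, h'])) he
    obtain ⟨t2, r2, e2, ht2, h2, hz2⟩ := ih r1 (h.of_eq hr1 hm1)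
      (fun h' => by rw [hr1 1 (by omega)]; exact hf (by simp [Cmd.far, h']))
    refine ⟨_, _, .seq e1 (.ite_true (by rwa [hv1]) e2), ?_, h2, by rw [hz2, hr1 1 (by omega)]⟩
    have ha : a.slow * t ≤ max (e.cost + 1) (max a.slow c.slow) * t :=
      Nat.mul_le_mul_right _ (by omega)
    simp only [Cmd.slow, Nat.mul_add]
    omega
  | @ite_false e a c s s' t he h0 _ ih =>
    intro r h hf
    obtain ⟨r1, e1, hv1, hr1, hm1⟩ := exec_expr hZ hb e 66 r le_rfl h
      (fun h' => hf (by simp [Cmd.far, h'])) he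
    obtain ⟨t2, r2, e2, ht2, h2, hz2⟩ := ih r1 (h.of_eq hr1 hm1)
      (fun h' => by rw [hr1 1 (by omega)]; exact hf (by simp [Cmd.far, h']))
    refine ⟨_, _, .seq e1 (.ite_false (by rwa [hv1]) e2), ?_, h2, by rw [hz2, hr1 1 (by omega)]⟩
    have ha : c.slow * t ≤ max (e.cost + 1) (max a.slow c.slow) * t :=
      Nat.mul_le_mul_right _ (by omega)
    simp only [Cmd.slow, Nat.mul_add]
    omega
  | @loop_true e a s s' s'' t t' he h0 _ _ iha ihl =>
    intro r h hf
    obtain ⟨r1, e1, hv1, hr1, hm1⟩ := exec_expr hZ hb e 66 r le_rfl h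
      (fun h' => hf (by simp [Cmd.far, h'])) he
    obtain ⟨t2, r2, e2, ht2, h2, hz2⟩ := iha r1 (h.of_eq hr1 hm1)
      (fun h' => by rw [hr1 1 (by omega)]; exact hf (by simp [Cmd.far, h']))
    obtain ⟨t3, r3, e3, ht3, h3, hz3⟩ := ihl r2 h2
      (fun h' => by rw [hz2, hr1 1 (by omega)]; exact hf h')
    -- The induction hypothesis gives a run of the remaining compiled loop, beginning with an
    -- evaluation of the condition. That evaluation is cut off and becomes the end of the present
    -- round.
    cases e3 with
    | @seq _ _ _ r' _ u u' e3 e4 =>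
      refine ⟨_, _, .seq e1 (.loop_true (by rwa [hv1]) (.seq e2 e3) e4), ?_, h3,
        by rw [hz3, hz2, hr1 1 (by omega)]⟩
      have ha : a.slow * t ≤ max (e.cost + 1) a.slow * t := Nat.mul_le_mul_right _ (by omega)
      simp only [Cmd.slow, Nat.mul_add] at ht3 ⊢
      omega
  | @loop_false e a s he h0 =>
    intro r h hf
    obtain ⟨r1, e1, hv1, hr1, hm1⟩ := exec_expr hZ hb e 66 r le_rfl h
      (fun h' => hf (by simp [Cmd.far, h'])) he
    refine ⟨_, _, .seq e1 (.loop_false (by rwa [hv1])), ?_, h.of_eq hr1 hm1, hr1 1 (by omega)⟩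
    simp only [Cmd.slow]
    omega

end

/-! ### Lists in memory and the decoding of binary bounds -/

/-- `M` bounds the data of an instance, and `Z` is large compared to the square of `M`. -/
structure Big (M Z : ℕ) : Prop where
  le : 16 ≤ M
  sq_le : 16 * (M * M) ≤ Z

theorem Big.lin {M Z : ℕ} (h : Big M Z) : 256 * M ≤ Z := by
  have := Nat.mul_le_mul_right M h.le
  have := h.sq_le
  omega

/-- The list `l` is stored in `f` from position `p` on. -/
def StoredAt (f : ℕ → ℕ) (p : ℕ) (l : List ℕ) : Prop := ∀ i (h : i < l.length), f (p + i) = l[i]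

theorem storedAt_append {f : ℕ → ℕ} {p : ℕ} {a b : List ℕ} :
    StoredAt f p (a ++ b) ↔ StoredAt f p a ∧ StoredAt f (p + a.length) b := by
  constructor
  · intro h
    refine ⟨fun i hi => ?_, fun i hi => ?_⟩
    · rw [h i (by simp; omega), List.getElem_append_left]
    · rw [Nat.add_assoc, h (a.length + i) (by simp; omega), List.getElem_append_right (by omega)]
      simp
  · rintro ⟨h1, h2⟩ i hi
    by_cases h : i < a.length
    · rw [h1 i h, List.getElem_append_left]
    · rw [List.getElem_append_right (by omega), ← h2]
      congr 1
      omega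

theorem storedAt_cons {f : ℕ → ℕ} {p x : ℕ} {l : List ℕ} :
    StoredAt f p (x :: l) ↔ f p = x ∧ StoredAt f (p + 1) l := by
  constructor
  · intro h
    refine ⟨h 0 (by simp), fun i hi => ?_⟩
    rw [Nat.add_assoc, Nat.add_comm 1, h (i + 1) (by simpa using hi)]
    simp
  · rintro ⟨h1, h2⟩ i hi
    cases i with
    | zero => simpa using h1
    | succ i =>
      have := h2 i (by simpa using hi)
      rw [Nat.add_assoc, Nat.add_comm 1] at this
      simpa using this

/-- The bound `b`, with all values above `m` replaced by `m + 1`. -/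
def clip (m : ℕ) : ℕ∞ → ℕ
  | ⊤ => m + 1
  | (n : ℕ) => min n (m + 1)

/-- Decode the bound at `ptr` up to values above `m`. -/
def decode : Cmd :=
  .ite (.get .inp Var.ptr) (.val ::= (Var.m : Expr) + 1)
    (.nb ::= .get .inp ((Var.ptr : Expr) + 1) ;;
      .ite (Expr.ltt Var.m Var.nb) (.val ::= (Var.m : Expr) + 1)
        (.val ::= 0 ;;
          .for .u .nb
            (.val ::= (Var.val : Expr) + Var.val +
                .get .inp ((Var.ptr : Expr) + 1 + ((Var.nb : Expr) - Var.u)) ;;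
              .ite (Expr.ltt Var.m Var.val) (.val ::= (Var.m : Expr) + 1) .skip)))

theorem bits_getElem (n i : ℕ) (h : i < n.bits.length) : n.bits[i].toNat = n / 2 ^ i % 2 := by
  rw [← Nat.toNat_testBit, Nat.testBit_eq_inth, List.getI_eq_getElem _ h]

/-- Horner's scheme from the most significant digit, cut off at `m + 1` in every round. There are no
leading zeros, so more than `m` digits mean a value of at least `2 ^ m > m`, and the digits need not
be read. Hence the time depends on `m` only, not on the number of digits. -/
theorem decode_spec {M Z m : ℕ} {s : St} (hB : Big M Z) (bd : ℕ∞) (hm : s.var .m = m) (hmM : m ≤ M)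
    (hp : s.var .ptr + (encodeBound bd).length ≤ M)
    (hat : StoredAt (s.arr .inp) (s.var .ptr) (encodeBound bd)) :
    wp Z decode (fun s' t => t ≤ 6 * (m + 1) ∧ s'.var .val = clip m bd) s 0 := by
  have hl := hB.lin
  have hle := hB.le
  cases bd using ENat.recTopCoe with
  | top =>
    have hat' : StoredAt (s.arr .inp) (s.var .ptr) [1] := hat
    rw [storedAt_cons] at hat'
    simp only [decode, wp_ite, Expr.ok_get, Expr.ok_var, Expr.eval_get, Expr.eval_var, hat'.1, wp_assign,
      Expr.ok_add, Expr.ok_one, Expr.eval_add, Expr.eval_one, hm, St.set_var]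
    refine ⟨trivial, fun _ => ⟨⟨trivial, by omega, by omega⟩, by omega, rfl⟩, by simp⟩
  | coe n =>
    have hat' : StoredAt (s.arr .inp) (s.var .ptr) (0 :: n.bits.length :: n.bits.map Bool.toNat) := hat
    have hlen : (encodeBound n).length = n.bits.length + 2 := by
      show (0 :: n.bits.length :: n.bits.map Bool.toNat).length = _
      simp
    rw [hlen] at hp
    rw [storedAt_cons, storedAt_cons] at hat'
    obtain ⟨h0, h1, hbits⟩ := hat'
    have hclip : clip m (n : ℕ∞) = min n (m + 1) := rfl
    rw [hclip]
    have hsz : n < 2 ^ n.bits.length := by rw [Nat.size_eq_bits_len]; exact Nat.lt_size_self n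
    have hsz' : ∀ k, k < n.bits.length → 2 ^ k ≤ n := by
      intro k hk; rw [Nat.size_eq_bits_len] at hk; exact Nat.lt_size.1 hk
    simp only [decode, wp_ite, wp_seq, wp_assign, Expr.ok_get, Expr.ok_var, Expr.ok_add, Expr.ok_one,
      Expr.eval_get, Expr.eval_var, Expr.eval_add, Expr.eval_one, Expr.ok_ltt, Expr.eval_ltt,
      Expr.ok_zero, Expr.eval_zero, h0, h1, hm, St.set_var, St.set_arr, reduceCtorEq, if_true, if_false]
    refine ⟨trivial, by simp, fun _ => ⟨⟨trivial, by omega, by omega⟩, ⟨trivial, trivial⟩, ?_, ?_⟩⟩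
    · intro hlt
      have hlt : m < n.bits.length := by simpa using hlt
      refine ⟨⟨trivial, by omega, by omega⟩, by omega, ?_⟩
      have h2 := hsz' m hlt
      have h3 : m < 2 ^ m := Nat.lt_two_pow_self
      omega
    · intro hge
      have hge : n.bits.length ≤ m := by simpa using hge
      refine ⟨by omega, ?_⟩
      -- After `i` rounds `val` is the number formed by the `i` leading digits, clipped; clipping is
      -- compatible with doubling and adding a digit.
      refine wp_for_const n.bits.length
        (fun i s' => s'.var .val = min (n / 2 ^ (n.bits.length - i)) (m + 1)) 3
        (by simp [St.set_var]) (by simp) rfl rfl (by omega) ?_ ?_ ?_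
      · simp [St.set_var, Nat.div_eq_of_lt hsz]
      · intro i hi s' hf hu hI
        have hnb : s'.var .nb = n.bits.length := by rw [hf.var _ rfl]; simp [St.set_var]
        have hptr : s'.var .ptr = s.var .ptr := by rw [hf.var _ rfl]; simp [St.set_var]
        have hmm : s'.var .m = m := by rw [hf.var _ rfl]; simp [St.set_var, hm]
        have hinp : s'.arr .inp = s.arr .inp := by rw [hf.arr _ rfl]; simp [St.set_arr]
        have hb : s.arr .inp (s.var .ptr + 1 + (n.bits.length - i))
            = n / 2 ^ (n.bits.length - (i + 1)) % 2 := by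
          have := hbits (n.bits.length - (i + 1)) (by simp; omega)
          rw [List.getElem_map, bits_getElem] at this
          rw [← this]
          congr 1
          omega
        have hdiv : n / 2 ^ (n.bits.length - i) = n / 2 ^ (n.bits.length - (i + 1)) / 2 := by
          rw [Nat.div_div_eq_div_mul, ← Nat.pow_succ]
          congr 2
          omega
        simp only [wp_ite, wp_seq, wp_assign, wp_skip, Expr.ok_get, Expr.ok_var, Expr.ok_add, Expr.ok_one,
          Expr.eval_get, Expr.eval_var, Expr.eval_add, Expr.eval_one, Expr.ok_ltt, Expr.eval_ltt,
          Expr.ok_sub, Expr.eval_sub, hnb, hu, hptr, hmm, hinp, hb, hI, hdiv,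
          St.set_var, St.set_arr, reduceCtorEq, if_true, if_false]
        have := Nat.mod_lt (n / 2 ^ (n.bits.length - (i + 1))) (show 0 < 2 by omega)
        generalize n / 2 ^ (n.bits.length - (i + 1)) = y at *
        refine ⟨⟨⟨trivial, trivial, by omega⟩, ⟨⟨trivial, by omega, by omega⟩, ⟨trivial, trivial⟩, by omega⟩,
          by omega⟩, ⟨trivial, trivial⟩, ?_, ?_⟩
        · intro h
          have h : m < min (y / 2) (m + 1) + min (y / 2) (m + 1) + y % 2 := by simpa using h
          exact ⟨⟨trivial, by omega, by omega⟩, by omega, by omega⟩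
        · intro h
          have h : min (y / 2) (m + 1) + min (y / 2) (m + 1) + y % 2 ≤ m := by simpa using h
          exact ⟨by omega, by omega⟩
      · intro s' t hf hu hI ht
        refine ⟨?_, by simpa using hI⟩
        have := Nat.mul_le_mul_right 5 hge
        omega

/-! ### One step of the dynamic program for a general gap constraint -/

/-- The state of an automaton that starts in state `s` at position `x` of the word `w` and reads `m`
letters. -/
def runN (tr : ℕ → ℕ → ℕ) (w : ℕ → ℕ) (s x : ℕ) : ℕ → ℕ
  | 0 => s
  | m + 1 => tr (runN tr w s x m) (w (x + m))

theorem runN_add (tr : ℕ → ℕ → ℕ) (w : ℕ → ℕ) (s x m m' : ℕ) :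
    runN tr w s x (m + m') = runN tr w (runN tr w s x m) (x + m) m' := by
  induction m' with
  | zero => rfl
  | succ m' ih => rw [← Nat.add_assoc, runN, ih, runN, Nat.add_assoc]

theorem runN_cons (tr : ℕ → ℕ → ℕ) (w : ℕ → ℕ) (s x m : ℕ) :
    runN tr w s x (m + 1) = runN tr w (tr s (w x)) (x + 1) m := by
  rw [Nat.add_comm, runN_add]
  rfl

/-- The data of a single step of the dynamic program: a word, a letter, and a gap constraint. -/
structure StepData where
  n : ℕ
  wb : ℕ
  rin : ℕ
  rout : ℕ
  a : ℕ
  sg : ℕ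
  q : ℕ
  st : ℕ
  ac : ℕ
  lo : ℕ
  hi : ℕ
  w : ℕ → ℕ
  acc : ℕ → Prop
  tr : ℕ → ℕ → ℕ

/-- The block length. For `lo = 0` the value 1 only avoids a reduction modulo 0; the block tables
are then not consulted. -/
def StepData.lm (D : StepData) : ℕ := max D.lo 1

/-- The state `s` holds the data `D`. -/
structure StepPre (M : ℕ) (D : StepData) (s : St) : Prop where
  n : s.var .n = D.n
  wb : s.var .wb = D.wb
  rin : s.var .rin = D.rin
  rout : s.var .rout = D.rout
  a : s.var .a = D.a
  sg : s.var .sig = D.sg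
  q : s.var .q = D.q
  st : s.var .st = D.st
  ac : s.var .ac = D.ac
  lo : s.var .lo = D.lo
  hi : s.var .hi = D.hi
  tr : s.var .tr = D.ac + D.q
  lm : s.var .lm = D.lm
  word : ∀ j < D.n, s.arr .inp (D.wb + j) = D.w j
  word_lt : ∀ j < D.n, D.w j < D.sg
  acc : ∀ x < D.q, s.arr .inp (D.ac + x) ≠ 0 ↔ D.acc x
  trans : ∀ x < D.q, ∀ y < D.sg, s.arr .inp (D.ac + D.q + x * D.sg + y) = D.tr x y
  trans_lt : ∀ x < D.q, ∀ y < D.sg, D.tr x y < D.q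
  st_lt : D.st < D.q
  word_le : D.wb + D.n ≤ M
  dfa_le : D.ac + D.q + D.q * D.sg ≤ M
  lo_le : D.lo ≤ M
  rin_le : D.rin + D.n ≤ D.rout
  rout_le : D.rout + D.n ≤ 4 * (M * M)

/-- The command leaves the data of a step unchanged. -/
def Cmd.keeps (c : Cmd) : Bool :=
  [Var.n, .wb, .rin, .rout, .a, .sig, .q, .st, .ac, .lo, .hi, .tr, .lm].all (fun x => !c.wr x) &&
    !c.awr .inp

theorem StepPre.frame {M : ℕ} {D : StepData} {s s' : St} {c : Cmd} (h : StepPre M D s)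
    (hf : Frame c s s') (hc : c.keeps = true) : StepPre M D s' := by
  simp only [Cmd.keeps, List.all_cons, List.all_nil, Bool.and_eq_true, Bool.not_eq_true',
    Bool.and_true] at hc
  obtain ⟨⟨h1, h2, h3, h4, h5, h6, h7, h8, h9, h10, h11, h12, h13⟩, h14⟩ := hc
  have hi : s'.arr .inp = s.arr .inp := hf.arr _ h14
  exact ⟨by rw [hf.var _ h1, h.n], by rw [hf.var _ h2, h.wb], by rw [hf.var _ h3, h.rin],
    by rw [hf.var _ h4, h.rout], by rw [hf.var _ h5, h.a], by rw [hf.var _ h6, h.sg],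
    by rw [hf.var _ h7, h.q], by rw [hf.var _ h8, h.st], by rw [hf.var _ h9, h.ac],
    by rw [hf.var _ h10, h.lo], by rw [hf.var _ h11, h.hi], by rw [hf.var _ h12, h.tr],
    by rw [hf.var _ h13, h.lm], by rw [hi]; exact h.word, h.word_lt, by rw [hi]; exact h.acc,
    by rw [hi]; exact h.trans, h.trans_lt, h.st_lt, h.word_le, h.dfa_le, h.lo_le, h.rin_le, h.rout_le⟩

theorem StepPre.runN_lt {M : ℕ} {D : StepData} {s : St} (h : StepPre M D s) {x p m : ℕ}
    (hx : x < D.q) (hm : p + m ≤ D.n) : runN D.tr D.w x p m < D.q := by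
  induction m with
  | zero => exact hx
  | succ m ih => exact h.trans_lt _ (ih (by omega)) _ (h.word_lt _ (by omega))

/-- The linear facts about sizes. -/
theorem StepPre.bounds {M Z : ℕ} {D : StepData} {s : St} (h : StepPre M D s) (hB : Big M Z) :
    256 * M ≤ Z ∧ 16 ≤ M ∧ 16 * (M * M) ≤ Z ∧ D.n ≤ M ∧ D.q ≤ M ∧ D.wb + D.n ≤ M ∧ D.ac + D.q ≤ M ∧
      D.rout + D.n ≤ 4 * (M * M) := by
  have := h.word_le
  have := h.dfa_le
  have := hB.lin
  have := hB.le
  exact ⟨hB.lin, hB.le, hB.sq_le, by omega, by omega, h.word_le, by omega, h.rout_le⟩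

theorem mul_add_lt {q x n s : ℕ} (hs : s < q) (hx : x < n) : x * q + s < n * q := by
  calc x * q + s < x * q + q := by omega
    _ = (x + 1) * q := by ring
    _ ≤ n * q := Nat.mul_le_mul_right _ hx

theorem StepPre.trans_le {M : ℕ} {D : StepData} {s : St} (h : StepPre M D s) {x y : ℕ} (hx : x < D.q)
    (hy : y < D.sg) : D.ac + D.q + x * D.sg + y < M := by
  have := mul_add_lt hy hx
  have := h.dfa_le
  omega

theorem StepPre.table_le {M : ℕ} {D : StepData} {s : St} (h : StepPre M D s) {x y : ℕ} (hx : x ≤ D.n)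
    (hy : y < D.q) (hn : D.n ≤ M) (hM : 1 ≤ M) (hq : D.q ≤ M) : x * D.q + y < 2 * (M * M) := by
  have h1 := mul_add_lt (n := D.n + 1) hy (by omega : x < D.n + 1)
  have h2 : (D.n + 1) * D.q ≤ (M + M) * M := Nat.mul_le_mul (by omega) hq
  have h3 : (M + M) * M = 2 * (M * M) := by ring
  omega

theorem mul_add_inj {q x x' s s' : ℕ} (hs : s < q) (hs' : s' < q) (h : x * q + s = x' * q + s') :
    x = x' ∧ s = s' := by
  have hq : 0 < q := by omega
  have h1 : (x * q + s) / q = x := by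
    rw [Nat.mul_comm, Nat.mul_add_div hq, Nat.div_eq_of_lt hs, Nat.add_zero]
  have h2 : (x' * q + s') / q = x' := by
    rw [Nat.mul_comm, Nat.mul_add_div hq, Nat.div_eq_of_lt hs', Nat.add_zero]
  have h3 : x = x' := by rw [← h1, ← h2, h]
  subst h3
  omega

/-- The distance from `x` to the next multiple of `l`, or to `n` if that is closer. -/
def toBlockEnd (n l x : ℕ) : ℕ := min (n - x) ((l - x % l) % l)

theorem toBlockEnd_self (n l : ℕ) : toBlockEnd n l n = 0 := by simp [toBlockEnd]

theorem toBlockEnd_of_dvd {n l x : ℕ} (h : x % l = 0) : toBlockEnd n l x = 0 := by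
  simp [toBlockEnd, h]

theorem toBlockEnd_succ {n l x : ℕ} (hl : 1 ≤ l) (hx : x < n) (h : x % l ≠ 0) :
    toBlockEnd n l x = toBlockEnd n l (x + 1) + 1 := by
  have h1 : x % l < l := Nat.mod_lt _ hl
  have h2 : (l - x % l) % l = l - x % l := Nat.mod_eq_of_lt (by omega)
  unfold toBlockEnd
  rw [h2]
  by_cases h3 : x % l + 1 = l
  · have h4 : (x + 1) % l = 0 := by
      rw [← Nat.mod_add_mod, h3, Nat.mod_self]
    rw [h4]
    simp
    omega
  · have h4 : (x + 1) % l = x % l + 1 := by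
      rw [Nat.add_mod, Nat.mod_eq_of_lt (show 1 < l by omega), Nat.mod_eq_of_lt (by omega)]
    rw [h4, Nat.mod_eq_of_lt (show l - (x % l + 1) < l by omega)]
    omega

/-- Table of the runs up to the next block end. -/
def backTable : Cmd :=
  .for .s .q (.store .tt ((Var.n : Expr) * Var.q + Var.s) Var.s) ;;
  .for .u .n
    (.x ::= (Var.n : Expr) - 1 - Var.u ;;
     .y ::= .get .inp ((Var.wb : Expr) + Var.x) ;;
     .for .s .q
      (.ite ((Var.x : Expr) % Var.lm)
        (.store .tt ((Var.x : Expr) * Var.q + Var.s)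
          (.get .tt (((Var.x : Expr) + 1) * Var.q +
            .get .inp ((Var.tr : Expr) + (Var.s : Expr) * Var.sig + Var.y))))
        (.store .tt ((Var.x : Expr) * Var.q + Var.s) Var.s)))

/-- The table is filled from right to left. At a block end the run is empty; elsewhere the run from
`x` reads one letter and continues as the run from `x + 1`. -/
theorem backTable_spec {M Z : ℕ} {D : StepData} {s : St} (hB : Big M Z) (hP : StepPre M D s) :
    wp Z backTable (fun s' t => t ≤ 20 * ((D.n + 1) * D.q) ∧ ∀ x ≤ D.n, ∀ y < D.q,
      s'.arr .tt (x * D.q + y) = runN D.tr D.w y x (toBlockEnd D.n D.lm x)) s 0 := by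
  obtain ⟨hl, hM, hMM, hn, hq, hwb, hac, hro⟩ := hP.bounds hB
  have hlm : 1 ≤ D.lm := le_max_right _ _
  have hq0 : 0 < D.q := Nat.zero_lt_of_lt hP.st_lt
  unfold backTable
  rw [wp_seq]
  -- Row `n` is the base of the recursion: the end of the word counts as a block end.
  refine wp_for_const D.q (fun i s' => ∀ y < i, s'.arr .tt (D.n * D.q + y) = y) 1 hP.q (by simp) rfl rfl
    (by omega) (by simp) ?_ ?_
  · intro i hi s' hf hs hI
    have hP' := hP.frame hf rfl
    have := hP.table_le le_rfl hi hn (by omega) hq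
    simp [hP'.n, hP'.q, hs]
    refine ⟨⟨by omega, by omega⟩, fun y hy => ?_⟩
    rw [St.put_arr]
    simp only [if_true, Nat.add_left_cancel_iff]
    split
    · omega
    · exact hI y (by omega)
  intro s1 t1 hf1 _ hI1 ht1
  have hP1 := hP.frame hf1 rfl
  refine wp_for_const D.n (fun i s' => ∀ x, D.n - i ≤ x → x ≤ D.n → ∀ y < D.q,
      s'.arr .tt (x * D.q + y) = runN D.tr D.w y x (toBlockEnd D.n D.lm x)) (4 * D.q + 4) hP1.n
    (by simp) rfl rfl (by omega) ?_ ?_ ?_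
  · intro x hx hx' y hy
    obtain rfl : x = D.n := by omega
    rw [toBlockEnd_self]
    exact hI1 y hy
  · intro i hi s' hf hu hI
    have hP' := hP1.frame hf rfl
    have hw := hP.word (D.n - 1 - i) (by omega)
    have hinp : s'.arr .inp = s.arr .inp := by rw [hf.arr _ rfl, hf1.arr _ rfl]
    simp only [wp_seq, wp_assign, Expr.ok_sub, Expr.ok_var, Expr.ok_one, Expr.ok_get, Expr.ok_add,
      Expr.eval_var, Expr.eval_sub, Expr.eval_add, Expr.eval_one, Expr.eval_get, hP'.n, hu, hP'.wb,
      hinp, hw, St.set_var, St.set_arr, reduceCtorEq, if_true, if_false]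
    refine ⟨⟨⟨trivial, by omega⟩, trivial⟩, ⟨trivial, trivial, by omega⟩, ?_⟩
    generalize hx : D.n - 1 - i = x
    have hxn : x < D.n := by omega
    refine wp_for_const D.q (fun k s' => ∀ x', ∀ y < D.q, (x < x' ∧ x' ≤ D.n ∨ x' = x ∧ y < k) →
      s'.arr .tt (x' * D.q + y) = runN D.tr D.w y x' (toBlockEnd D.n D.lm x')) 2
      (by simp [hP'.q]) (by simp) rfl rfl (by omega) ?_ ?_ ?_
    · intro x' y hy h
      rcases h with h | h
      · exact hI x' (by omega) (by omega) y hy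
      · omega
    · intro k hk s2 hf2 hs2 hI2
      have hq2 : s2.var .q = D.q := by rw [hf2.var _ rfl]; simp [hP'.q]
      have hx2 : s2.var .x = x := by rw [hf2.var _ rfl]; simp
      have hy2 : s2.var .y = D.w x := by rw [hf2.var _ rfl]; simp
      have hsg2 : s2.var .sig = D.sg := by rw [hf2.var _ rfl]; simp [hP'.sg]
      have htr2 : s2.var .tr = D.ac + D.q := by rw [hf2.var _ rfl]; simp [hP'.tr]
      have hlm2 : s2.var .lm = D.lm := by rw [hf2.var _ rfl]; simp [hP'.lm]
      have hinp2 : s2.arr .inp = s.arr .inp := by rw [hf2.arr _ rfl]; simp [hinp]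
      have hwl := hP.word_lt x hxn
      have htr := hP.trans k hk _ hwl
      have htrl := hP.trans_lt k hk _ hwl
      have htrM := hP.trans_le hk hwl
      have ht1 := hP.table_le (by omega : x ≤ D.n) hk hn (by omega) hq
      have ht2 := hP.table_le (by omega : x + 1 ≤ D.n) htrl hn (by omega) hq
      have hnew := hI2 (x + 1) (D.tr k (D.w x)) htrl (by omega)
      have hput : ∀ v, v = runN D.tr D.w k x (toBlockEnd D.n D.lm x) → ∀ x', ∀ y < D.q,
          (x < x' ∧ x' ≤ D.n ∨ x' = x ∧ y < k + 1) →
          ((s2.put .tt (x * D.q + k) v).set .s (k + 1)).arr .tt (x' * D.q + y) =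
            runN D.tr D.w y x' (toBlockEnd D.n D.lm x') := by
        intro v hv x' y hy h
        rw [St.set_arr, St.put_arr]
        simp only [if_true]
        split
        · next h' =>
          obtain ⟨rfl, rfl⟩ := mul_add_inj hy hk h'
          exact hv
        · next h' =>
          refine hI2 x' y hy ?_
          rcases h with h | ⟨rfl, h⟩
          · exact Or.inl h
          · refine Or.inr ⟨rfl, ?_⟩
            have : y ≠ k := fun h'' => h' (by rw [h''])
            omega
      simp only [wp_ite, wp_store, Expr.ok_mod, Expr.ok_var, Expr.ok_add, Expr.ok_mul, Expr.ok_get,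
        Expr.ok_one, Expr.eval_mod, Expr.eval_var, Expr.eval_add, Expr.eval_mul, Expr.eval_get,
        Expr.eval_one, hq2, hx2, hy2, hsg2, htr2, hlm2, hs2, hinp2, htr, hnew]
      refine ⟨⟨trivial, trivial⟩, fun h => ⟨⟨⟨trivial, trivial, by omega⟩, trivial, by omega⟩, ?_,
        by omega, hput _ ?_⟩, fun h => ⟨⟨⟨trivial, trivial, by omega⟩, trivial, by omega⟩, trivial, by omega,
        hput _ ?_⟩⟩
      · exact ⟨⟨⟨trivial, by omega, by omega⟩, trivial, by omega⟩,
          ⟨⟨trivial, ⟨trivial, trivial, by omega⟩, by omega⟩, trivial, by omega⟩, by omega⟩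
      · rw [toBlockEnd_succ hlm hxn h, runN_cons]
      · rw [toBlockEnd_of_dvd h]; rfl
    · intro s2 t2 hf2 _ hI2 ht2
      refine ⟨by omega, fun x' hx' hx'' y hy => ?_⟩
      exact hI2 x' y hy (by omega)
  · intro s' t hf _ hI ht
    refine ⟨?_, fun x hx y hy => hI x (by omega) hx y hy⟩
    have h1 : D.n * 1 ≤ D.n * D.q := Nat.mul_le_mul_left _ hq0
    have h2 : D.n * (4 * D.q + 4 + 2) = 4 * (D.n * D.q) + 6 * D.n := by ring
    have h3 : (D.n + 1) * D.q = D.n * D.q + D.q := by ring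
    omega

theorem of_ite_ne {P : Prop} [Decidable P] (h : (if P then (1 : ℕ) else 0) ≠ 0) : P := by
  by_contra h'
  simp [h'] at h

theorem of_ite_eq {P : Prop} [Decidable P] (h : (if P then (1 : ℕ) else 0) = 0) : ¬ P := by
  intro h'
  simp [h'] at h

/-- Decide whether the position `p` is reachable. -/
def acceptAt : Cmd :=
  .d ::= 0 ;;
  .for .s .q
    (.ite (.get .inp ((Var.ac : Expr) + Var.s))
      (.ite (.get .bb Var.s)
        (.ite (Expr.ltt Var.hi ((Var.p : Expr) - .get .bb Var.s)) .skip (.d ::= 1)) .skip) .skip) ;;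
  .store .row ((Var.rout : Expr) + Var.p) Var.d

/-- An entry `j + 1` of `bb` stands for the start `j`, and 0 stands for no start; so `p` minus the
entry is the length of the gap between `j` and `p`. -/
theorem acceptAt_spec {M Z p : ℕ} {D : StepData} {s : St} (hB : Big M Z) (hP : StepPre M D s)
    (hp : s.var .p = p) (hpn : p < D.n) :
    wp Z acceptAt (fun s' t => t ≤ 12 * D.q ∧ ∃ v,
      s'.arr .row = Function.update (s.arr .row) (D.rout + p) v ∧
      (v ≠ 0 ↔ ∃ x < D.q, D.acc x ∧ s.arr .bb x ≠ 0 ∧ p - s.arr .bb x ≤ D.hi)) s 0 := by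
  obtain ⟨hl, hM, hMM, hn, hq, hwb, hac, hro⟩ := hP.bounds hB
  have hq0 : 0 < D.q := Nat.zero_lt_of_lt hP.st_lt
  unfold acceptAt
  simp only [wp_seq, wp_assign, Expr.ok_zero, Expr.eval_zero]
  refine ⟨by omega, ?_⟩
  refine wp_for_const D.q (fun i s' => s'.var .d ≠ 0 ↔ ∃ x < i, D.acc x ∧ s.arr .bb x ≠ 0 ∧
    p - s.arr .bb x ≤ D.hi) 5 (by simp [hP.q]) (by simp) rfl rfl (by omega) (by simp) ?_ ?_
  · intro i hi s' hf hs hI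
    have hac' : s'.var .ac = D.ac := by rw [hf.var _ rfl]; simp [hP.ac]
    have hhi' : s'.var .hi = D.hi := by rw [hf.var _ rfl]; simp [hP.hi]
    have hp' : s'.var .p = p := by rw [hf.var _ rfl]; simp [hp]
    have hinp : s'.arr .inp = s.arr .inp := by rw [hf.arr _ rfl]; simp
    have hbb : s'.arr .bb = s.arr .bb := by rw [hf.arr _ rfl]; simp
    have hacc := hP.acc i hi
    have hold : (s'.var .d ≠ 0 ∨ D.acc i ∧ s.arr .bb i ≠ 0 ∧ p - s.arr .bb i ≤ D.hi) ↔
        ∃ x < i + 1, D.acc x ∧ s.arr .bb x ≠ 0 ∧ p - s.arr .bb x ≤ D.hi := by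
      constructor
      · rintro (h | h)
        · obtain ⟨x, hx, h⟩ := hI.1 h
          exact ⟨x, by omega, h⟩
        · exact ⟨i, by omega, h⟩
      · rintro ⟨x, hx, h⟩
        by_cases hxi : x = i
        · subst hxi; exact Or.inr h
        · exact Or.inl (hI.2 ⟨x, by omega, h⟩)
    simp only [wp_ite, wp_skip, wp_assign, Expr.ok_get, Expr.ok_add, Expr.ok_var, Expr.eval_get,
      Expr.eval_add, Expr.eval_var, hac', hs, hinp, hbb, hhi', hp', Expr.ok_ltt, Expr.ok_sub,
      Expr.eval_ltt, Expr.eval_sub, Expr.ok_one, Expr.eval_one, St.set_var, reduceCtorEq, if_true, if_false]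
    refine ⟨⟨trivial, trivial, by omega⟩, fun h1 => ⟨trivial, fun h2 => ⟨⟨trivial, trivial, trivial⟩,
      fun h3 => ⟨by omega, ?_⟩, fun h3 => ⟨by omega, by omega, ?_⟩⟩, fun h2 => ⟨by omega, ?_⟩⟩,
      fun h1 => ⟨by omega, ?_⟩⟩
    · rw [← hold]
      have h3 := of_ite_ne h3
      exact ⟨Or.inl, fun h => h.resolve_right fun h' => by omega⟩
    · rw [← hold]
      have h3 : p - s.arr .bb i ≤ D.hi := by simpa using h3
      simp only [ne_eq, one_ne_zero, not_false_eq_true, true_iff]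
      exact Or.inr ⟨hacc.1 h1, h2, h3⟩
    · rw [← hold]
      exact ⟨Or.inl, fun h => h.resolve_right fun h' => h'.2.1 h2⟩
    · rw [← hold]
      exact ⟨Or.inl, fun h => h.resolve_right fun h' => hacc.2 h'.1 h1⟩
  · intro s' t hf _ hI ht
    have hro' : s'.var .rout = D.rout := by rw [hf.var _ rfl]; simp [hP.rout]
    have hp' : s'.var .p = p := by rw [hf.var _ rfl]; simp [hp]
    have hrow : s'.arr .row = s.arr .row := by rw [hf.arr _ rfl]; simp
    simp only [wp_store, Expr.ok_add, Expr.ok_var, Expr.eval_add, Expr.eval_var, hro', hp']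
    refine ⟨⟨trivial, trivial, by omega⟩, trivial, by omega, _, ?_, hI⟩
    rw [St.put_arr_self, hrow]

/-- Advance the transition tables since the last block end by the letter at `p`. -/
def advanceTable : Cmd :=
  .for .s .q
    (.ite ((Var.p : Expr) % Var.lm)
      (.store .pp Var.s (.get .inp ((Var.tr : Expr) + (.get .pp Var.s : Expr) * Var.sig + Var.y)))
      (.store .pp Var.s (.get .inp ((Var.tr : Expr) + (Var.s : Expr) * Var.sig + Var.y))))

/-- At a block border the table restarts from the identity. The update can be done in place, since a
new entry depends on no other old entry. -/
theorem advanceTable_spec {M Z p : ℕ} {D : StepData} {s : St} (hB : Big M Z) (hP : StepPre M D s)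
    (hp : s.var .p = p) (hpn : p < D.n) (hy : s.var .y = D.w p) (hpp : ∀ x < D.q, s.arr .pp x < D.q) :
    wp Z advanceTable (fun s' t => t ≤ 6 * D.q ∧ ∀ x < D.q,
      s'.arr .pp x = D.tr (if p % D.lm = 0 then x else s.arr .pp x) (D.w p)) s 0 := by
  obtain ⟨hl, hM, hMM, hn, hq, hwb, hac, hro⟩ := hP.bounds hB
  have hq0 : 0 < D.q := Nat.zero_lt_of_lt hP.st_lt
  unfold advanceTable
  refine wp_for_const D.q (fun i s' => ∀ x < D.q, s'.arr .pp x =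
    if x < i then D.tr (if p % D.lm = 0 then x else s.arr .pp x) (D.w p) else s.arr .pp x) 2
    hP.q (by simp) rfl rfl (by omega) (by simp) ?_ ?_
  · intro i hi s' hf hs hI
    have hP' := hP.frame hf rfl
    have hp' : s'.var .p = p := by rw [hf.var _ rfl, hp]
    have hy' : s'.var .y = D.w p := by rw [hf.var _ rfl, hy]
    have hinp : s'.arr .inp = s.arr .inp := hf.arr _ rfl
    have hwl := hP.word_lt p hpn
    have h1 := hP.trans_le hi hwl
    have h2 := hP.trans_le (hpp i hi) hwl
    have hppi : s'.arr .pp i = s.arr .pp i := by rw [hI i hi]; simp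
    have hput : ∀ v, v = D.tr (if p % D.lm = 0 then i else s.arr .pp i) (D.w p) → ∀ x < D.q,
        ((s'.put .pp i v).set .s (i + 1)).arr .pp x = if x < i + 1 then
          D.tr (if p % D.lm = 0 then x else s.arr .pp x) (D.w p) else s.arr .pp x := by
      intro v hv x hx
      rw [St.set_arr, St.put_arr]
      simp only [if_true]
      split
      · next h => subst h; simp [hv]
      · next h =>
        rw [hI x hx]
        have : x < i ↔ x < i + 1 := by omega
        simp only [this]
    simp only [wp_ite, wp_store, Expr.ok_mod, Expr.ok_var, Expr.ok_add, Expr.ok_mul, Expr.ok_get,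
      Expr.eval_mod, Expr.eval_var, Expr.eval_add, Expr.eval_mul, Expr.eval_get, hP'.lm, hP'.tr, hP'.sg,
      hp', hy', hs, hinp, hppi, hP.trans i hi _ hwl, hP.trans _ (hpp i hi) _ hwl]
    refine ⟨⟨trivial, trivial⟩, fun h => ⟨trivial, ⟨⟨trivial, ⟨trivial, trivial, by omega⟩, by omega⟩,
      trivial, by omega⟩, by omega, hput _ (by simp [h])⟩, fun h => ⟨trivial,
      ⟨⟨trivial, ⟨trivial, trivial, by omega⟩, by omega⟩, trivial, by omega⟩, by omega,
      hput _ (by simp [h])⟩⟩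
  · intro s' t hf _ hI ht
    refine ⟨by omega, fun x hx => ?_⟩
    rw [hI x hx, if_pos hx]

/-- Advance the latest starting positions by the letter `y`. -/
def advanceBest : Cmd :=
  .for .s .q (.store .b2 Var.s 0) ;;
  .for .s .q
    (.f ::= .get .inp ((Var.tr : Expr) + (Var.s : Expr) * Var.sig + Var.y) ;;
     .ite (Expr.ltt (.get .b2 Var.f) (.get .bb Var.s)) (.store .b2 Var.f (.get .bb Var.s)) .skip)

/-- The two conditions characterise `b2 x` as the maximum of `bb` over the predecessors of `x` under
the letter, with 0 if there are none. The automaton is deterministic, so runs that meet stay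
together and only the latest start has to be carried on. -/
theorem advanceBest_spec {M Z y : ℕ} {D : StepData} {s : St} (hB : Big M Z) (hP : StepPre M D s)
    (hy : s.var .y = y) (hyl : y < D.sg) :
    wp Z advanceBest (fun s' t => t ≤ 12 * D.q ∧
      (∀ x < D.q, s'.arr .b2 x ≠ 0 → ∃ z < D.q, D.tr z y = x ∧ s'.arr .b2 x = s.arr .bb z) ∧
      ∀ z < D.q, s.arr .bb z ≤ s'.arr .b2 (D.tr z y)) s 0 := by
  obtain ⟨hl, hM, hMM, hn, hq, hwb, hac, hro⟩ := hP.bounds hB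
  have hq0 : 0 < D.q := Nat.zero_lt_of_lt hP.st_lt
  unfold advanceBest
  rw [wp_seq]
  refine wp_for_const D.q (fun i s' => ∀ x < i, s'.arr .b2 x = 0) 1 hP.q (by simp) rfl rfl
    (by omega) (by simp) ?_ ?_
  · intro i hi s' hf hs hI
    simp only [wp_store, Expr.ok_var, Expr.ok_zero, Expr.eval_var, Expr.eval_zero, hs]
    refine ⟨trivial, by omega, by omega, fun x hx => ?_⟩
    rw [St.set_arr, St.put_arr]
    simp only [if_true]
    split
    · rfl
    · exact hI x (by omega)
  intro s1 t1 hf1 _ hI1 ht1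
  have hP1 := hP.frame hf1 rfl
  have hbb1 : s1.arr .bb = s.arr .bb := hf1.arr _ rfl
  have hy1 : s1.var .y = y := by rw [hf1.var _ rfl, hy]
  refine wp_for_const D.q (fun i s' =>
      (∀ x < D.q, s'.arr .b2 x ≠ 0 → ∃ z < i, D.tr z y = x ∧ s'.arr .b2 x = s.arr .bb z) ∧
      ∀ z < i, s.arr .bb z ≤ s'.arr .b2 (D.tr z y)) 3 hP1.q (by simp) rfl rfl
    (by omega) ?_ ?_ ?_
  · refine ⟨fun x hx h => ?_, by simp⟩
    rw [St.set_arr] at h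
    exact absurd (hI1 x hx) h
  · intro i hi s' hf hs hI
    have hP' := hP1.frame hf rfl
    have hy' : s'.var .y = y := by rw [hf.var _ rfl, hy1]
    have hbb' : s'.arr .bb = s.arr .bb := by rw [hf.arr _ rfl, hbb1]
    have h1 := hP'.trans_le hi hyl
    have h2 := hP'.trans i hi y hyl
    simp only [wp_seq, wp_assign, wp_ite, wp_store, wp_skip, Expr.ok_get, Expr.ok_add, Expr.ok_mul,
      Expr.ok_var, Expr.eval_get, Expr.eval_add, Expr.eval_mul, Expr.eval_var, Expr.ok_ltt,
      Expr.eval_ltt, hP'.tr, hP'.sg, hs, hy', h2, hbb', St.set_var, St.set_arr, reduceCtorEq, if_true,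
      if_false]
    refine ⟨⟨⟨trivial, ⟨trivial, trivial, by omega⟩, by omega⟩, trivial, by omega⟩, ⟨trivial, trivial⟩,
      fun h => ⟨trivial, trivial, by omega, fun x hx => ?_, fun z hz => ?_⟩, fun h => ⟨by omega, fun x hx hx0 => ?_, fun z hz => ?_⟩⟩
    · rw [St.put_arr]
      simp only [if_true]
      split
      · next h' => intro _; exact ⟨i, by omega, h'.symm, rfl⟩
      · intro h0
        obtain ⟨z, hz, h3⟩ := hI.1 x hx h0
        exact ⟨z, by omega, h3⟩
    · have h : s'.arr .b2 (D.tr i y) < s.arr .bb i := by simpa using h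
      rw [St.put_arr]
      simp only [if_true, St.set_arr]
      by_cases hz' : z = i
      · subst hz'; simp
      · have := hI.2 z (by omega)
        split
        · next h' => rw [h'] at this; omega
        · exact this
    · obtain ⟨z, hz, h3⟩ := hI.1 x hx hx0
      exact ⟨z, by omega, h3⟩
    · have h : s.arr .bb i ≤ s'.arr .b2 (D.tr i y) := by simpa using h
      by_cases hz' : z = i
      · subst hz'; exact h
      · exact hI.2 z (by omega)
  · intro s' t hf _ hI ht
    exact ⟨by omega, hI.1, hI.2⟩

/-- Take account of the starting position whose shortest admissible gap ends behind `p`. -/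
def inject : Cmd :=
  .ite (Expr.ltt Var.p Var.lo) .skip
    (.j ::= (Var.p : Expr) - Var.lo ;;
     .ite (.get .row ((Var.rin : Expr) + Var.j))
      (.ite (Expr.eqq (.get .inp ((Var.wb : Expr) + Var.j)) Var.a)
        (.ite Var.lo (.f ::= .get .pp (.get .tt (((Var.j : Expr) + 1) * Var.q + Var.st)))
          (.f ::= (Var.st : Expr)) ;;
         .store .b2 Var.f ((Var.j : Expr) + 1)) .skip) .skip)

/-- The only new candidate is `p - lo`, whose gap up to and including `p` has exactly `lo` letters.
It is later than all starts in the table, so it overwrites the entry of its state without a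
comparison. -/
theorem inject_spec {M Z p f : ℕ} {D : StepData} {s : St} (hB : Big M Z) (hP : StepPre M D s)
    (hp : s.var .p = p) (hpn : p < D.n)
    (hf : D.lo ≤ p → s.arr .row (D.rin + (p - D.lo)) ≠ 0 → D.w (p - D.lo) = D.a →
      (if D.lo = 0 then D.st else s.arr .pp (s.arr .tt ((p - D.lo + 1) * D.q + D.st))) = f) :
    wp Z inject (fun s' t => t ≤ 7 ∧ s'.arr .b2 =
      if D.lo ≤ p ∧ s.arr .row (D.rin + (p - D.lo)) ≠ 0 ∧ D.w (p - D.lo) = D.a then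
        Function.update (s.arr .b2) f (p - D.lo + 1) else s.arr .b2) s 0 := by
  obtain ⟨hl, hM, hMM, hn, hq, hwb, hac, hro⟩ := hP.bounds hB
  have hq0 : 0 < D.q := Nat.zero_lt_of_lt hP.st_lt
  have hrin := hP.rin_le
  have htab := hP.table_le (x := p - D.lo + 1) (by omega) hP.st_lt hn (by omega) hq
  have hw := hP.word (p - D.lo) (by omega)
  unfold inject
  simp only [wp_seq, wp_assign, wp_ite, wp_store, wp_skip, Expr.ok_get, Expr.ok_add, Expr.ok_mul,
    Expr.ok_var, Expr.eval_get, Expr.eval_add, Expr.eval_mul, Expr.eval_var, Expr.ok_ltt, Expr.ok_sub,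
    Expr.eval_sub, Expr.ok_one, Expr.eval_one, Expr.ok_eqq, Expr.eval_eqq,
    Expr.eval_ltt, hp, hP.lo, hP.rin, hP.wb, hP.a, hP.q, hP.st, hw, St.set_var, St.set_arr, reduceCtorEq, if_true,
    if_false]
  refine ⟨⟨trivial, trivial⟩, fun h => ⟨by omega, ?_⟩, fun h => ⟨⟨trivial, trivial⟩,
    ⟨trivial, trivial, by omega⟩, fun h1 => ⟨⟨⟨trivial, trivial, by omega⟩, trivial⟩, fun h2 => ⟨trivial,
    fun h3 => ⟨⟨⟨⟨trivial, by omega, by omega⟩, trivial, by omega⟩, trivial, by omega⟩, trivial,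
      ⟨trivial, by omega, by omega⟩, by omega, ?_⟩, fun h3 => ⟨trivial, trivial,
      ⟨trivial, by omega, by omega⟩, by omega, ?_⟩⟩, fun h2 => ⟨by omega, ?_⟩⟩, fun h1 => ⟨by omega, ?_⟩⟩⟩
  · rw [if_neg]
    have := of_ite_ne h
    omega
  · have h := of_ite_eq h
    have h2 := of_ite_ne h2
    rw [if_pos ⟨by omega, h1, h2⟩, St.put_arr_self, ← hf (by omega) h1 h2, if_neg h3]
    rfl
  · have h := of_ite_eq h
    have h2 := of_ite_ne h2
    rw [if_pos ⟨by omega, h1, h2⟩, St.put_arr_self, ← hf (by omega) h1 h2, if_pos h3]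
    rfl
  · rw [if_neg]
    have := of_ite_eq h2
    tauto
  · rw [if_neg]
    tauto

/-- Process the position `p` of the word. -/
def forward : Cmd :=
  acceptAt ;;
  .y ::= .get .inp ((Var.wb : Expr) + Var.p) ;;
  advanceTable ;;
  advanceBest ;;
  inject ;;
  .for .s .q (.store .bb Var.s (.get .b2 Var.s))

/-- The distance from the previous multiple of `l` to `p`, where `p` is not counted as a previous
multiple. -/
def fromBlock (l p : ℕ) : ℕ := if p = 0 then 0 else (p - 1) % l + 1

theorem fromBlock_le (l p : ℕ) : fromBlock l p ≤ p := by
  unfold fromBlock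
  split
  · omega
  · have := Nat.mod_le (p - 1) l
    omega

theorem pred_mod {l x : ℕ} (hl : 1 ≤ l) (hx : 1 ≤ x) :
    (x - 1) % l + 1 = if x % l = 0 then l else x % l := by
  obtain ⟨y, rfl⟩ : ∃ y, x = y + 1 := ⟨x - 1, by omega⟩
  have h1 : y % l < l := Nat.mod_lt _ hl
  rw [Nat.add_sub_cancel, ← Nat.mod_add_mod]
  by_cases h : y % l + 1 = l
  · simp [h]
  · rw [Nat.mod_eq_of_lt (show y % l + 1 < l by omega)]
    simp

theorem fromBlock_succ {l p : ℕ} (hl : 1 ≤ l) (h : p % l ≠ 0) :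
    fromBlock l (p + 1) = fromBlock l p + 1 := by
  have hp : p ≠ 0 := by rintro rfl; simp at h
  have := pred_mod hl (show 1 ≤ p by omega)
  rw [if_neg h] at this
  simp [fromBlock, hp, this]

theorem fromBlock_succ_of_dvd {l p : ℕ} (h : p % l = 0) : fromBlock l (p + 1) = 1 := by
  simp [fromBlock, h]

/-- A window of length `l` is split by one multiple of `l` into the rest of one block and the
beginning of the next. `fromBlock` does not count `p` itself as a border; so if `x` is a multiple of
`l`, the second part is the whole window and the first is empty. -/
theorem toBlockEnd_add_fromBlock {n l x : ℕ} (hl : 1 ≤ l) (hx : 1 ≤ x) (hn : x + l ≤ n) :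
    toBlockEnd n l x + fromBlock l (x + l) = l := by
  have h1 := pred_mod hl hx
  have h2 : fromBlock l (x + l) = (x - 1) % l + 1 := by
    unfold fromBlock
    rw [if_neg (by omega), show x + l - 1 = x - 1 + l by omega, Nat.add_mod_right]
  have h3 : x % l < l := Nat.mod_lt _ hl
  rw [h2, h1]
  split
  · next h => rw [toBlockEnd_of_dvd h]; omega
  · unfold toBlockEnd
    rw [Nat.mod_eq_of_lt (show l - x % l < l by omega)]
    omega

/-- At `p`, the position `j` is a start of an admissible gap that is not too short. -/
def StepData.Active (D : StepData) (C : ℕ → Prop) (p j : ℕ) : Prop :=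
  C j ∧ D.w j = D.a ∧ j + 1 + D.lo ≤ p

/-- The array `bb` stores for every state the latest active start that leads to this state. -/
def StepData.Best (D : StepData) (C : ℕ → Prop) (p : ℕ) (bb : ℕ → ℕ) : Prop :=
  (∀ x < D.q, bb x ≠ 0 → ∃ j, bb x = j + 1 ∧ D.Active C p j ∧
    runN D.tr D.w D.st (j + 1) (p - (j + 1)) = x) ∧
  ∀ j, D.Active C p j → j + 1 ≤ bb (runN D.tr D.w D.st (j + 1) (p - (j + 1)))

/-- The position `p` is reachable. -/
def StepData.Reach (D : StepData) (C : ℕ → Prop) (p : ℕ) : Prop :=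
  ∃ j, D.Active C p j ∧ p - (j + 1) ≤ D.hi ∧ D.acc (runN D.tr D.w D.st (j + 1) (p - (j + 1)))

/-- Among the active starts that lead to the same state, the latest one has the shortest gap. If any
of them obeys the upper bound, so does this one. -/
theorem StepData.Best.reach {D : StepData} {C : ℕ → Prop} {p : ℕ} {bb : ℕ → ℕ} (h : D.Best C p bb)
    (hlt : ∀ j, D.Active C p j → runN D.tr D.w D.st (j + 1) (p - (j + 1)) < D.q) :
    (∃ x < D.q, D.acc x ∧ bb x ≠ 0 ∧ p - bb x ≤ D.hi) ↔ D.Reach C p := by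
  constructor
  · rintro ⟨x, hx, ha, h0, hh⟩
    obtain ⟨j, hj, hact, hr⟩ := h.1 x hx h0
    exact ⟨j, hact, by rw [← hj]; exact hh, by rw [hr]; exact ha⟩
  · rintro ⟨j, hact, hh, ha⟩
    have := h.2 j hact
    exact ⟨_, hlt j hact, ha, by omega, by omega⟩

/-- The active starts at `p + 1` are those at `p`, whose runs are extended by one letter, and
possibly `p - lo`. The latter is the latest of all, which is why overwriting an entry preserves
maximality. -/
theorem StepData.Best.step {D : StepData} {C : ℕ → Prop} [DecidablePred C] {p f : ℕ} {bb b2 b3 : ℕ → ℕ}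
    (h : D.Best C p bb)
    (hlt : ∀ j, D.Active C p j → runN D.tr D.w D.st (j + 1) (p - (j + 1)) < D.q)
    (h1 : ∀ x < D.q, b2 x ≠ 0 → ∃ z < D.q, D.tr z (D.w p) = x ∧ b2 x = bb z)
    (h2 : ∀ z < D.q, bb z ≤ b2 (D.tr z (D.w p)))
    (hf : D.lo ≤ p → f = runN D.tr D.w D.st (p - D.lo + 1) D.lo)
    (h3 : b3 = if D.lo ≤ p ∧ C (p - D.lo) ∧ D.w (p - D.lo) = D.a then
      Function.update b2 f (p - D.lo + 1) else b2) : D.Best C (p + 1) b3 := by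
  have hrun : ∀ j, j + 1 ≤ p → runN D.tr D.w D.st (j + 1) (p + 1 - (j + 1)) =
      D.tr (runN D.tr D.w D.st (j + 1) (p - (j + 1))) (D.w p) := by
    intro j hj
    rw [show p + 1 - (j + 1) = p - (j + 1) + 1 by omega, runN]
    congr 2
    omega
  have hold : ∀ x < D.q, b2 x ≠ 0 → ∃ j, b2 x = j + 1 ∧ D.Active C (p + 1) j ∧
      runN D.tr D.w D.st (j + 1) (p + 1 - (j + 1)) = x := by
    intro x hx h0
    obtain ⟨z, hz, htr, hb⟩ := h1 x hx h0
    obtain ⟨j, hj, hact, hr⟩ := h.1 z hz (by omega)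
    refine ⟨j, by omega, ⟨hact.1, hact.2.1, by have := hact.2.2; omega⟩, ?_⟩
    rw [hrun j (by have := hact.2.2; omega), hr, htr]
  have hnew : D.lo ≤ p → runN D.tr D.w D.st (p - D.lo + 1) (p + 1 - (p - D.lo + 1)) = f := by
    intro hle
    rw [hf hle, show p + 1 - (p - D.lo + 1) = D.lo by omega]
  refine ⟨fun x hx h0 => ?_, fun j hact => ?_⟩
  · rw [h3] at h0 ⊢
    split
    · next hc =>
      rw [if_pos hc] at h0
      by_cases hxf : x = f
      · subst hxf
        refine ⟨p - D.lo, by simp, ⟨hc.2.1, hc.2.2, by omega⟩, hnew hc.1⟩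
      · rw [Function.update_of_ne hxf] at h0 ⊢
        exact hold x hx h0
    · next hc =>
      rw [if_neg hc] at h0
      exact hold x hx h0
  · by_cases hj : j + 1 + D.lo ≤ p
    · have ho : D.Active C p j := ⟨hact.1, hact.2.1, hj⟩
      have h4 := (h.2 j ho).trans (h2 _ (hlt j ho))
      rw [← hrun j (by omega)] at h4
      rw [h3]
      split
      · rw [Function.update_apply]
        split
        · omega
        · exact h4
      · exact h4
    · have hj' : j = p - D.lo := by have := hact.2.2; omega
      have hle : D.lo ≤ p := by have := hact.2.2; omega
      subst hj'
      rw [h3, if_pos ⟨hle, hact.1, hact.2.1⟩, hnew hle]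
      simp

/-- The invariant of the scan of the word: all positions before `p` have been processed. -/
structure ScanInv (D : StepData) (row : ℕ → ℕ) (p : ℕ) (s : St) : Prop where
  tt : ∀ x ≤ D.n, ∀ y < D.q,
    s.arr .tt (x * D.q + y) = runN D.tr D.w y x (toBlockEnd D.n D.lm x)
  pp : ∀ x < D.q, s.arr .pp x = runN D.tr D.w x (p - fromBlock D.lm p) (fromBlock D.lm p)
  bb : D.Best (fun j => row (D.rin + j) ≠ 0) p (s.arr .bb)
  row_iff : ∀ j < p, s.arr .row (D.rout + j) ≠ 0 ↔ D.Reach (fun j => row (D.rin + j) ≠ 0) j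
  row_eq : ∀ i, i < D.rout ∨ D.rout + D.n ≤ i → s.arr .row i = row i

/-- The order of the operations matters: a gap before `p` does not contain the letter at `p`, so
reachability of `p` is decided before this letter is read. -/
theorem forward_spec {M Z p : ℕ} {D : StepData} {row : ℕ → ℕ} {s : St} (hB : Big M Z)
    (hP : StepPre M D s) (hp : s.var .p = p) (hpn : p < D.n) (hI : ScanInv D row p s) :
    wp Z forward (fun s' t => t ≤ 50 * D.q ∧ ScanInv D row (p + 1) s') s 0 := by
  obtain ⟨hl, hM, hMM, hn, hq, hwb, hac, hro⟩ := hP.bounds hB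
  have hq0 : 0 < D.q := Nat.zero_lt_of_lt hP.st_lt
  have hlm : 1 ≤ D.lm := le_max_right _ _
  have hwl := hP.word_lt p hpn
  have hlt : ∀ j, D.Active (fun j => row (D.rin + j) ≠ 0) p j →
      runN D.tr D.w D.st (j + 1) (p - (j + 1)) < D.q := by
    intro j hj
    have := hj.2.2
    exact hP.runN_lt hP.st_lt (by omega)
  unfold forward
  rw [wp_seq]
  refine wp_call (acceptAt_spec hB hP hp hpn) ?_
  rintro s1 t1 hf1 ht1 ⟨v, hrow1, hv⟩
  have hP1 := hP.frame hf1 rfl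
  have hp1 : s1.var .p = p := by rw [hf1.var _ rfl, hp]
  have hinp1 : s1.arr .inp = s.arr .inp := hf1.arr _ rfl
  have htt1 : s1.arr .tt = s.arr .tt := hf1.arr _ rfl
  have hpp1 : s1.arr .pp = s.arr .pp := hf1.arr _ rfl
  have hbb1 : s1.arr .bb = s.arr .bb := hf1.arr _ rfl
  rw [wp_seq]
  simp only [wp_assign, Expr.ok_get, Expr.ok_add, Expr.ok_var, Expr.eval_get, Expr.eval_add,
    Expr.eval_var, hP1.wb, hp1, hinp1, hP.word p hpn]
  refine ⟨⟨trivial, trivial, by omega⟩, ?_⟩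
  generalize hs2 : s1.set .y (D.w p) = s2
  have hf2 : Frame (Cmd.assign .y 0) s1 s2 := by
    subst hs2
    refine ⟨fun y hy => ?_, fun _ _ => rfl⟩
    have : y ≠ .y := by
      rintro rfl
      simp [Cmd.wr] at hy
    simp [this]
  have hP2 := hP1.frame hf2 rfl
  have hp2 : s2.var .p = p := by rw [hf2.var _ rfl, hp1]
  have hy2 : s2.var .y = D.w p := by subst hs2; simp
  have hpp2 : s2.arr .pp = s.arr .pp := by rw [hf2.arr _ rfl, hpp1]
  have hppl : ∀ x < D.q, s2.arr .pp x < D.q := by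
    intro x hx
    rw [hpp2, hI.pp x hx]
    exact hP.runN_lt hx (by have := fromBlock_le D.lm p; omega)
  rw [wp_seq]
  refine wp_call (advanceTable_spec hB hP2 hp2 hpn hy2 hppl) ?_
  intro s3 t3 hf3 ht3 hpp3
  have hP3 := hP2.frame hf3 rfl
  have hp3 : s3.var .p = p := by rw [hf3.var _ rfl, hp2]
  have hy3 : s3.var .y = D.w p := by rw [hf3.var _ rfl, hy2]
  have hbb3 : s3.arr .bb = s.arr .bb := by rw [hf3.arr _ rfl, hf2.arr _ rfl, hbb1]
  have hpp3' : ∀ x < D.q, s3.arr .pp x =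
      runN D.tr D.w x (p + 1 - fromBlock D.lm (p + 1)) (fromBlock D.lm (p + 1)) := by
    intro x hx
    rw [hpp3 x hx, hpp2]
    split
    · next h =>
      rw [fromBlock_succ_of_dvd h]
      rfl
    · next h =>
      rw [fromBlock_succ hlm h, runN, hI.pp x hx]
      have := fromBlock_le D.lm p
      rw [show p + 1 - (fromBlock D.lm p + 1) = p - fromBlock D.lm p by omega,
        show p - fromBlock D.lm p + fromBlock D.lm p = p by omega]
  rw [wp_seq]
  refine wp_call (advanceBest_spec hB hP3 hy3 hwl) ?_
  rintro s4 t4 hf4 ht4 ⟨hb4, hb4'⟩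
  have hP4 := hP3.frame hf4 rfl
  have hp4 : s4.var .p = p := by rw [hf4.var _ rfl, hp3]
  have hpp4 : s4.arr .pp = s3.arr .pp := hf4.arr _ rfl
  have htt4 : s4.arr .tt = s.arr .tt := by
    rw [hf4.arr _ rfl, hf3.arr _ rfl, hf2.arr _ rfl, htt1]
  have hrow4 : s4.arr .row = Function.update (s.arr .row) (D.rout + p) v := by
    rw [hf4.arr _ rfl, hf3.arr _ rfl, hf2.arr _ rfl, hrow1]
  have hrin := hP.rin_le
  have hrow4' : D.lo ≤ p → s4.arr .row (D.rin + (p - D.lo)) = row (D.rin + (p - D.lo)) := by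
    intro h
    rw [hrow4, Function.update_of_ne (by omega), hI.row_eq _ (by omega)]
  -- The `lo` letters behind the position `p - lo` are split at the block border: `tt` supplies the
  -- state at the border, and `pp` leads from there to the state behind `p`.
  have hff : D.lo ≤ p →
      (if D.lo = 0 then D.st else s4.arr .pp (s4.arr .tt ((p - D.lo + 1) * D.q + D.st))) =
        runN D.tr D.w D.st (p - D.lo + 1) D.lo := by
    intro h
    split
    · next h0 => rw [h0]; rfl
    · next h0 =>
      have hlmlo : D.lm = D.lo := max_eq_left (by omega)
      have h1 := toBlockEnd_add_fromBlock (n := D.n) (x := p - D.lo + 1) (l := D.lo) (by omega)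
        (by omega) (by omega)
      rw [show p - D.lo + 1 + D.lo = p + 1 by omega] at h1
      rw [htt4, hpp4, hI.tt _ (by omega) _ hP.st_lt, hpp3', hlmlo]
      · rw [show p + 1 - fromBlock D.lo (p + 1) =
          p - D.lo + 1 + toBlockEnd D.n D.lo (p - D.lo + 1) by omega, ← runN_add, h1]
      · rw [hlmlo]
        exact hP.runN_lt hP.st_lt (by omega)
  rw [wp_seq]
  refine wp_call (inject_spec (f := runN D.tr D.w D.st (p - D.lo + 1) D.lo) hB hP4 hp4 hpn
    (fun h _ _ => hff h)) ?_
  intro s5 t5 hf5 ht5 hb5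
  have hP5 := hP4.frame hf5 rfl
  refine wp_for_const D.q (fun i s' => ∀ x < i, s'.arr .bb x = s5.arr .b2 x) 1 hP5.q (by simp) rfl rfl
    (by omega) (by simp) ?_ ?_
  · intro i hi s' hf hs h
    have hb2 : s'.arr .b2 = s5.arr .b2 := hf.arr _ rfl
    simp only [wp_store, Expr.ok_var, Expr.ok_get, Expr.eval_var, Expr.eval_get, hs, hb2]
    refine ⟨trivial, trivial, by omega, fun x hx => ?_⟩
    rw [St.set_arr, St.put_arr]
    simp only [if_true]
    split
    · next h' => rw [h']
    · exact h x (by omega)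
  · intro s6 t6 hf6 _ hb6 ht6
    have hrow6 : s6.arr .row = Function.update (s.arr .row) (D.rout + p) v := by
      rw [hf6.arr _ rfl, hf5.arr _ rfl, hrow4]
    have hpp6 : s6.arr .pp = s3.arr .pp := by rw [hf6.arr _ rfl, hf5.arr _ rfl, hpp4]
    have htt6 : s6.arr .tt = s.arr .tt := by rw [hf6.arr _ rfl, hf5.arr _ rfl, htt4]
    refine ⟨by omega, ?_, ?_, ?_, ?_, ?_⟩
    · rw [htt6]; exact hI.tt
    · rw [hpp6]; exact hpp3'
    · classical
      have hstep := StepData.Best.step (C := fun j => row (D.rin + j) ≠ 0) (b3 := s5.arr .b2)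
        (b2 := s4.arr .b2) hI.bb hlt (by rw [hbb3] at hb4; exact hb4) (by rw [hbb3] at hb4'; exact hb4')
        (fun _ => rfl) ?_
      · refine ⟨fun x hx h0 => ?_, fun j hj => ?_⟩
        · rw [hb6 x hx] at h0 ⊢
          exact hstep.1 x hx h0
        · rw [hb6 _ (hP.runN_lt hP.st_lt (by have := hj.2.2; omega))]
          exact hstep.2 j hj
      · rw [hb5]
        by_cases h : D.lo ≤ p
        · simp only [hrow4' h]
        · simp [h]
    · intro j hj
      rw [hrow6, Function.update_apply]
      by_cases hjp : j = p
      · subst hjp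
        rw [if_pos rfl, hv]
        exact hI.bb.reach hlt
      · rw [if_neg (by omega)]
        exact hI.row_iff j (by omega)
    · intro i hi
      rw [hrow6, Function.update_of_ne (by omega)]
      exact hI.row_eq i hi

/-- Compute the next row of the dynamic program. -/
def gapStep : Cmd :=
  .lm ::= (Var.lo : Expr) + Expr.eqq Var.lo 0 ;;
  .tr ::= (Var.ac : Expr) + Var.q ;;
  backTable ;;
  .for .s .q (.store .pp Var.s Var.s ;; .store .bb Var.s 0) ;;
  .for .p .n forward

/-- Every position costs a constant number of passes over the states. Neither length bound enters
the time. -/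
theorem gapStep_spec {M Z : ℕ} {D : StepData} {s : St} (hB : Big M Z)
    (hlo : s.var .lo = D.lo) (hac : s.var .ac = D.ac) (hq : s.var .q = D.q)
    (hP : StepPre M D ((s.set .lm D.lm).set .tr (D.ac + D.q))) :
    wp Z gapStep (fun s' t => t ≤ 90 * ((D.n + 1) * D.q) ∧
      (∀ j < D.n, s'.arr .row (D.rout + j) ≠ 0 ↔
        D.Reach (fun j => s.arr .row (D.rin + j) ≠ 0) j) ∧
      ∀ i, i < D.rout ∨ D.rout + D.n ≤ i → s'.arr .row i = s.arr .row i) s 0 := by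
  obtain ⟨hl, hM, hMM, hn, hqM, hwb, hacM, hro⟩ := hP.bounds hB
  have hq0 : 0 < D.q := Nat.zero_lt_of_lt hP.st_lt
  have hloM := hP.lo_le
  have hlm : (D.lo + if D.lo = 0 then 1 else 0) = D.lm := by
    unfold StepData.lm
    split <;> omega
  unfold gapStep
  simp only [wp_seq, wp_assign, Expr.ok_add, Expr.ok_var, Expr.ok_eqq, Expr.ok_zero, Expr.eval_add,
    Expr.eval_var, Expr.eval_eqq, Expr.eval_zero, hlo, hac, hq, hlm, St.set_var, reduceCtorEq, if_false]
  refine ⟨⟨trivial, ⟨trivial, by omega⟩, by unfold StepData.lm; omega⟩, ⟨trivial, trivial, by omega⟩, ?_⟩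
  refine wp_call (backTable_spec hB hP) ?_
  intro s1 t1 hf1 ht1 htt1
  have hP1 := hP.frame hf1 rfl
  refine wp_for_const D.q (fun i s' => ∀ x < i, s'.arr .pp x = x ∧ s'.arr .bb x = 0) 2 hP1.q (by simp)
    rfl rfl (by omega) (by simp) ?_ ?_
  · intro i hi s' hf hs h
    simp only [wp_seq, wp_store, Expr.ok_var, Expr.ok_zero, Expr.eval_var, Expr.eval_zero, hs, St.put_var]
    refine ⟨trivial, trivial, trivial, by omega, by omega, fun x hx => ?_⟩
    simp only [St.set_arr, St.put_arr, reduceCtorEq, if_false, if_true]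
    by_cases hxi : x = i
    · simp [hxi]
    · simp only [hxi, if_false]
      exact h x (by omega)
  intro s2 t2 hf2 _ hI2 ht2
  have hP2 := hP1.frame hf2 rfl
  have hrow2 : s2.arr .row = s.arr .row := by rw [hf2.arr _ rfl, hf1.arr _ rfl]; rfl
  have htt2 : s2.arr .tt = s1.arr .tt := hf2.arr _ rfl
  refine wp_for_const D.n (fun p s' => ScanInv D (s.arr .row) p s') (50 * D.q) hP2.n (by simp)
    rfl rfl (by omega) ?_ ?_ ?_
  · refine ⟨by rw [St.set_arr, htt2]; exact htt1, fun x hx => ?_, ⟨fun x hx h => ?_, fun j hj => ?_⟩,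
      by simp, fun i _ => by rw [St.set_arr, hrow2]⟩
    · rw [St.set_arr, (hI2 x hx).1]; rfl
    · rw [St.set_arr, (hI2 x hx).2] at h
      exact absurd rfl h
    · have := hj.2.2
      omega
  · intro p hp s' hf hps h
    have hP' := hP2.frame hf rfl
    refine wp_mono (forward_spec hB hP' hps hp h) ?_
    rintro s'' t - - ⟨ht, h⟩
    exact ⟨ht, h.tt, h.pp, h.bb, h.row_iff, h.row_eq⟩
  · intro s' t hf _ h ht
    refine ⟨?_, fun j hj => h.row_iff j hj, h.row_eq⟩
    have h1 : D.n * 1 ≤ D.n * D.q := Nat.mul_le_mul_left _ hq0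
    have h2 : D.n * (50 * D.q + 2) = 50 * (D.n * D.q) + 2 * D.n := by ring
    have h3 : (D.n + 1) * D.q = D.n * D.q + D.q := by ring
    omega

/-! ### One step of the dynamic program for the gap constraint `{ε}` -/

/-- Compute the next row of the dynamic program for the gap constraint `{ε}`. -/
def zeroStep : Cmd :=
  .for .p .n
    (.d ::= 0 ;;
     .ite Var.p
      (.ite (.get .row ((Var.rin : Expr) + ((Var.p : Expr) - 1)))
        (.ite (Expr.eqq (.get .inp ((Var.wb : Expr) + ((Var.p : Expr) - 1))) Var.a) (.d ::= 1) .skip)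
        .skip)
      .skip ;;
     .store .row ((Var.rout : Expr) + Var.p) Var.d)

/-- No automaton is involved: an empty gap means adjacent positions. The time must not depend on the
number of states here, since these constraints do not contribute to `states`. -/
theorem zeroStep_spec {M Z n wb rin rout a : ℕ} {w : ℕ → ℕ} {s : St} (hB : Big M Z)
    (hn : s.var .n = n) (hwb : s.var .wb = wb) (hrin : s.var .rin = rin) (hrout : s.var .rout = rout)
    (ha : s.var .a = a) (hw : ∀ j < n, s.arr .inp (wb + j) = w j) (hwM : wb + n ≤ M)
    (hrr : rin + n ≤ rout) (hrM : rout + n ≤ 4 * (M * M)) :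
    wp Z zeroStep (fun s' t => t ≤ 10 * (n + 1) ∧
      (∀ j < n, s'.arr .row (rout + j) ≠ 0 ↔
        ∃ i, s.arr .row (rin + i) ≠ 0 ∧ w i = a ∧ i + 1 = j) ∧
      ∀ i, i < rout ∨ rout + n ≤ i → s'.arr .row i = s.arr .row i) s 0 := by
  have hl := hB.lin
  have hM := hB.le
  have hMM := hB.sq_le
  unfold zeroStep
  refine wp_for_const n (fun p s' => (∀ j < p, s'.arr .row (rout + j) ≠ 0 ↔
        ∃ i, s.arr .row (rin + i) ≠ 0 ∧ w i = a ∧ i + 1 = j) ∧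
      ∀ i, i < rout ∨ rout + n ≤ i → s'.arr .row i = s.arr .row i) 6 hn (by simp)
    rfl rfl (by omega) (by simp) ?_ ?_
  · rintro p hp s' hf hps ⟨h1, h2⟩
    have hwb' : s'.var .wb = wb := by rw [hf.var _ rfl, hwb]
    have hrin' : s'.var .rin = rin := by rw [hf.var _ rfl, hrin]
    have hrout' : s'.var .rout = rout := by rw [hf.var _ rfl, hrout]
    have ha' : s'.var .a = a := by rw [hf.var _ rfl, ha]
    have hinp : s'.arr .inp = s.arr .inp := hf.arr _ rfl
    have hw' := hw (p - 1) (by omega)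
    have hr' := h2 (rin + (p - 1)) (by omega)
    have key : ∀ v, (v ≠ 0 ↔ ∃ i, s.arr .row (rin + i) ≠ 0 ∧ w i = a ∧ i + 1 = p) →
        (∀ j < p + 1, Function.update (s'.arr .row) (rout + p) v (rout + j) ≠ 0 ↔
          ∃ i, s.arr .row (rin + i) ≠ 0 ∧ w i = a ∧ i + 1 = j) ∧
        ∀ i, i < rout ∨ rout + n ≤ i →
          Function.update (s'.arr .row) (rout + p) v i = s.arr .row i := by
      intro v hv
      refine ⟨fun j hj => ?_, fun i hi => ?_⟩
      · by_cases hjp : j = p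
        · subst hjp; simpa using hv
        · rw [Function.update_of_ne (by omega)]
          exact h1 j (by omega)
      · rw [Function.update_of_ne (by omega)]
        exact h2 i hi
    simp only [wp_seq, wp_assign, wp_ite, wp_skip, wp_store, Expr.ok_get, Expr.ok_add, Expr.ok_sub,
      Expr.ok_var, Expr.ok_zero, Expr.ok_one, Expr.ok_eqq, Expr.eval_get, Expr.eval_add, Expr.eval_sub,
      Expr.eval_var, Expr.eval_zero, Expr.eval_one, Expr.eval_eqq, hps, hwb', hrin', hrout', ha', hinp, hw', hr',
      St.set_var, St.set_arr, reduceCtorEq, if_true, if_false, St.put_arr_self]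
    refine ⟨by omega, trivial, fun h3 => ⟨⟨trivial, ⟨trivial, by omega⟩, by omega⟩, fun h4 =>
      ⟨⟨⟨trivial, ⟨trivial, by omega⟩, by omega⟩, trivial⟩, fun h5 => ⟨by omega,
        ⟨trivial, trivial, by omega⟩, trivial, by omega, key _ ?_⟩,
        fun h5 => ⟨⟨trivial, trivial, by omega⟩, trivial, by omega, key _ ?_⟩⟩,
      fun h4 => ⟨⟨trivial, trivial, by omega⟩, trivial, by omega, key _ ?_⟩⟩,
      fun h3 => ⟨⟨trivial, trivial, by omega⟩, trivial, by omega, key _ ?_⟩⟩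
    · have h5 := of_ite_ne h5
      simp only [ne_eq, one_ne_zero, not_false_eq_true, true_iff]
      exact ⟨p - 1, h4, h5, by omega⟩
    · have h5 := of_ite_eq h5
      simp only [ne_eq, not_true_eq_false, false_iff]
      rintro ⟨i, _, h6, h7⟩
      obtain rfl : i = p - 1 := by omega
      exact h5 h6
    · simp only [ne_eq, not_true_eq_false, false_iff]
      rintro ⟨i, h6, _, h7⟩
      obtain rfl : i = p - 1 := by omega
      exact h6 h4
    · simp only [ne_eq, not_true_eq_false, false_iff]
      rintro ⟨i, h6, _, h7⟩
      omega
  · intro s' t hf _ h ht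
    exact ⟨by omega, h⟩

/-! ### Breadth-first search for non-empty accepted words of bounded length -/

/-- An automaton that is stored from position `ac` on. -/
structure Aut where
  sg : ℕ
  q : ℕ
  st : ℕ
  ac : ℕ
  acc : ℕ → Prop
  tr : ℕ → ℕ → ℕ

/-- The automaton is stored in the array `inp`. -/
structure Aut.In (A : Aut) (M : ℕ) (inp : ℕ → ℕ) : Prop where
  acc : ∀ x < A.q, inp (A.ac + x) ≠ 0 ↔ A.acc x
  trans : ∀ x < A.q, ∀ y < A.sg, inp (A.ac + A.q + x * A.sg + y) = A.tr x y
  trans_lt : ∀ x < A.q, ∀ y < A.sg, A.tr x y < A.q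
  st_lt : A.st < A.q
  le : A.ac + A.q + A.q * A.sg ≤ M

theorem Aut.In.trans_le {A : Aut} {M : ℕ} {inp : ℕ → ℕ} (h : A.In M inp) {x y : ℕ} (hx : x < A.q)
    (hy : y < A.sg) : A.ac + A.q + x * A.sg + y < M := by
  have := mul_add_lt hy hx
  have := h.le
  omega

/-- The invariant of the breadth-first search: `que` holds the initial state and the states found so
far, `dst` their distances; the first `h` entries and the first `c` letters of the next entry have been
processed. -/
structure BfsInv (A : Aut) (lim h c tail fnd : ℕ) (que dst vis : ℕ → ℕ) : Prop where
  tail_pos : 1 ≤ tail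
  que_lt : ∀ i < tail, que i < A.q
  que_zero : que 0 = A.st
  dst_zero : dst 0 = 0
  dst_le : ∀ i < tail, dst i ≤ i
  mono : ∀ i j, i ≤ j → j < tail → dst i ≤ dst j
  spread : h < tail → ∀ j < tail, dst j ≤ dst h + 1
  word : ∀ i < tail, ∃ v : List ℕ, (∀ c ∈ v, c < A.sg) ∧ v.length = dst i ∧ v.foldl A.tr A.st = que i
  dst_pos : ∀ i, 1 ≤ i → i < tail → 1 ≤ dst i ∧ dst i ≤ lim
  inj : ∀ i j, 1 ≤ i → i < tail → 1 ≤ j → j < tail → que i = que j → i = j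
  vis_iff : ∀ y < A.q, vis y ≠ 0 ↔ ∃ i, 1 ≤ i ∧ i < tail ∧ que i = y
  fnd_iff : fnd ≠ 0 ↔ ∃ i, 1 ≤ i ∧ i < tail ∧ A.acc (que i)
  closed : ∀ i < h, i < tail → dst i < lim → ∀ e < A.sg,
    ∃ j, 1 ≤ j ∧ j < tail ∧ que j = A.tr (que i) e ∧ dst j ≤ dst i + 1
  current : h < tail → ∀ e < c, ∃ j, 1 ≤ j ∧ j < tail ∧ que j = A.tr (que h) e ∧ dst j ≤ dst h + 1

/-- The entries from 1 on are different states. Entry 0 is the initial state, which is not marked as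
visited: only non-empty words count, and the initial state may be found once more by such a word.
This explains the additional 1. -/
theorem BfsInv.tail_le {A : Aut} {lim h c tail fnd : ℕ} {que dst vis : ℕ → ℕ}
    (I : BfsInv A lim h c tail fnd que dst vis) : tail ≤ A.q + 1 := by
  have h1 := Finset.card_le_card_of_injOn (s := Finset.Ico 1 tail) (t := Finset.range A.q) que
    (fun i hi => by
      simp only [Finset.coe_Ico, Set.mem_Ico] at hi
      simpa using I.que_lt i hi.2)
    (fun i hi j hj hij => by
      simp only [Finset.coe_Ico, Set.mem_Ico] at hi hj
      exact I.inj i j hi.1 hi.2 hj.1 hj.2 hij)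
  simp only [Nat.card_Ico, Finset.card_range] at h1
  omega

theorem BfsInv.init {A : Aut} {lim : ℕ} {que dst vis : ℕ → ℕ} (hst : A.st < A.q)
    (hq : que 0 = A.st) (hd : dst 0 = 0) (hv : ∀ y < A.q, vis y = 0) :
    BfsInv A lim 0 0 1 0 que dst vis := by
  refine ⟨le_rfl, ?_, hq, hd, ?_, ?_, ?_, ?_, ?_, ?_, ?_, ?_, ?_, ?_⟩
  · intro i hi; obtain rfl : i = 0 := by omega
    omega
  · intro i hi; obtain rfl : i = 0 := by omega
    omega
  · intro i j hi hj; obtain rfl : i = 0 := by omega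
    omega
  · intro _ i hi; obtain rfl : i = 0 := by omega
    omega
  · intro i hi; obtain rfl : i = 0 := by omega
    exact ⟨[], by simp, by simp [hd], by simp [hq]⟩
  · intro i h1 h2; omega
  · intro i j h1 h2; omega
  · intro y hy
    simp only [hv y hy, ne_eq, not_true_eq_false, false_iff]
    rintro ⟨i, h1, h2, _⟩; omega
  · simp only [ne_eq, not_true_eq_false, false_iff]
    rintro ⟨i, h1, h2, _⟩; omega
  · intro i hi; omega
  · intro _ e he; omega

theorem BfsInv.old {A : Aut} {lim h c tail fnd : ℕ} {que dst vis : ℕ → ℕ}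
    (I : BfsInv A lim h c tail fnd que dst vis) (hh : h < tail) (hlt : A.tr (que h) c < A.q)
    (hv : vis (A.tr (que h) c) ≠ 0) : BfsInv A lim h (c + 1) tail fnd que dst vis := by
  refine { I with current := fun _ e he => ?_ }
  by_cases hec : e = c
  · subst hec
    obtain ⟨i, h1, h2, h3⟩ := (I.vis_iff _ hlt).1 hv
    exact ⟨i, h1, h2, h3, I.spread hh i h2⟩
  · exact I.current hh e (by omega)

/-- By `spread` the new distance `dst h + 1` is at least as large as all distances in the queue, so
the queue stays sorted; its word is that of entry `h` followed by `c`. -/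
theorem BfsInv.push {A : Aut} {lim h c tail fnd fnd' : ℕ} {que dst vis : ℕ → ℕ}
    (I : BfsInv A lim h c tail fnd que dst vis) (hh : h < tail) (hc : c < A.sg)
    (hlt : A.tr (que h) c < A.q) (hd : dst h < lim)
    (hv : vis (A.tr (que h) c) = 0) (hf : fnd' ≠ 0 ↔ fnd ≠ 0 ∨ A.acc (A.tr (que h) c)) :
    BfsInv A lim h (c + 1) (tail + 1) fnd' (Function.update que tail (A.tr (que h) c))
      (Function.update dst tail (dst h + 1)) (Function.update vis (A.tr (que h) c) 1) := by
  have hq : ∀ i < tail, Function.update que tail (A.tr (que h) c) i = que i :=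
    fun i hi => Function.update_of_ne (by omega) _ _
  have hdd : ∀ i < tail, Function.update dst tail (dst h + 1) i = dst i :=
    fun i hi => Function.update_of_ne (by omega) _ _
  have hqs : Function.update que tail (A.tr (que h) c) tail = A.tr (que h) c := by simp
  have hds : Function.update dst tail (dst h + 1) tail = dst h + 1 := by simp
  have hp := I.tail_pos
  have hnew : ∀ i, 1 ≤ i → i < tail → que i ≠ A.tr (que h) c := by
    intro i h1 h2 h3
    exact (I.vis_iff _ hlt).2 ⟨i, h1, h2, h3⟩ hv
  have split : ∀ i, i < tail + 1 → i < tail ∨ i = tail := fun i hi => by omega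
  refine ⟨by omega, ?_, ?_, ?_, ?_, ?_, ?_, ?_, ?_, ?_, ?_, ?_, ?_, ?_⟩
  · intro i hi
    rcases split i hi with h1 | rfl
    · rw [hq i h1]; exact I.que_lt i h1
    · rw [hqs]; exact hlt
  · rw [hq 0 (by omega), I.que_zero]
  · rw [hdd 0 (by omega), I.dst_zero]
  · intro i hi
    rcases split i hi with h1 | rfl
    · rw [hdd i h1]; exact I.dst_le i h1
    · rw [hds]; have := I.dst_le h hh; omega
  · intro i j hij hj
    rcases split j hj with h1 | rfl
    · rw [hdd i (by omega), hdd j h1]; exact I.mono i j hij h1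
    · rw [hds]
      rcases split i (by omega) with h2 | rfl
      · rw [hdd i h2]; exact I.spread hh i h2
      · rw [hds]
  · intro _ j hj
    rw [hdd h hh]
    rcases split j hj with h1 | rfl
    · rw [hdd j h1]; exact I.spread hh j h1
    · rw [hds]
  · intro i hi
    rcases split i hi with h1 | rfl
    · rw [hdd i h1, hq i h1]; exact I.word i h1
    · obtain ⟨v, h2, h3, h4⟩ := I.word h hh
      refine ⟨v ++ [c], ?_, by simp [h3], by simp [h4]⟩
      intro e he
      rcases List.mem_append.1 he with h5 | h5
      · exact h2 e h5
      · rw [List.mem_singleton.1 h5]; exact hc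
  · intro i h1 hi
    rcases split i hi with h2 | rfl
    · rw [hdd i h2]; exact I.dst_pos i h1 h2
    · rw [hds]; omega
  · intro i j h1 hi h2 hj hij
    rcases split i hi with h3 | rfl
    · rw [hq i h3] at hij
      rcases split j hj with h4 | rfl
      · rw [hq j h4] at hij; exact I.inj i j h1 h3 h2 h4 hij
      · rw [hqs] at hij; exact absurd hij (hnew i h1 h3)
    · rw [hqs] at hij
      rcases split j hj with h4 | rfl
      · rw [hq j h4] at hij; exact absurd hij.symm (hnew j h2 h4)
      · rfl
  · intro y hy
    rw [Function.update_apply]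
    split
    · next h1 =>
      simp only [ne_eq, one_ne_zero, not_false_eq_true, true_iff]
      exact ⟨tail, by omega, by omega, by rw [hqs, h1]⟩
    · next h1 =>
      rw [I.vis_iff y hy]
      constructor
      · rintro ⟨i, h2, h3, h4⟩
        exact ⟨i, h2, by omega, by rw [hq i h3, h4]⟩
      · rintro ⟨i, h2, h3, h4⟩
        rcases split i h3 with h5 | rfl
        · exact ⟨i, h2, h5, by rw [← h4, hq i h5]⟩
        · rw [hqs] at h4; exact absurd h4.symm h1
  · rw [hf, I.fnd_iff]
    constructor
    · rintro (⟨i, h2, h3, h4⟩ | h1)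
      · exact ⟨i, h2, by omega, by rwa [hq i h3]⟩
      · exact ⟨tail, by omega, by omega, by rwa [hqs]⟩
    · rintro ⟨i, h2, h3, h4⟩
      rcases split i h3 with h5 | rfl
      · exact Or.inl ⟨i, h2, h5, by rwa [hq i h5] at h4⟩
      · rw [hqs] at h4; exact Or.inr h4
  · intro i hi _ h1 e he
    rw [hdd i (by omega)] at h1
    obtain ⟨j, h2, h3, h4, h5⟩ := I.closed i hi (by omega) h1 e he
    exact ⟨j, h2, by omega, by rw [hq j h3, hq i (by omega), h4], by rw [hdd j h3, hdd i (by omega)]; exact h5⟩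
  · intro _ e he
    by_cases hec : e = c
    · subst hec
      exact ⟨tail, by omega, by omega, by rw [hqs, hq h hh], by rw [hds, hdd h hh]⟩
    · obtain ⟨j, h2, h3, h4, h5⟩ := I.current hh e (by omega)
      exact ⟨j, h2, by omega, by rw [hq j h3, hq h hh, h4], by rw [hdd j h3, hdd h hh]; exact h5⟩

/-- An entry may be left before all its letters are processed only if its distance has attained the
limit; `closed` claims nothing about such entries. -/
theorem BfsInv.next {A : Aut} {lim h tail fnd c : ℕ} {que dst vis : ℕ → ℕ}
    (I : BfsInv A lim h c tail fnd que dst vis) (hh : h < tail → dst h < lim → A.sg ≤ c) :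
    BfsInv A lim (h + 1) 0 tail fnd que dst vis := by
  refine { I with
    spread := fun h1 j hj => ?_
    closed := fun i hi ht hd e he => ?_
    current := fun _ e he => by omega }
  · have := I.spread (by omega) j hj
    have := I.mono h (h + 1) (by omega) h1
    omega
  · by_cases hih : i = h
    · subst hih
      exact I.current ht e (by have := hh ht hd; omega)
    · exact I.closed i (by omega) ht hd e he

/-- Entry `i` has distance at most `i ≤ q`. Hence a limit above `q` never stops the search, and then
words of every length are covered. -/
theorem BfsInv.found {A : Aut} {lim h tail fnd c : ℕ} {que dst vis : ℕ → ℕ}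
    (I : BfsInv A lim h c tail fnd que dst vis) (hh : tail ≤ h) :
    (fnd ≠ 0 → ∃ v : List ℕ, (∀ c ∈ v, c < A.sg) ∧ 1 ≤ v.length ∧ v.length ≤ lim ∧
      A.acc (v.foldl A.tr A.st)) ∧
    ∀ v : List ℕ, (∀ c ∈ v, c < A.sg) → 1 ≤ v.length → (v.length ≤ lim ∨ A.q < lim) →
      A.acc (v.foldl A.tr A.st) → fnd ≠ 0 := by
  rw [I.fnd_iff]
  constructor
  · rintro ⟨i, h1, h2, h3⟩
    obtain ⟨v, h4, h5, h6⟩ := I.word i h2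
    have := I.dst_pos i h1 h2
    exact ⟨v, h4, by omega, by omega, by rwa [h6]⟩
  · intro v h1 h2 h3 h4
    -- Induction from the right: the state after each word is in the queue, at a distance of at most
    -- the length of the word. Entry 0 serves for the empty word only.
    have key : ∀ v : List ℕ, (∀ c ∈ v, c < A.sg) → (v.length ≤ lim ∨ A.q < lim) →
        ∃ i < tail, (1 ≤ v.length → 1 ≤ i) ∧ que i = v.foldl A.tr A.st ∧ dst i ≤ v.length := by
      intro v
      induction v using List.reverseRecOn with
      | nil =>
        intro _ _
        exact ⟨0, I.tail_pos, by simp, by simp [I.que_zero], by simp [I.dst_zero]⟩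
      | append_singleton v a ih =>
        intro hv hl
        simp only [List.length_append, List.length_singleton] at hl ⊢
        obtain ⟨i, h5, _, h6, h7⟩ := ih (fun c hc => hv c (by simp [hc])) (by omega)
        have h8 := I.dst_le i h5
        have h9 := I.tail_le
        obtain ⟨j, h10, h11, h12, h13⟩ := I.closed i (by omega) h5 (by omega) a (hv a (by simp))
        exact ⟨j, h11, fun _ => h10, by simp [h12, h6], by omega⟩
    obtain ⟨i, h5, h6, h7, _⟩ := key v h1 h3
    exact ⟨i, h6 h2, h5, by rwa [h7]⟩

/-- Process the letter `c` in the search. -/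
def bfsLetter : Cmd :=
  .y ::= .get .inp ((Var.ac : Expr) + Var.q + (Var.x : Expr) * Var.sig + Var.c) ;;
  .ite (.get .vis Var.y) .skip
    (.store .vis Var.y 1 ;; .store .que Var.tail Var.y ;;
     .store .dst Var.tail ((.get .dst Var.head : Expr) + 1) ;;
     .tail ::= (Var.tail : Expr) + 1 ;;
     .ite (.get .inp ((Var.ac : Expr) + Var.y)) (.fnd ::= 1) .skip)

/-- Breadth-first search for accepting states up to the distance `lim`. -/
def bfs : Cmd :=
  .for .s .q (.store .vis Var.s 0) ;;
  .store .que 0 Var.st ;; .store .dst 0 0 ;; .tail ::= 1 ;; .fnd ::= 0 ;;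
  .k ::= (Var.q : Expr) + 1 ;;
  .for .head .k
    (.ite (Expr.ltt Var.head Var.tail)
      (.ite (Expr.ltt (.get .dst Var.head) Var.lim)
        (.x ::= .get .que Var.head ;; .for .c .sig bfsLetter) .skip) .skip)

/-- The state of the search satisfies the invariant. -/
def BfsSt (A : Aut) (lim h c : ℕ) (s : St) : Prop :=
  BfsInv A lim h c (s.var .tail) (s.var .fnd) (s.arr .que) (s.arr .dst) (s.arr .vis)

theorem bfsLetter_spec {M Z lim h c : ℕ} {A : Aut} {s : St} (hB : Big M Z) (hA : A.In M (s.arr .inp))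
    (hq : s.var .q = A.q) (hac : s.var .ac = A.ac) (hsg : s.var .sig = A.sg)
    (hx : s.var .x = s.arr .que h) (hc : s.var .c = c) (hcs : c < A.sg) (hhd : s.var .head = h)
    (hh : h < s.var .tail) (hd : s.arr .dst h < lim) (hI : BfsSt A lim h c s) :
    wp Z bfsLetter (fun s' t => t ≤ 8 ∧ s'.arr .que h = s.arr .que h ∧ s'.arr .dst h = s.arr .dst h ∧
      h < s'.var .tail ∧ BfsSt A lim h (c + 1) s') s 0 := by
  have hl := hB.lin
  have hM := hB.le
  have hle := hA.le
  have hxq : s.arr .que h < A.q := hI.que_lt h hh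
  have h1 := hA.trans_le hxq hcs
  have h2 := hA.trans _ hxq c hcs
  have h3 := hA.trans_lt _ hxq c hcs
  have h4 := hA.acc _ h3
  have h5 := hI.tail_le
  have h6 := hI.dst_le h hh
  unfold bfsLetter
  simp only [wp_seq, wp_assign, wp_ite, wp_skip, wp_store, Expr.ok_get, Expr.ok_add, Expr.ok_mul,
    Expr.ok_var, Expr.ok_zero, Expr.ok_one, Expr.eval_get, Expr.eval_add, Expr.eval_mul,
    Expr.eval_var, Expr.eval_zero, Expr.eval_one, hq, hac, hsg, hx, hc, hhd, h2,
    St.set_var, St.set_arr, St.put_var, reduceCtorEq, if_true, if_false, ne_eq, not_false_eq_true,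
    St.put_arr_ne, St.put_arr_self, BfsSt]
  refine ⟨⟨⟨⟨trivial, trivial, by omega⟩, ⟨trivial, trivial, by omega⟩, by omega⟩, trivial, by omega⟩,
    trivial, fun h7 => ⟨by omega, trivial, trivial, hh, hI.old hh h3 h7⟩, fun h7 =>
    ⟨trivial, by omega, trivial, trivial, trivial, ⟨trivial, by omega, by omega⟩,
      ⟨trivial, by omega, by omega⟩, ⟨trivial, trivial, by omega⟩, fun h8 => ⟨by omega, by omega, ?_, ?_,
      by omega, ?_⟩, fun h8 => ⟨by omega, ?_, ?_, by omega, ?_⟩⟩⟩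
  · exact Function.update_of_ne (by omega) _ _
  · exact Function.update_of_ne (by omega) _ _
  · exact hI.push hh hcs h3 hd h7 (by simpa using Or.inr (h4.1 h8))
  · exact Function.update_of_ne (by omega) _ _
  · exact Function.update_of_ne (by omega) _ _
  · refine hI.push hh hcs h3 hd h7 ⟨Or.inl, ?_⟩
    rintro (h | h)
    · exact h
    · exact absurd h8 (h4.2 h)

/-- The queue never has more than `q + 1` entries, so `q + 1` rounds suffice; rounds beyond the end
of the queue do nothing. -/
theorem bfs_spec {M Z lim : ℕ} {A : Aut} {s : St} (hB : Big M Z) (hA : A.In M (s.arr .inp))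
    (hq : s.var .q = A.q) (hac : s.var .ac = A.ac) (hsg : s.var .sig = A.sg) (hst : s.var .st = A.st)
    (hlim : s.var .lim = lim) :
    wp Z bfs (fun s' t => t ≤ 40 * (A.q * (A.sg + 1)) ∧
      (s'.var .fnd ≠ 0 → ∃ v : List ℕ, (∀ c ∈ v, c < A.sg) ∧ 1 ≤ v.length ∧ v.length ≤ lim ∧
        A.acc (v.foldl A.tr A.st)) ∧
      ∀ v : List ℕ, (∀ c ∈ v, c < A.sg) → 1 ≤ v.length → (v.length ≤ lim ∨ A.q < lim) →
        A.acc (v.foldl A.tr A.st) → s'.var .fnd ≠ 0) s 0 := by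
  have hl := hB.lin
  have hM := hB.le
  have hle := hA.le
  have hsl := hA.st_lt
  have hsgM : A.sg ≤ M := by
    have : 1 * A.sg ≤ A.q * A.sg := Nat.mul_le_mul_right _ (by omega)
    omega
  unfold bfs
  rw [wp_seq]
  refine wp_for_const A.q (fun i s' => ∀ y < i, s'.arr .vis y = 0) 1 hq (by simp) rfl rfl (by omega)
    (by simp) ?_ ?_
  · intro i hi s' hf hs hI
    simp only [wp_store, Expr.ok_var, Expr.ok_zero, Expr.eval_var, Expr.eval_zero, hs]
    refine ⟨trivial, by omega, by omega, fun y hy => ?_⟩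
    rw [St.set_arr, St.put_arr_self, Function.update_apply]
    split
    · rfl
    · exact hI y (by omega)
  intro s1 t1 hf1 _ hv1 ht1
  have hq1 : s1.var .q = A.q := by rw [hf1.var _ rfl, hq]
  have hst1 : s1.var .st = A.st := by rw [hf1.var _ rfl, hst]
  simp only [wp_seq, wp_assign, wp_store, Expr.ok_var, Expr.ok_zero, Expr.ok_one, Expr.ok_add, Expr.eval_add,
    Expr.eval_var, Expr.eval_zero, Expr.eval_one, St.put_var, St.set_var, reduceCtorEq, if_false, if_true,
    hq1, hst1]
  refine ⟨by omega, trivial, by omega, by omega, by omega, by omega, ⟨trivial, by omega, by omega⟩, ?_⟩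
  generalize hs2 : (((((s1.put .que 0 A.st).put .dst 0 0).set .tail 1).set .fnd 0).set .k (A.q + 1)) = s2
  have hk2 : s2.var .k = A.q + 1 := by subst hs2; simp
  have hq2 : s2.var .q = A.q := by subst hs2; simp [hq1]
  have hsg2 : s2.var .sig = A.sg := by subst hs2; simp only [St.set_var, St.put_var, reduceCtorEq, if_false]; rw [hf1.var _ rfl, hsg]
  have hac2 : s2.var .ac = A.ac := by subst hs2; simp only [St.set_var, St.put_var, reduceCtorEq, if_false]; rw [hf1.var _ rfl, hac]
  have hlim2 : s2.var .lim = lim := by subst hs2; simp only [St.set_var, St.put_var, reduceCtorEq, if_false]; rw [hf1.var _ rfl, hlim]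
  have hinp2 : s2.arr .inp = s.arr .inp := by
    subst hs2; simp [St.put_arr_ne, hf1.arr .inp rfl]
  refine wp_for_const (A.q + 1) (fun h s' => BfsSt A lim h 0 s') (10 * A.sg + 7) hk2 (by simp) rfl rfl
    (by omega) ?_ ?_ ?_
  · have h1 := BfsInv.init (lim := lim) (que := s2.arr .que) (dst := s2.arr .dst) (vis := s2.arr .vis) hsl
      (by subst hs2; simp [St.put_arr_self, St.put_arr_ne])
      (by subst hs2; simp [St.put_arr_self, St.put_arr_ne])
      (by subst hs2; simpa [St.put_arr_self, St.put_arr_ne] using hv1)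
    unfold BfsSt
    subst hs2
    simpa using h1
  · intro h hh s' hf hhd hI
    have hq' : s'.var .q = A.q := by rw [hf.var _ rfl, hq2]
    have hsg' : s'.var .sig = A.sg := by rw [hf.var _ rfl, hsg2]
    have hac' : s'.var .ac = A.ac := by rw [hf.var _ rfl, hac2]
    have hlim' : s'.var .lim = lim := by rw [hf.var _ rfl, hlim2]
    have hinp' : s'.arr .inp = s.arr .inp := by rw [hf.arr _ rfl, hinp2]
    simp only [wp_seq, wp_assign, wp_ite, wp_skip, Expr.ok_get, Expr.ok_var, Expr.ok_ltt, Expr.eval_get,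
      Expr.eval_var, Expr.eval_ltt, hhd, hlim']
    refine ⟨⟨trivial, trivial⟩, fun h1 => ⟨⟨trivial, trivial⟩, fun h2 => ⟨trivial, ?_⟩, fun h2 =>
      ⟨by omega, ?_⟩⟩, fun h1 => ⟨by omega, ?_⟩⟩
    · have h1 := of_ite_ne h1
      have h2 := of_ite_ne h2
      refine wp_for_const A.sg (fun c s'' => s''.arr .que h = s'.arr .que h ∧ s''.arr .dst h = s'.arr .dst h ∧
        h < s''.var .tail ∧ BfsSt A lim h c s'') 8 (by simp [hsg']) (by simp) rfl rfl (by omega) ?_ ?_ ?_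
      · exact ⟨rfl, rfl, by simpa using h1, by unfold BfsSt at *; simpa using hI⟩
      · rintro c hc s2 hf2 hc2 ⟨e1, e2, e3, e4⟩
        refine wp_mono (bfsLetter_spec (lim := lim) (h := h) hB
          (by rw [hf2.arr .inp rfl]; simp only [St.set_arr]; rw [hinp']; exact hA)
          (by rw [hf2.var _ rfl]; simp [hq']) (by rw [hf2.var _ rfl]; simp [hac'])
          (by rw [hf2.var _ rfl]; simp [hsg']) (by rw [hf2.var _ rfl]; simp [e1]) hc2 hc
          (by rw [hf2.var _ rfl]; simp [hhd]) e3 (by rw [e2]; exact h2) e4) ?_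
        rintro s3 t3 - - ⟨g1, g2, g3, g4, g5⟩
        exact ⟨g1, by rw [← e1]; exact g2, by rw [← e2]; exact g3, by simpa using g4,
          by unfold BfsSt at *; simpa using g5⟩
      · rintro s2 t2 hf2 _ ⟨_, _, _, e4⟩ ht2
        refine ⟨by omega, ?_⟩
        have := BfsInv.next e4 (fun _ _ => le_rfl)
        unfold BfsSt
        simpa using this
    · have := of_ite_eq h2
      have := BfsInv.next hI (fun _ _ => by omega)
      unfold BfsSt
      simpa using this
    · have := of_ite_eq h1
      have := BfsInv.next hI (fun _ _ => by omega)
      unfold BfsSt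
      simpa using this
  · intro s' t hf _ hI ht
    refine ⟨?_, hI.found hI.tail_le⟩
    have h1 : (A.q + 1) * (10 * A.sg + 7 + 2) = 10 * (A.q * A.sg) + 9 * A.q + 10 * A.sg + 9 := by ring
    have h2 : A.q * (A.sg + 1) = A.q * A.sg + A.q := by ring
    have h3 : 1 * A.sg ≤ A.q * A.sg := Nat.mul_le_mul_right _ (by omega)
    omega

/-! ### Analysis of the constraints: the test for `{ε}` and the clipped bounds -/

/-- The automaton of a constraint, if it is stored from position `ac` on. -/
def autOf {σ : ℕ} (c : RegLenConstraint σ) (ac : ℕ) : Aut where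
  sg := σ
  q := c.numStates
  st := c.dfa.start
  ac := ac
  acc x := ∃ h : x < c.numStates, (⟨x, h⟩ : Fin c.numStates) ∈ c.dfa.accept
  tr x y := if h : x < c.numStates ∧ y < σ then c.dfa.step ⟨x, h.1⟩ ⟨y, h.2⟩ else 0

theorem autOf_tr {σ : ℕ} (c : RegLenConstraint σ) (ac : ℕ) (x : Fin c.numStates) (y : Fin σ) :
    (autOf c ac).tr x y = c.dfa.step x y := by
  simp [autOf]

theorem autOf_acc {σ : ℕ} (c : RegLenConstraint σ) (ac : ℕ) (x : Fin c.numStates) :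
    (autOf c ac).acc x ↔ x ∈ c.dfa.accept := by
  simp [autOf]

theorem autOf_foldl {σ : ℕ} (c : RegLenConstraint σ) (ac : ℕ) (v : List (Fin σ)) (x : Fin c.numStates) :
    (v.map Fin.val).foldl (autOf c ac).tr x = c.dfa.evalFrom x v := by
  induction v generalizing x with
  | nil => rfl
  | cons a v ih =>
    rw [List.map_cons, List.foldl_cons, autOf_tr, ih]
    rfl

theorem autOf_acc_foldl {σ : ℕ} (c : RegLenConstraint σ) (ac : ℕ) (v : List (Fin σ)) :
    (autOf c ac).acc ((v.map Fin.val).foldl (autOf c ac).tr (autOf c ac).st) ↔ v ∈ c.dfa.accepts := by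
  have := autOf_foldl c ac v c.dfa.start
  rw [show (autOf c ac).st = c.dfa.start from rfl, this, autOf_acc]
  rfl

theorem exists_map_val {σ : ℕ} (v : List ℕ) (h : ∀ c ∈ v, c < σ) :
    ∃ u : List (Fin σ), u.map Fin.val = v := by
  induction v with
  | nil => exact ⟨[], rfl⟩
  | cons a v ih =>
    obtain ⟨u, hu⟩ := ih (fun c hc => h c (by simp [hc]))
    exact ⟨⟨a, h a (by simp)⟩ :: u, by simp [hu]⟩

theorem clip_le (m : ℕ) (b : ℕ∞) : clip m b ≤ m + 1 := by
  cases b using ENat.recTopCoe with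
  | top => exact le_rfl
  | coe n => exact Nat.min_le_right _ _

/-- Clipping at `m + 1` does not affect comparisons with numbers up to `m`. Gap lengths never exceed
`ℓ`, so the bounds clipped with `m = ℓ` are as good as the original ones. -/
theorem le_clip_iff {m n : ℕ} (hn : n ≤ m) (b : ℕ∞) : n ≤ clip m b ↔ (n : ℕ∞) ≤ b := by
  cases b using ENat.recTopCoe with
  | top =>
    have : clip m ⊤ = m + 1 := rfl
    simp [this]
    omega
  | coe k =>
    have : clip m (k : ℕ∞) = min k (m + 1) := rfl
    rw [this, Nat.cast_le]
    omega

theorem clip_le_iff {m n : ℕ} (hn : n ≤ m) (b : ℕ∞) : clip m b ≤ n ↔ b ≤ (n : ℕ∞) := by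
  cases b using ENat.recTopCoe with
  | top =>
    have : clip m ⊤ = m + 1 := rfl
    simp [this]
    omega
  | coe k =>
    have : clip m (k : ℕ∞) = min k (m + 1) := rfl
    rw [this, Nat.cast_le]
    omega

theorem RegLenConstraint.mem_lang {σ : ℕ} (c : RegLenConstraint σ) (v : List (Fin σ)) :
    v ∈ c.lang σ ↔ v ∈ c.dfa.accepts ∧ c.len.lo ≤ (v.length : ℕ∞) ∧ (v.length : ℕ∞) ≤ c.len.hi := Iff.rfl

/-- Once `ε` belongs to the language, the search has to exclude non-empty words only. The upper
bound clipped at the number of states suffices: if a word longer than this number is admissible, the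
clipped bound exceeds the number of states, and then the search ignores lengths. -/
theorem lang_eq_nil_iff {σ : ℕ} (c : RegLenConstraint σ) (ac : ℕ) (fnd : ℕ)
    (h1 : fnd ≠ 0 → ∃ v : List ℕ, (∀ e ∈ v, e < (autOf c ac).sg) ∧ 1 ≤ v.length ∧
      v.length ≤ clip c.numStates c.len.hi ∧ (autOf c ac).acc (v.foldl (autOf c ac).tr (autOf c ac).st))
    (h2 : ∀ v : List ℕ, (∀ e ∈ v, e < (autOf c ac).sg) → 1 ≤ v.length →
      (v.length ≤ clip c.numStates c.len.hi ∨ (autOf c ac).q < clip c.numStates c.len.hi) →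
      (autOf c ac).acc (v.foldl (autOf c ac).tr (autOf c ac).st) → fnd ≠ 0)
    (hlo : c.len.lo = 0) (hst : c.dfa.start ∈ c.dfa.accept) : fnd = 0 ↔ c.lang σ = {[]} := by
  constructor
  · intro h0
    ext v
    rw [RegLenConstraint.mem_lang]
    constructor
    · rintro ⟨h3, h4, h5⟩
      by_contra hv
      have hpos : 1 ≤ v.length := by
        rw [Nat.one_le_iff_ne_zero]
        intro h; exact hv (List.length_eq_zero_iff.1 h)
      refine h2 (v.map Fin.val) (fun e he => ?_) (by simpa) ?_ ((autOf_acc_foldl c ac v).2 h3) h0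
      · obtain ⟨f, _, rfl⟩ := List.mem_map.1 he
        exact f.2
      · rw [List.length_map]
        by_cases h6 : v.length ≤ c.numStates
        · exact Or.inl ((le_clip_iff h6 _).2 h5)
        · right
          show c.numStates < _
          by_contra h7
          have := (clip_le_iff (n := c.numStates) le_rfl _).1 (not_lt.1 h7)
          have := h5.trans this
          rw [Nat.cast_le] at this
          exact h6 this
    · rintro rfl
      exact ⟨hst, by simp [hlo], by simp⟩
  · intro hL
    by_contra h0
    obtain ⟨v, h3, h4, h5, h6⟩ := h1 h0
    obtain ⟨u, rfl⟩ := exists_map_val (σ := σ) v h3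
    rw [autOf_acc_foldl] at h6
    have hu : u ∈ c.lang σ := by
      rw [RegLenConstraint.mem_lang]
      refine ⟨h6, by simp [hlo], ?_⟩
      rw [List.length_map] at h5
      cases hh : c.len.hi using ENat.recTopCoe with
      | top => exact le_top
      | coe k =>
        rw [hh] at h5
        have : clip c.numStates (k : ℕ∞) = min k (c.numStates + 1) := rfl
        rw [Nat.cast_le]
        omega
    rw [hL] at hu
    rw [show u = [] from hu] at h4
    simp at h4

/-- The `i`-th entries of the tables describe the constraint `c`. -/
structure GapAt (M : ℕ) {σ : ℕ} (c : RegLenConstraint σ) (i : ℕ) (s : St) : Prop where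
  lo : StoredAt (s.arr .inp) (s.arr .lop i) (encodeBound c.len.lo)
  hi : StoredAt (s.arr .inp) (s.arr .hip i) (encodeBound c.len.hi)
  lo_le : s.arr .lop i + (encodeBound c.len.lo).length ≤ M
  hi_le : s.arr .hip i + (encodeBound c.len.hi).length ≤ M
  qq : s.arr .qq i = c.numStates
  st : s.arr .st i = c.dfa.start
  aut : (autOf c (s.arr .ac i)).In M (s.arr .inp)

/-- The command leaves the tables of the constraints unchanged. -/
def Cmd.keepsTables (c : Cmd) : Bool :=
  [Arr.inp, .lop, .hip, .qq, .st, .ac].all (fun x => !c.awr x)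

theorem GapAt.frame {M σ i : ℕ} {c : RegLenConstraint σ} {s s' : St} {a : Cmd} (h : GapAt M c i s)
    (hf : Frame a s s') (ha : a.keepsTables = true) : GapAt M c i s' := by
  simp only [Cmd.keepsTables, List.all_cons, List.all_nil, Bool.and_eq_true, Bool.not_eq_true',
    Bool.and_true] at ha
  obtain ⟨h1, h2, h3, h4, h5, h6⟩ := ha
  constructor
  · rw [hf.arr _ h1, hf.arr _ h2]; exact h.lo
  · rw [hf.arr _ h1, hf.arr _ h3]; exact h.hi
  · rw [hf.arr _ h2]; exact h.lo_le
  · rw [hf.arr _ h3]; exact h.hi_le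
  · rw [hf.arr _ h4]; exact h.qq
  · rw [hf.arr _ h5]; exact h.st
  · rw [hf.arr _ h1, hf.arr _ h6]; exact h.aut

/-- The result of the analysis of a constraint. -/
structure GapInfo (ell : ℕ) {σ : ℕ} (c : RegLenConstraint σ) (i : ℕ) (s : St) : Prop where
  zf : s.arr .zf i ≠ 0 ↔ c.lang σ = {[]}
  lo : s.arr .zf i = 0 → s.arr .lo i = clip ell c.len.lo
  hi : s.arr .zf i = 0 → s.arr .hi i = clip ell c.len.hi

/-- Load the entries for the constraint `i`. -/
def loadGap : Cmd :=
  .lop ::= .get .lop Var.i ;; .hip ::= .get .hip Var.i ;; .q ::= .get .qq Var.i ;;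
  .st ::= .get .st Var.i ;; .ac ::= .get .ac Var.i

/-- Test for the constraint `{ε}`. -/
def testZero : Cmd :=
  .z ::= 0 ;;
  .ite (.get .inp Var.lop) .skip
    (.ite (.get .inp ((Var.lop : Expr) + 1)) .skip
      (.ite (.get .inp ((Var.ac : Expr) + Var.st))
        (.ptr ::= Var.hip ;; .m ::= Var.q ;; decode ;; .lim ::= Var.val ;; bfs ;;
          .z ::= Expr.eqq Var.fnd 0) .skip))

/-- Decode the bounds of the constraint `i`. -/
def decodeBounds : Cmd :=
  .ptr ::= Var.lop ;; .m ::= Var.ell ;; decode ;; .store .lo Var.i Var.val ;;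
  .ptr ::= Var.hip ;; decode ;; .store .hi Var.i Var.val

/-- Analyse all constraints. -/
def classify : Cmd :=
  .for .i .g
    (loadGap ;; testZero ;; .store .zf Var.i Var.z ;; .ite Var.z .skip decodeBounds)

theorem loadGap_spec {Z M σ i : ℕ} {c : RegLenConstraint σ} {s : St} (hi : s.var .i = i)
    (hG : GapAt M c i s) :
    wp Z loadGap (fun s' t => t ≤ 5 ∧ s'.var .lop = s.arr .lop i ∧ s'.var .hip = s.arr .hip i ∧
      s'.var .q = c.numStates ∧ s'.var .st = c.dfa.start ∧ s'.var .ac = s.arr .ac i) s 0 := by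
  simp [loadGap, hi, hG.qq, hG.st]

/-- Only the number 0 has no binary digits. So whether the lower bound vanishes is seen from two
cells without decoding. -/
theorem storedAt_encodeBound_eq_zero {f : ℕ → ℕ} {p : ℕ} {b : ℕ∞} (h : StoredAt f p (encodeBound b)) :
    f p = 0 ∧ f (p + 1) = 0 ↔ b = 0 := by
  cases b using ENat.recTopCoe with
  | top =>
    have h' : StoredAt f p [1] := h
    rw [storedAt_cons] at h'
    simp [h'.1]
  | coe n =>
    have h' : StoredAt f p (0 :: n.bits.length :: n.bits.map Bool.toNat) := h
    rw [storedAt_cons, storedAt_cons] at h'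
    rw [h'.1, h'.2.1, Nat.size_eq_bits_len]
    simp [Nat.size_eq_zero]

/-- The upper bound is decoded only up to the number of states, so the test costs time linear in the
size of the automaton and independent of `ℓ`. This matters because constraints `{ε}` are paid for by
`size` alone. -/
theorem testZero_spec {M Z σ i : ℕ} {c : RegLenConstraint σ} {s : St} (hB : Big M Z)
    (hsg : s.var .sig = σ) (hG : GapAt M c i s) (hlop : s.var .lop = s.arr .lop i)
    (hhip : s.var .hip = s.arr .hip i) (hq : s.var .q = c.numStates) (hst : s.var .st = c.dfa.start)
    (hac : s.var .ac = s.arr .ac i) :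
    wp Z testZero (fun s' t => t ≤ 60 * (c.numStates * (σ + 1)) ∧ (s'.var .z ≠ 0 ↔ c.lang σ = {[]})) s 0 := by
  have hl := hB.lin
  have hM := hB.le
  have hlo := storedAt_encodeBound_eq_zero hG.lo
  have hAle : s.arr .ac i + c.numStates + c.numStates * σ ≤ M := hG.aut.le
  have hslt : (c.dfa.start : ℕ) < c.numStates := c.dfa.start.2
  have hacc := (hG.aut.acc c.dfa.start hslt).trans (autOf_acc c _ c.dfa.start)
  have hacc : s.arr .inp (s.arr .ac i + c.dfa.start) ≠ 0 ↔ c.dfa.start ∈ c.dfa.accept := hacc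
  have hlole := hG.lo_le
  have hlpos : 1 ≤ (encodeBound c.len.lo).length := by
    cases c.len.lo using ENat.recTopCoe with
    | top => exact le_rfl
    | coe n => exact Nat.succ_le_succ (Nat.zero_le _)
  have hqs : 1 ≤ c.numStates * (σ + 1) := Nat.mul_pos (by omega) (by omega)
  have hqs' : c.numStates ≤ c.numStates * (σ + 1) := Nat.le_mul_of_pos_right _ (by omega)
  have hnil : c.lang σ = {[]} → c.len.lo = 0 ∧ c.dfa.start ∈ c.dfa.accept := by
    intro h
    have : [] ∈ c.lang σ := by rw [h]; rfl
    rw [RegLenConstraint.mem_lang] at this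
    exact ⟨by simpa using this.2.1, this.1⟩
  unfold testZero
  simp only [wp_seq, wp_assign, wp_ite, wp_skip, Expr.ok_get, Expr.ok_var, Expr.ok_zero, Expr.ok_one,
    Expr.ok_add, Expr.eval_get, Expr.eval_var, Expr.eval_zero, Expr.eval_one, Expr.eval_add, hlop, hhip,
    hac, hst, hq, St.set_var, St.set_arr, reduceCtorEq, if_true, if_false]
  refine ⟨by omega, trivial, fun h1 => ⟨by omega, ?_⟩, fun h1 => ⟨⟨trivial, by omega, by omega⟩,
    fun h2 => ⟨by omega, ?_⟩, fun h2 => ⟨⟨trivial, trivial, by omega⟩, fun h3 => ⟨trivial, trivial, ?_⟩,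
    fun h3 => ⟨by omega, ?_⟩⟩⟩⟩
  · simp only [ne_eq, not_true_eq_false, false_iff]
    intro h; exact h1 (hlo.2 (hnil h).1).1
  · simp only [ne_eq, not_true_eq_false, false_iff]
    intro h; exact h2 (hlo.2 (hnil h).1).2
  · refine wp_call (decode_spec (m := c.numStates) hB c.len.hi (by simp) (by omega)
      (by simpa using hG.hi_le) (by simpa using hG.hi)) ?_
    intro s1 t1 hf1 ht1 hv1
    refine ⟨trivial, ?_⟩
    have hA1 : (autOf c (s.arr .ac i)).In M (s1.arr .inp) := by rw [hf1.arr _ rfl]; exact hG.aut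
    refine wp_call (bfs_spec (lim := clip c.numStates c.len.hi) (A := autOf c (s.arr .ac i)) hB hA1
      ?_ ?_ ?_ ?_ (by simp [hv1])) ?_
    · simp only [St.set_var, reduceCtorEq, if_false]; rw [hf1.var _ rfl]; simp [hq]; rfl
    · simp only [St.set_var, reduceCtorEq, if_false]; rw [hf1.var _ rfl]; simp [hac]; rfl
    · simp only [St.set_var, reduceCtorEq, if_false]; rw [hf1.var _ rfl]; simp [hsg]; rfl
    · simp only [St.set_var, reduceCtorEq, if_false]; rw [hf1.var _ rfl]; simp [hst]; rfl
    · rintro s2 t2 hf2 ht2 ⟨h4, h5⟩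
      refine ⟨by simp; omega, ?_, ?_⟩
      · have : (autOf c (s.arr .ac i)).q * ((autOf c (s.arr .ac i)).sg + 1) = c.numStates * (σ + 1) := rfl
        omega
      · rw [← lang_eq_nil_iff c _ _ h4 h5 (hlo.1 ⟨h1, h2⟩) (hacc.1 h3)]
        exact ⟨fun h => of_ite_ne h, fun h => by simp [h]⟩
  · simp only [ne_eq, not_true_eq_false, false_iff]
    intro h; exact hacc.2 (hnil h).2 h3

theorem decodeBounds_spec {M Z σ i ell : ℕ} {c : RegLenConstraint σ} {s : St} (hB : Big M Z)
    (hell : s.var .ell = ell) (hM : ell ≤ M) (hi : s.var .i = i)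
    (hG : GapAt M c i s) (hlop : s.var .lop = s.arr .lop i) (hhip : s.var .hip = s.arr .hip i) :
    wp Z decodeBounds (fun s' t => t ≤ 18 * (ell + 1) ∧
      s'.arr .lo = Function.update (s.arr .lo) i (clip ell c.len.lo) ∧
      s'.arr .hi = Function.update (s.arr .hi) i (clip ell c.len.hi)) s 0 := by
  unfold decodeBounds
  simp only [wp_seq, wp_assign, Expr.ok_var, Expr.eval_var, hlop, hell, St.set_var, reduceCtorEq, if_false]
  refine ⟨trivial, trivial, ?_⟩
  refine wp_call (decode_spec (m := ell) hB c.len.lo (by simp) hM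
      (by simpa using hG.lo_le) (by simpa using hG.lo)) ?_
  intro s1 t1 hf1 ht1 hv1
  have hi1 : s1.var .i = i := by rw [hf1.var _ rfl]; simp [hi]
  have hm1 : s1.var .m = ell := by rw [hf1.var _ rfl]; simp
  have hhip1 : s1.var .hip = s.arr .hip i := by rw [hf1.var _ rfl]; simp [hhip]
  have hinp1 : s1.arr .inp = s.arr .inp := by rw [hf1.arr _ rfl]; simp
  simp only [wp_store, Expr.ok_var, Expr.eval_var, hi1, hv1, St.put_var, hhip1]
  refine ⟨trivial, trivial, trivial, ?_⟩
  refine wp_call (decode_spec (m := ell) hB c.len.hi (by simp [hm1]) hM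
      (by simpa using hG.hi_le) (by simpa [St.put_arr_ne, hinp1] using hG.hi)) ?_
  intro s2 t2 hf2 ht2 hv2
  have hi2 : s2.var .i = i := by rw [hf2.var _ rfl]; simp [hi1]
  simp only [hi2, hv2]
  refine ⟨trivial, trivial, by omega, ?_, ?_⟩
  · rw [St.put_arr_ne _ _ _ _ _ (by simp), hf2.arr _ rfl, St.set_arr, St.put_arr_self, hf1.arr _ rfl]
    rfl
  · rw [St.put_arr_self, hf2.arr _ rfl, St.set_arr, St.put_arr_ne _ _ _ _ _ (by simp), hf1.arr _ rfl]
    rfl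

open Classical in
/-- A bound for the time of the analysis of a constraint. -/
noncomputable def gapCost (ell : ℕ) {σ : ℕ} (c : RegLenConstraint σ) : ℕ :=
  80 * (c.numStates * (σ + 1)) + if c.lang σ = {[]} then 0 else 18 * (ell + 1)

/-- The bounds are decoded up to `ℓ` only for constraints other than `{ε}`; each of these
contributes at least 1 to `states`. -/
theorem classify_spec {M Z σ ell : ℕ} {gc : List (RegLenConstraint σ)} {s : St} (hB : Big M Z)
    (hsg : s.var .sig = σ) (hell : s.var .ell = ell) (hM : ell ≤ M) (hg : s.var .g = gc.length)
    (hgM : gc.length ≤ M) (hG : ∀ i (h : i < gc.length), GapAt M gc[i] i s) :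
    wp Z classify (fun s' t =>
      t ≤ ∑ i ∈ Finset.range gc.length, ((gc[i]?.map (gapCost ell)).getD 0 + 2) + 2 ∧
      ∀ i (h : i < gc.length), GapInfo ell gc[i] i s') s 0 := by
  have hl := hB.lin
  have hM16 := hB.le
  unfold classify
  refine wp_for gc.length (fun k s' => ∀ i (h : i < gc.length), i < k → GapInfo ell gc[i] i s')
    (fun i => (gc[i]?.map (gapCost ell)).getD 0) hg
    (by simp) rfl rfl (by omega) (by simp) ?_ ?_
  · intro i hi s' hf hii hI
    have hGi := (hG i hi).frame hf rfl
    have hsg' : s'.var .sig = σ := by rw [hf.var _ rfl, hsg]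
    have hell' : s'.var .ell = ell := by rw [hf.var _ rfl, hell]
    rw [wp_seq]
    refine wp_call (loadGap_spec hii hGi) ?_
    rintro s1 t1 hf1 ht1 ⟨e1, e2, e3, e4, e5⟩
    have hG1 := hGi.frame hf1 rfl
    rw [wp_seq]
    refine wp_call (testZero_spec (i := i) hB (by rw [hf1.var _ rfl, hsg']) hG1 (by rw [e1, hf1.arr _ rfl])
      (by rw [e2, hf1.arr _ rfl]) e3 e4 (by rw [e5, hf1.arr _ rfl])) ?_
    intro s2 t2 hf2 ht2 hz2
    have hG2 := hG1.frame hf2 rfl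
    have hi2 : s2.var .i = i := by rw [hf2.var _ rfl, hf1.var _ rfl, hii]
    have hzf2 : s2.arr .zf = s'.arr .zf := by rw [hf2.arr _ rfl, hf1.arr _ rfl]
    have hlo2 : s2.arr .lo = s'.arr .lo := by rw [hf2.arr _ rfl, hf1.arr _ rfl]
    have hhi2 : s2.arr .hi = s'.arr .hi := by rw [hf2.arr _ rfl, hf1.arr _ rfl]
    have hlp2 : s2.var .lop = s2.arr .lop i := by
      rw [hf2.var _ rfl, e1, hf2.arr _ rfl, hf1.arr _ rfl]
    have hhp2 : s2.var .hip = s2.arr .hip i := by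
      rw [hf2.var _ rfl, e2, hf2.arr _ rfl, hf1.arr _ rfl]
    have hell2 : s2.var .ell = ell := by rw [hf2.var _ rfl, hf1.var _ rfl, hell']
    have hqs : 1 ≤ gc[i].numStates * (σ + 1) :=
      Nat.mul_pos (Nat.zero_lt_of_lt gc[i].dfa.start.2) (by omega)
    rw [wp_seq]
    simp only [wp_store, Expr.ok_var, Expr.eval_var, hi2]
    refine ⟨trivial, trivial, ?_⟩
    simp only [wp_ite, wp_skip, Expr.ok_var, Expr.eval_var, St.put_var]
    have hcost : (gc[i]?.map (gapCost ell)).getD 0 = gapCost ell gc[i] := by simp [hi]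
    refine ⟨trivial, fun hz => ?_, fun hz => ?_⟩
    · refine ⟨?_, fun k hk hki => ?_⟩
      · rw [hcost, gapCost, if_pos (hz2.1 hz)]; omega
      · by_cases hki' : k = i
        · subst hki'
          refine ⟨?_, ?_, ?_⟩
          · rw [St.set_arr, St.put_arr_self]; simpa using hz2
          · rw [St.set_arr, St.put_arr_self]; simp [hz]
          · rw [St.set_arr, St.put_arr_self]; simp [hz]
        · have := hI k hk (by omega)
          refine ⟨?_, ?_, ?_⟩
          · rw [St.set_arr, St.put_arr_self, Function.update_of_ne hki', hzf2]; exact this.zf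
          · rw [St.set_arr, St.put_arr_self, Function.update_of_ne hki', hzf2,
              St.put_arr_ne _ _ _ _ _ (by simp), hlo2]; exact this.lo
          · rw [St.set_arr, St.put_arr_self, Function.update_of_ne hki', hzf2,
              St.put_arr_ne _ _ _ _ _ (by simp), hhi2]; exact this.hi
    · have hf3 : Frame (.store .zf Var.i Var.z) s2 (s2.put .zf i (s2.var .z)) :=
        ⟨fun _ _ => rfl, fun d hd => St.put_arr_ne _ _ _ _ _ (by
          rintro rfl
          simp [Cmd.awr] at hd)⟩
      refine wp_call (decodeBounds_spec (i := i) hB (by simp [hell2]) hM (by simp [hi2]) (hG2.frame hf3 rfl)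
        (by simp [hlp2, St.put_arr_ne]) (by simp [hhp2, St.put_arr_ne])) ?_
      rintro s4 t4 hf4 ht4 ⟨h5, h6⟩
      have hzf4 : s4.arr .zf = Function.update (s'.arr .zf) i (s2.var .z) := by
        rw [hf4.arr _ rfl, St.put_arr_self, hzf2]
      rw [St.put_arr_ne _ _ _ _ _ (by simp), hlo2] at h5
      rw [St.put_arr_ne _ _ _ _ _ (by simp), hhi2] at h6
      refine ⟨?_, fun k hk hki => ?_⟩
      · rw [hcost, gapCost, if_neg (fun h => hz2.2 h hz)]; omega
      · by_cases hki' : k = i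
        · subst hki'
          refine ⟨?_, ?_, ?_⟩
          · rw [St.set_arr, hzf4]; simpa using hz2
          · intro _; rw [St.set_arr, h5]; simp
          · intro _; rw [St.set_arr, h6]; simp
        · have := hI k hk (by omega)
          refine ⟨?_, ?_, ?_⟩
          · rw [St.set_arr, hzf4, Function.update_of_ne hki']; exact this.zf
          · rw [St.set_arr, hzf4, Function.update_of_ne hki', h5, Function.update_of_ne hki']; exact this.lo
          · rw [St.set_arr, hzf4, Function.update_of_ne hki', h6, Function.update_of_ne hki']; exact this.hi
  · intro s' t hf _ hI ht
    exact ⟨by simpa using ht, fun i h => hI i h h⟩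

/-! ### Subsequences letter by letter -/

section
variable {α : Type}

/-- The positions that can follow a position with letter `a` from `C` by the gap constraint `L`. -/
def advance (w : List α) (L : Language α) (a : α) (C : ℕ → Prop) (j' : ℕ) : Prop :=
  ∃ j, ∃ h : j < w.length, C j ∧ w[j] = a ∧ j < j' ∧ gap w j j' ∈ L

/-- The word `u` can be embedded into `w` with first position in `C`. -/
def Matches (w : List α) : List (Language α) → List α → (ℕ → Prop) → Prop
  | [], [a], C => ∃ j, ∃ h : j < w.length, C j ∧ w[j] = a
  | L :: gc, a :: u, C => Matches w gc u (advance w L a C)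
  | _, _, _ => False

theorem satisfies_iff (gc : List (Language α)) (w : List α) (e : Fin (gc.length + 1) → Fin w.length) :
    Satisfies gc w e ↔ ∀ j : Fin gc.length, e j.castSucc < e j.succ ∧
      gap w (e j.castSucc) (e j.succ) ∈ gc.get j := by
  unfold Satisfies
  rw [Fin.strictMono_iff_lt_succ, ← forall_and]

/-- Induction on the constraints with `C` arbitrary. Splitting off the first position of the
embedding leaves an embedding of the remaining letters that begins in the set `advance w L a C`. -/
theorem matches_iff (w : List α) (gc : List (Language α)) (u : List α) (C : ℕ → Prop) :
    Matches w gc u C ↔ ∃ e : Fin (gc.length + 1) → Fin w.length,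
      Satisfies gc w e ∧ C (e 0) ∧ u = List.ofFn fun i => w.get (e i) := by
  induction gc generalizing u C with
  | nil =>
    constructor
    · intro h
      match u, h with
      | [a], ⟨j, hj, hC, ha⟩ =>
        refine ⟨fun _ => ⟨j, hj⟩, ?_, hC, by simp [ha]⟩
        rw [satisfies_iff]
        exact fun j => Fin.elim0 j
    · rintro ⟨e, -, hC, rfl⟩
      simp only [List.length_nil, Nat.reduceAdd, List.ofFn_succ, List.ofFn_zero]
      exact ⟨e 0, (e 0).2, hC, rfl⟩
  | cons L gc ih =>
    constructor
    · intro h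
      match u, h with
      | a :: u, h =>
        obtain ⟨e, h1, ⟨j, hj, hC, ha, hlt, hg⟩, hu⟩ := (ih u _).1 h
        rw [satisfies_iff] at h1
        refine ⟨Fin.cons (⟨j, hj⟩ : Fin w.length) e, ?_, hC, ?_⟩
        · rw [satisfies_iff]
          intro i
          refine Fin.cases ?_ (fun i => ?_) i
          · exact ⟨hlt, hg⟩
          · exact h1 i
        · rw [List.ofFn_succ]
          exact congrArg₂ List.cons ha.symm hu
    · rintro ⟨e, h1, hC, rfl⟩
      rw [satisfies_iff] at h1
      rw [List.ofFn_succ]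
      refine (ih _ _).2 ⟨fun i => e i.succ, ?_, ?_, rfl⟩
      · rw [satisfies_iff]
        exact fun i => h1 i.succ
      · exact ⟨e 0, (e 0).2, hC, rfl, (h1 0).1, (h1 0).2⟩

theorem mem_subseqSet (w : List α) (gc : List (Language α)) (u : List α) :
    u ∈ subseqSet gc w ↔ Matches w gc u fun _ => True := by
  rw [matches_iff]
  simp [subseqSet]

theorem Matches.length_eq {w : List α} {gc : List (Language α)} {u : List α} {C : ℕ → Prop}
    (h : Matches w gc u C) : u.length = gc.length + 1 := by
  obtain ⟨e, _, _, rfl⟩ := (matches_iff _ _ _ _).1 h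
  simp

theorem Matches.congr {w : List α} {gc : List (Language α)} {u : List α} {C C' : ℕ → Prop}
    (h : ∀ j < w.length, C j ↔ C' j) : Matches w gc u C ↔ Matches w gc u C' := by
  rw [matches_iff, matches_iff]
  simp only [h _ (Fin.isLt _)]

end

/-! ### The rows of the dynamic program for both strings -/

/-- The instance is stored in the state, and all constraints have been analysed. -/
structure Env (M ell : ℕ) {σ : ℕ} (gc : List (RegLenConstraint σ)) (ws : ℕ → List (Fin σ)) (s : St) :
    Prop where
  sig_eq : s.var .sig = σ
  g_eq : s.var .g = gc.length
  ell_eq : s.var .ell = ell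
  ell_pos : 1 ≤ ell
  ell_lt : ell + 1 ≤ M
  g_lt : gc.length + 1 ≤ M
  len : ∀ h < 2, s.arr .wlen h = (ws h).length
  len_le : ∀ h < 2, (ws h).length ≤ ell
  word : ∀ h < 2, ∀ j (hj : j < (ws h).length), s.arr .inp (s.arr .wbase h + j) = (ws h)[j]
  word_le : ∀ h < 2, s.arr .wbase h + (ws h).length ≤ M
  gap : ∀ i (h : i < gc.length), GapAt M gc[i] i s
  info : ∀ i (h : i < gc.length), GapInfo ell gc[i] i s

/-- The command leaves the description of the instance unchanged. -/
def Cmd.keepsEnv (c : Cmd) : Bool :=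
  [Var.sig, .g, .ell].all (fun x => !c.wr x) &&
    [Arr.wlen, .wbase, .zf, .lo, .hi].all (fun x => !c.awr x) && c.keepsTables

theorem Env.frame {M ell σ : ℕ} {gc : List (RegLenConstraint σ)} {ws : ℕ → List (Fin σ)} {s s' : St}
    {a : Cmd} (h : Env M ell gc ws s) (hf : Frame a s s') (ha : a.keepsEnv = true) :
    Env M ell gc ws s' := by
  simp only [Cmd.keepsEnv, List.all_cons, List.all_nil, Bool.and_eq_true, Bool.not_eq_true',
    Bool.and_true] at ha
  obtain ⟨⟨⟨h1, h2, h3⟩, h4, h5, h6, h7, h8⟩, h9⟩ := ha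
  have hinp : s'.arr .inp = s.arr .inp := by
    simp only [Cmd.keepsTables, List.all_cons, List.all_nil, Bool.and_eq_true, Bool.not_eq_true',
      Bool.and_true] at h9
    exact hf.arr _ h9.1
  refine ⟨by rw [hf.var _ h1, h.sig_eq], by rw [hf.var _ h2, h.g_eq], by rw [hf.var _ h3, h.ell_eq], h.ell_pos,
    h.ell_lt, h.g_lt, by rw [hf.arr _ h4]; exact h.len, h.len_le, by rw [hinp, hf.arr _ h5]; exact h.word,
    by rw [hf.arr _ h5]; exact h.word_le, fun i hi => (h.gap i hi).frame hf h9, fun i hi => ?_⟩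
  have := h.info i hi
  exact ⟨by rw [hf.arr _ h6]; exact this.zf, by rw [hf.arr _ h6, hf.arr _ h7]; exact this.lo,
    by rw [hf.arr _ h6, hf.arr _ h8]; exact this.hi⟩

theorem Env.of_eq {M ell σ : ℕ} {gc : List (RegLenConstraint σ)} {ws : ℕ → List (Fin σ)} {s s' : St}
    (h : Env M ell gc ws s) (h1 : ∀ x, x = .sig ∨ x = .g ∨ x = .ell → s'.var x = s.var x)
    (h2 : ∀ d, d ≠ .v → d ≠ .row → d ≠ .ans → s'.arr d = s.arr d) : Env M ell gc ws s' := by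
  -- This command is never run. It only provides a write set for which `Env.frame` can be applied to
  -- the arrays.
  let c : Cmd := .seq (.for .t .n (.store .v 0 0)) (.seq (.store .row 0 0) (.store .ans 0 0))
  have hf : Frame c ⟨s.var, s'.arr⟩ ⟨s.var, s'.arr⟩ := Frame.refl _ _
  have h3 : Env M ell gc ws ⟨s.var, s'.arr⟩ := by
    refine h.frame (a := c) ⟨fun _ _ => rfl, fun d hd => ?_⟩ rfl
    refine h2 d ?_ ?_ ?_ <;> rintro rfl <;> simp [c, Cmd.awr, Cmd.for] at hd
  have hs : s'.var .sig = s.var .sig := h1 _ (by simp)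
  have hg : s'.var .g = s.var .g := h1 _ (by simp)
  have he : s'.var .ell = s.var .ell := h1 _ (by simp)
  exact ⟨hs.trans h3.sig_eq, hg.trans h3.g_eq, he.trans h3.ell_eq, h3.ell_pos, h3.ell_lt, h3.g_lt, h3.len,
    h3.len_le, h3.word, h3.word_le, fun i hi => by
      have := h3.gap i hi
      exact ⟨this.lo, this.hi, this.lo_le, this.hi_le, this.qq, this.st, this.aut⟩,
    fun i hi => by
      have := h3.info i hi
      exact ⟨this.zf, this.lo, this.hi⟩⟩

/-- The letters of a word as numbers. -/
def letter {σ : ℕ} (w : List (Fin σ)) (j : ℕ) : ℕ := if h : j < w.length then w[j] else 0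

theorem letter_eq {σ : ℕ} (w : List (Fin σ)) {j : ℕ} (h : j < w.length) : letter w j = w[j] := by
  simp [letter, h]

theorem gap_eq {α : Type} (w : List α) (i j : ℕ) : gap w i j = (w.drop (i + 1)).take (j - (i + 1)) := by
  unfold gap
  rw [List.drop_take]

theorem length_gap {α : Type} (w : List α) {i j : ℕ} (hj : j ≤ w.length) :
    (gap w i j).length = j - (i + 1) := by
  rw [gap_eq, List.length_take, List.length_drop]
  omega

theorem runN_letter {σ : ℕ} (tr : ℕ → ℕ → ℕ) (w : List (Fin σ)) (s x m : ℕ) (h : x + m ≤ w.length) :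
    runN tr (letter w) s x m = (((w.drop x).take m).map Fin.val).foldl tr s := by
  induction m with
  | zero => simp [runN]
  | succ m ih =>
    rw [runN, ih (by omega), letter_eq w (by omega), List.take_add_one, List.getElem?_drop,
      List.getElem?_eq_getElem (by omega)]
    simp

/-- The data for the step with constraint `c` in the word `w`. -/
def stepData {σ : ℕ} (c : RegLenConstraint σ) (ac ell : ℕ) (w : List (Fin σ)) (a wb rin rout : ℕ) : StepData where
  n := w.length
  wb := wb
  rin := rin
  rout := rout
  a := a
  sg := σ
  q := c.numStates
  st := c.dfa.start
  ac := ac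
  lo := clip ell c.len.lo
  hi := clip ell c.len.hi
  w := letter w
  acc := (autOf c ac).acc
  tr := (autOf c ac).tr

/-- This connects the scan with the combinatorial recursion. The gap between `j` and `j'` has length
`j' - (j + 1)`, which is at most `ell`, so the clipped bounds may be used. -/
theorem reach_iff {σ : ℕ} (c : RegLenConstraint σ) (ac ell : ℕ) (w : List (Fin σ)) (a : Fin σ)
    (wb rin rout : ℕ) (C C' : ℕ → Prop) (hC : ∀ j < w.length, C j ↔ C' j) (hell : w.length ≤ ell) {j' : ℕ}
    (hj' : j' < w.length) :
    (stepData c ac ell w a wb rin rout).Reach C j' ↔ advance w (c.lang σ) a C' j' := by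
  have hacc : ∀ j, j + 1 ≤ j' → ((autOf c ac).acc (runN (autOf c ac).tr (letter w) c.dfa.start (j + 1)
      (j' - (j + 1))) ↔ gap w j j' ∈ c.dfa.accepts) := by
    intro j hj
    rw [runN_letter _ _ _ _ _ (by omega), ← gap_eq]
    exact autOf_acc_foldl c ac _
  constructor
  · rintro ⟨j, ⟨h1, h2, h3⟩, h4, h5⟩
    have h2 : letter w j = a := h2
    have h3 : j + 1 + clip ell c.len.lo ≤ j' := h3
    have h4 : j' - (j + 1) ≤ clip ell c.len.hi := h4
    have hj : j < w.length := by omega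
    refine ⟨j, hj, (hC j hj).1 h1, ?_, by omega, ?_⟩
    · rw [letter_eq w hj] at h2
      exact Fin.ext h2
    · rw [RegLenConstraint.mem_lang, length_gap _ hj'.le]
      exact ⟨(hacc j (by omega)).1 h5, (clip_le_iff (m := ell) (by omega) _).1 (by omega),
        (le_clip_iff (by omega) _).1 h4⟩
  · rintro ⟨j, hj, h1, h2, h3, h4⟩
    rw [RegLenConstraint.mem_lang, length_gap _ hj'.le] at h4
    have h5 := (clip_le_iff (m := ell) (by omega) _).2 h4.2.1
    refine ⟨j, ⟨(hC j hj).2 h1, ?_, ?_⟩, (le_clip_iff (m := ell) (by omega) _).2 h4.2.2,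
      (hacc j (by omega)).2 h4.1⟩
    · show letter w j = a
      rw [letter_eq w hj, h2]
    · show j + 1 + clip ell c.len.lo ≤ j'
      omega

theorem zero_reach_iff {σ : ℕ} (w : List (Fin σ)) (a : Fin σ) (C C' : ℕ → Prop)
    (hC : ∀ j < w.length, C j ↔ C' j) {j' : ℕ} (hj' : j' < w.length) :
    (∃ i, C i ∧ letter w i = a ∧ i + 1 = j') ↔ advance w ({[]} : Set (List (Fin σ))) a C' j' := by
  constructor
  · rintro ⟨i, h1, h2, rfl⟩
    have hi : i < w.length := by omega
    refine ⟨i, hi, (hC i hi).1 h1, ?_, by omega, ?_⟩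
    · rw [letter_eq w hi] at h2
      exact Fin.ext h2
    · show gap w i (i + 1) = []
      rw [← List.length_eq_zero_iff, length_gap _ hj'.le]
      omega
  · rintro ⟨j, hj, h1, h2, h3, h4⟩
    have h4 : gap w j j' = [] := h4
    rw [← List.length_eq_zero_iff, length_gap _ hj'.le] at h4
    exact ⟨j, (hC j hj).2 h1, by rw [letter_eq w hj, h2], by omega⟩

/-- Row `t` of the dynamic program for the word `h`. -/
def RowIs {σ : ℕ} (ell : ℕ) (ws : ℕ → List (Fin σ)) (t h : ℕ) (C : ℕ → Prop) (s : St) : Prop :=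
  ∀ j < (ws h).length, s.arr .row ((t + t + h) * ell + j) ≠ 0 ↔ C j

/-- Select the word `h`. -/
def selectWord : Cmd :=
  .n ::= .get .wlen Var.h ;; .wb ::= .get .wbase Var.h ;;
  .rin ::= ((Var.t : Expr) + Var.t + Var.h) * Var.ell

/-- Compute the rows for depth `t + 1` from those for depth `t`. -/
def step : Cmd :=
  .i ::= Var.t ;; .a ::= .get .v Var.t ;; loadGap ;;
  .lo ::= .get .lo Var.i ;; .hi ::= .get .hi Var.i ;; .z ::= .get .zf Var.i ;; .two ::= 2 ;;
  .for .h .two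
    (selectWord ;; .rout ::= ((Var.t : Expr) + Var.t + 2 + Var.h) * Var.ell ;;
     .ite Var.z zeroStep gapStep)

/-- The rows of depth `t` for the two strings begin at `2 * t * ell` and `(2 * t + 1) * ell`, so the
input row ends before the output row begins. -/
theorem row_le {M ell t h n j : ℕ} (hell : ell + 1 ≤ M) (ht : t + 2 ≤ M) (hh : h < 2) (hn : n ≤ ell)
    (hj : j ≤ n) :
    (t + t + h) * ell + n ≤ (t + t + 2 + h) * ell ∧ (t + t + 2 + h) * ell + n ≤ 2 * (M * M) ∧
      (t + t + h) * ell ≤ (t + t + 2 + h) * ell ∧ t + t + 2 + h ≤ 2 * M := by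
  have h1 : (t + t + 2 + h) * ell = (t + t + h) * ell + 2 * ell := by ring
  have h2 : (t + t + 2 + h + 1) * ell ≤ (M + M) * M := Nat.mul_le_mul (by omega) (by omega)
  have h3 : (t + t + 2 + h + 1) * ell = (t + t + 2 + h) * ell + ell := by ring
  have h4 : (M + M) * M = 2 * (M * M) := by ring
  omega

open Classical in
/-- The weight of a constraint in the time bounds. -/
noncomputable def weight {σ : ℕ} (c : RegLenConstraint σ) : ℕ :=
  if c.lang σ = {[]} then 1 else c.numStates

theorem weight_pos {σ : ℕ} (c : RegLenConstraint σ) : 1 ≤ weight c := by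
  unfold weight
  split
  · exact le_rfl
  · exact Nat.zero_lt_of_lt c.dfa.start.2

/-- The last clause says that the rows up to depth `t` survive. So after backtracking the search can
go on with the next letter without recomputing anything. -/
theorem step_spec {M Z ell σ t : ℕ} {gc : List (RegLenConstraint σ)} {ws : ℕ → List (Fin σ)} {s : St}
    {C : ℕ → ℕ → Prop} (hB : Big M Z) (hE : Env M ell gc ws s) (ht : s.var .t = t) (htg : t < gc.length)
    (a : Fin σ) (ha : s.arr .v t = a) (hC : ∀ h < 2, RowIs ell ws t h (C h) s) :
    wp Z step (fun s' u => u ≤ 400 * ((ell + 1) * weight gc[t]) ∧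
      (∀ h < 2, RowIs ell ws (t + 1) h (advance (ws h) (gc[t].lang σ) a (C h)) s') ∧
      ∀ i < (t + t + 2) * ell, s'.arr .row i = s.arr .row i) s 0 := by
  have hl := hB.lin
  have hM := hB.le
  have hMM := hB.sq_le
  have hgM := hE.g_lt
  have heM := hE.ell_lt
  have hG := hE.gap t htg
  have hI := hE.info t htg
  have hAle : s.arr .ac t + gc[t].numStates + gc[t].numStates * σ ≤ M := hG.aut.le
  generalize hc : gc[t] = c at *
  have hf0 : Frame (.seq (.i ::= 0) (.a ::= 0)) s ((s.set .i t).set .a a) := by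
    refine ⟨fun y hy => ?_, fun _ _ => rfl⟩
    have h1 : y ≠ .i := by rintro rfl; simp [Cmd.wr] at hy
    have h2 : y ≠ .a := by rintro rfl; simp [Cmd.wr] at hy
    simp [h1, h2]
  unfold step
  simp only [wp_seq, wp_assign, Expr.ok_var, Expr.ok_get, Expr.eval_var, Expr.eval_get, ht, ha, St.set_var,
    St.set_arr, reduceCtorEq, if_false]
  refine ⟨trivial, trivial, ?_⟩
  refine wp_call (loadGap_spec (M := M) (i := t) (c := c) (by simp) (hG.frame hf0 rfl)) ?_
  rintro s1 t1 hf1 ht1 ⟨e1, e2, e3, e4, e5⟩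
  have hi1 : s1.var .i = t := by rw [hf1.var _ rfl]; simp
  have ha1 : s1.var .a = a := by rw [hf1.var _ rfl]; simp
  have ht1' : s1.var .t = t := by rw [hf1.var _ rfl]; simp [ht]
  have harr1 : s1.arr = s.arr := by funext d; rw [hf1.arr _ rfl]; simp
  simp only [hi1, harr1, Expr.ok_two, Expr.eval_two]
  refine ⟨trivial, trivial, trivial, by omega, ?_⟩
  generalize hs2 : (((s1.set .lo (s.arr .lo t)).set .hi (s.arr .hi t)).set .z (s.arr .zf t)).set .two 2 = s2
  have hE2 : Env M ell gc ws s2 := by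
    refine hE.of_eq ?_ (fun d _ _ _ => by subst hs2; simp [harr1])
    rintro x (rfl | rfl | rfl) <;> subst hs2 <;> simp only [St.set_var, reduceCtorEq, if_false] <;>
      rw [hf1.var _ rfl] <;> simp
  have hrow2 : s2.arr .row = s.arr .row := by subst hs2; simp [harr1]
  have hlo2 : s2.var .lo = s.arr .lo t := by subst hs2; simp
  have hhi2 : s2.var .hi = s.arr .hi t := by subst hs2; simp
  have hz2 : s2.var .z = s.arr .zf t := by subst hs2; simp
  have htwo2 : s2.var .two = 2 := by subst hs2; simp
  have ha2 : s2.var .a = a := by subst hs2; simp [ha1]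
  have ht2 : s2.var .t = t := by subst hs2; simp [ht1']
  have hq2 : s2.var .q = c.numStates := by subst hs2; simp [e3]
  have hst2 : s2.var .st = c.dfa.start := by subst hs2; simp [e4]
  have hac2 : s2.var .ac = s.arr .ac t := by subst hs2; simp [e5]
  have harr2 : s2.arr = s.arr := by subst hs2; simp [harr1]
  have hw := weight_pos c
  have hw' : ell + 1 ≤ (ell + 1) * weight c := Nat.le_mul_of_pos_right _ hw
  clear hs2
  refine wp_for_const 2 (fun h s' =>
      (∀ h' < h, RowIs ell ws (t + 1) h' (advance (ws h') (c.lang σ) a (C h')) s') ∧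
      ∀ i < (t + t + 2) * ell, s'.arr .row i = s.arr .row i) (180 * ((ell + 1) * weight c) + 10) htwo2 (by simp)
    rfl rfl (by omega) ⟨by simp, by simp [hrow2]⟩ ?_ ?_
  · rintro h hh s3 hf3 hh3 ⟨hI1, hI2⟩
    have hE3 := hE2.frame hf3 rfl
    have ht3 : s3.var .t = t := by rw [hf3.var _ rfl, ht2]
    have hz3 : s3.var .z = s.arr .zf t := by rw [hf3.var _ rfl, hz2]
    have hn := hE.len_le h hh
    obtain ⟨hr1, hr2, hr3, hr4⟩ := row_le (M := M) (t := t) hE.ell_lt (by omega) hh hn le_rfl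
    have harr3 : ∀ d, d ≠ .row → d ≠ .tt → d ≠ .pp → d ≠ .bb → d ≠ .b2 → s3.arr d = s.arr d := by
      intro d h1 h2 h3 h4 h5
      rw [hf3.arr d (by cases d <;> first | rfl | contradiction), harr2]
    have hinp3 := harr3 .inp (by simp) (by simp) (by simp) (by simp) (by simp)
    have hwb3 := harr3 .wbase (by simp) (by simp) (by simp) (by simp) (by simp)
    simp only [selectWord, wp_seq, wp_assign, Expr.ok_var, Expr.ok_get, Expr.ok_add, Expr.ok_mul, Expr.ok_two,
      Expr.eval_var, Expr.eval_get, Expr.eval_add, Expr.eval_mul, Expr.eval_two, hh3, ht3, hE3.ell_eq,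
      hE3.len h hh, hwb3, St.set_var, St.set_arr, reduceCtorEq, if_false, wp_ite, hz3]
    refine ⟨trivial, trivial, ⟨⟨⟨trivial, trivial, by omega⟩, trivial, by omega⟩, trivial, by omega⟩,
      ⟨⟨⟨⟨trivial, trivial, by omega⟩, by omega, by omega⟩, trivial, by omega⟩, trivial, by omega⟩,
      trivial, ?_⟩
    generalize hs4 : (((s3.set .n (ws h).length).set .wb (s.arr .wbase h)).set .rin ((t + t + h) * ell)).set
      .rout ((t + t + 2 + h) * ell) = s4
    have harr4 : s4.arr = s3.arr := by subst hs4; rfl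
    have hn4 : s4.var .n = (ws h).length := by subst hs4; simp
    have hwb4 : s4.var .wb = s.arr .wbase h := by subst hs4; simp
    have hrin4 : s4.var .rin = (t + t + h) * ell := by subst hs4; simp
    have hrout4 : s4.var .rout = (t + t + 2 + h) * ell := by subst hs4; simp
    have hvar4 : ∀ x, x ≠ .n → x ≠ .wb → x ≠ .rin → x ≠ .rout → s4.var x = s3.var x := by
      intro x h1 h2 h3 h4
      subst hs4
      simp [h1, h2, h3, h4]
    have ha4 : s4.var .a = a := by
      rw [hvar4 _ (by simp) (by simp) (by simp) (by simp), hf3.var _ rfl, ha2]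
    have hq4 : s4.var .q = c.numStates := by
      rw [hvar4 _ (by simp) (by simp) (by simp) (by simp), hf3.var _ rfl, hq2]
    have hst4 : s4.var .st = c.dfa.start := by
      rw [hvar4 _ (by simp) (by simp) (by simp) (by simp), hf3.var _ rfl, hst2]
    have hac4 : s4.var .ac = s.arr .ac t := by
      rw [hvar4 _ (by simp) (by simp) (by simp) (by simp), hf3.var _ rfl, hac2]
    have hlo4 : s4.var .lo = s.arr .lo t := by
      rw [hvar4 _ (by simp) (by simp) (by simp) (by simp), hf3.var _ rfl, hlo2]
    have hhi4 : s4.var .hi = s.arr .hi t := by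
      rw [hvar4 _ (by simp) (by simp) (by simp) (by simp), hf3.var _ rfl, hhi2]
    have hsig4 : s4.var .sig = σ := by
      rw [hvar4 _ (by simp) (by simp) (by simp) (by simp), hE3.sig_eq]
    clear hs4
    have hword : ∀ j < (ws h).length, s4.arr .inp (s.arr .wbase h + j) = letter (ws h) j := by
      intro j hj
      rw [harr4, hinp3, hE.word h hh j hj, letter_eq _ hj]
    have hrowC : ∀ j < (ws h).length, s4.arr .row ((t + t + h) * ell + j) ≠ 0 ↔ C h j := by
      intro j hj
      rw [harr4, hI2, hC h hh j hj]
      exact mul_add_lt (by omega) (by omega)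
    -- The common end of the cases `{ε}` and not `{ε}`: the new row is correct, and the row of the
    -- other string at the same depth, if already computed, lies before it and is not touched.
    have key : ∀ s5 : St, (∀ j < (ws h).length, s5.arr .row ((t + t + 2 + h) * ell + j) ≠ 0 ↔
        advance (ws h) (c.lang σ) a (C h) j) →
        (∀ i, i < (t + t + 2 + h) * ell ∨ (t + t + 2 + h) * ell + (ws h).length ≤ i →
          s5.arr .row i = s4.arr .row i) →
        (∀ h' < h + 1, RowIs ell ws (t + 1) h' (advance (ws h') (c.lang σ) a (C h')) (s5.set .h (h + 1))) ∧
          ∀ i < (t + t + 2) * ell, (s5.set .h (h + 1)).arr .row i = s.arr .row i := by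
      intro s5 h5 h6
      refine ⟨fun h' hh' j hj => ?_, fun i hi => ?_⟩
      · rw [St.set_arr, show t + 1 + (t + 1) + h' = t + t + 2 + h' by ring]
        by_cases hhh : h' = h
        · subst hhh; exact h5 j hj
        · have hlt : (t + t + 2 + h') * ell + j < (t + t + 2 + h) * ell :=
            mul_add_lt (by have := hE.len_le h' (by omega); omega) (by omega)
          rw [h6 _ (Or.inl hlt), harr4]
          have := hI1 h' (by omega) j hj
          rwa [show t + 1 + (t + 1) + h' = t + t + 2 + h' by ring] at this
      · have hlt : (t + t + 2) * ell ≤ (t + t + 2 + h) * ell := Nat.mul_le_mul_right _ (by omega)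
        rw [St.set_arr, h6 _ (Or.inl (by omega)), harr4, hI2 i hi]
    refine ⟨fun hz => ?_, fun hz => ?_⟩
    · refine wp_call (zeroStep_spec (w := letter (ws h)) hB hn4 hwb4 hrin4 hrout4 ha4 hword
        (hE.word_le h hh) hr1 (by omega)) ?_
      rintro s5 t5 hf5 ht5 ⟨h5, h6⟩
      refine ⟨by omega, key s5 (fun j hj => ?_) h6⟩
      rw [h5 j hj, hI.zf.1 hz]
      exact zero_reach_iff _ _ _ _ hrowC hj
    · have hwc : weight c = c.numStates := by
        unfold weight
        rw [if_neg (fun h => hI.zf.2 h hz)]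
      have hA := hG.aut
      have hwl := hE.word_le h hh
      refine wp_call (gapStep_spec (D := stepData c (s.arr .ac t) ell (ws h) a (s.arr .wbase h)
        ((t + t + h) * ell) ((t + t + 2 + h) * ell)) hB (hlo4.trans (hI.lo hz)) hac4 hq4 ?_) ?_
      · have hlm := clip_le ell c.len.lo
        have hinp4 : s4.arr .inp = s.arr .inp := by rw [harr4, hinp3]
        constructor <;> try simp only [St.set_var, St.set_arr, reduceCtorEq, if_false, if_true]
        · exact hn4
        · exact hwb4
        · exact hrin4
        · exact hrout4
        · exact ha4
        · exact hsig4
        · exact hq4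
        · exact hst4
        · exact hac4
        · exact hlo4.trans (hI.lo hz)
        · exact hhi4.trans (hI.hi hz)
        · exact hword
        · intro j hj
          show letter (ws h) j < σ
          rw [letter_eq _ hj]
          exact Fin.isLt _
        · rw [hinp4]; exact hA.acc
        · rw [hinp4]; exact hA.trans
        · exact hA.trans_lt
        · exact hA.st_lt
        · exact hwl
        · exact hA.le
        · show clip ell c.len.lo ≤ M
          omega
        · exact hr1
        · show (t + t + 2 + h) * ell + (ws h).length ≤ 4 * (M * M)
          omega
      · rintro s5 t5 hf5 ht5 ⟨h5, h6⟩
        refine ⟨?_, key s5 (fun j hj => ?_) h6⟩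
        · have h7 : ((ws h).length + 1) * c.numStates ≤ (ell + 1) * weight c := by
            rw [hwc]; exact Nat.mul_le_mul_right _ (by omega)
          have ht5 : t5 ≤ 0 + 1 + 1 + 1 + 1 + 1 + 90 * (((ws h).length + 1) * c.numStates) := ht5
          omega
        · have h8 := h5 j hj
          exact h8.trans (reach_iff c _ ell (ws h) a _ _ _ _ (C h) hrowC hn hj)
  · rintro s' t' hf' _ ⟨h1, h2⟩ ht'
    exact ⟨by omega, h1, h2⟩

/-! ### Depth-first search over all words of length `k` -/

/-- What has to hold for every word `u`, given whether it is a subsequence of the two strings. -/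
def Good : Problem → Prop → Prop → Prop
  | .uni, A, _ => A
  | .con, A, B => A → B
  | .equ, A, B => A ↔ B

/-- The test of `Good`, given the array `ans`. -/
def check : Problem → Expr
  | .uni => .get .ans 0
  | .con => .get .ans 1 + Expr.eqq (.get .ans 0) 0
  | .equ => Expr.eqq (.get .ans 0) (.get .ans 1)

theorem check_iff (p : Problem) {s : St} (A : ℕ → Prop) (h : ∀ i < 2, s.arr .ans i ≠ 0 ↔ A i)
    (hle : ∀ i < 2, s.arr .ans i ≤ 1) : (check p).eval s ≠ 0 ↔ Good p (A 0) (A 1) := by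
  have h0 := h 0 (by omega)
  have h1 := h 1 (by omega)
  have l0 := hle 0 (by omega)
  have l1 := hle 1 (by omega)
  cases p with
  | uni => simpa [check, Good] using h0
  | con =>
    simp only [check, Good, Expr.eval_add, Expr.eval_get, Expr.eval_one, Expr.eval_eqq, Expr.eval_zero, ← h0,
      ← h1]
    by_cases h : s.arr .ans 0 = 0 <;> simp [h]
  | equ =>
    simp only [check, Good, Expr.eval_get, Expr.eval_one, Expr.eval_eqq, Expr.eval_zero, ← h0, ← h1]
    by_cases h : s.arr .ans 0 = s.arr .ans 1
    · simp [h]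
    · simp only [h, if_false]; omega

theorem check_ok (p : Problem) {s : St} {Z : ℕ} (hZ : 3 ≤ Z) (hle : ∀ i < 2, s.arr .ans i ≤ 1) :
    (check p).Ok Z s := by
  have l1 := hle 1 (by omega)
  cases p with
  | uni => simp only [check, Expr.ok_get, Expr.ok_zero]; omega
  | con =>
    simp only [check, Expr.ok_add, Expr.ok_get, Expr.ok_one, Expr.ok_eqq, Expr.ok_zero, Expr.eval_get,
      Expr.eval_one, Expr.eval_eqq, Expr.eval_zero]
    refine ⟨by omega, by omega, ?_⟩
    by_cases h : s.arr .ans 0 = 0 <;> simp only [h, if_true, if_false] <;> omega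
  | equ =>
    simp only [check, Expr.ok_get, Expr.ok_one, Expr.ok_eqq, Expr.ok_zero]
    omega

/-- Test all words that end with the letter `v[t]` after the current prefix. -/
def leaf (p : Problem) : Cmd :=
  .a ::= .get .v Var.t ;; .two ::= 2 ;;
  .for .h .two
    (selectWord ;; .d ::= 0 ;;
     .for .j .n
      (.ite (.get .row ((Var.rin : Expr) + Var.j))
        (.ite (Expr.eqq (.get .inp ((Var.wb : Expr) + Var.j)) Var.a) (.d ::= 1) .skip) .skip) ;;
     .store .ans Var.h Var.d) ;;
  .ite (check p) .skip (.res ::= 0) ;;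
  .store .v Var.t ((Var.a : Expr) + 1)

theorem row_lt {M ell t h n : ℕ} (hell : ell + 1 ≤ M) (ht : t + 1 ≤ M) (hh : h < 2) (hn : n ≤ ell) :
    (t + t + h) * ell + n ≤ (t + t + 2) * ell ∧ (t + t + h) * ell + n ≤ 2 * (M * M) ∧ t + t + h ≤ 2 * M := by
  have h0 : (t + t + h + 1) * ell ≤ (t + t + 2) * ell := Nat.mul_le_mul_right _ (by omega)
  have h2 : (t + t + h + 1) * ell ≤ (M + M) * M := Nat.mul_le_mul (by omega) (by omega)
  have h3 : (t + t + h + 1) * ell = (t + t + h) * ell + ell := by ring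
  have h4 : (M + M) * M = 2 * (M * M) := by ring
  omega

theorem RowIs.of_eq {σ ell t h : ℕ} {ws : ℕ → List (Fin σ)} {C : ℕ → Prop} {s s' : St}
    (hR : RowIs ell ws t h C s) (hh : h < 2) (hl : (ws h).length ≤ ell)
    (he : ∀ i < (t + t + 2) * ell, s'.arr .row i = s.arr .row i) : RowIs ell ws t h C s' := by
  intro j hj
  have h0 : (t + t + h + 1) * ell ≤ (t + t + 2) * ell := Nat.mul_le_mul_right _ (by omega)
  have h3 : (t + t + h + 1) * ell = (t + t + h) * ell + ell := by ring
  rw [he _ (by omega)]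
  exact hR j hj

/-- No further row is needed for the last letter; it only has to occur at a position of the current
row. The result `res` can only change from yes to no, so at the end it is the conjunction over all
words. -/
theorem leaf_spec {M Z ell σ t : ℕ} {gc : List (RegLenConstraint σ)} {ws : ℕ → List (Fin σ)} {s : St}
    {C : ℕ → ℕ → Prop} (p : Problem) (hB : Big M Z) (hE : Env M ell gc ws s) (ht : s.var .t = t)
    (htg : t ≤ gc.length) (a : Fin σ) (hσ : σ ≤ M) (ha : s.arr .v t = a) (hC : ∀ h < 2, RowIs ell ws t h (C h) s) :
    wp Z (leaf p) (fun s' u => u ≤ 50 * (ell + 1) ∧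
      s'.arr .v = Function.update (s.arr .v) t (a + 1) ∧
      (s'.var .res ≠ 0 ↔ s.var .res ≠ 0 ∧
        Good p (Matches (ws 0) [] [a] (C 0)) (Matches (ws 1) [] [a] (C 1)))) s 0 := by
  have hl := hB.lin
  have hM := hB.le
  have hMM := hB.sq_le
  have hgM := hE.g_lt
  have heM := hE.ell_lt
  have hepos := hE.ell_pos
  have haσ := a.2
  unfold leaf
  simp only [wp_seq, wp_assign, Expr.ok_var, Expr.ok_get, Expr.eval_var, Expr.eval_get, ht, ha, St.set_var,
    St.set_arr, Expr.ok_two, Expr.eval_two]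
  refine ⟨trivial, by omega, ?_⟩
  refine wp_for_const 2 (fun k s' => ∀ h < k, (s'.arr .ans h ≠ 0 ↔ Matches (ws h) [] [a] (C h)) ∧
      s'.arr .ans h ≤ 1) (6 * (ell + 1) + 8) (by simp) (by simp) rfl rfl (by omega) (by simp) ?_ ?_
  · intro h hh s3 hf3 hh3 hI
    have ht3 : s3.var .t = t := by rw [hf3.var _ rfl]; simp [ht]
    have ha3 : s3.var .a = a := by rw [hf3.var _ rfl]; simp
    have hell3 : s3.var .ell = ell := by rw [hf3.var _ rfl]; simp [hE.ell_eq]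
    have hwl3 : s3.arr .wlen h = (ws h).length := by rw [hf3.arr _ rfl]; exact hE.len h hh
    have hwb3 : s3.arr .wbase = s.arr .wbase := by rw [hf3.arr _ rfl]; rfl
    have hinp3 : s3.arr .inp = s.arr .inp := by rw [hf3.arr _ rfl]; rfl
    have hrow3 : s3.arr .row = s.arr .row := by rw [hf3.arr _ rfl]; rfl
    have hn := hE.len_le h hh
    have hwo := hE.word_le h hh
    obtain ⟨hr1, hr2, hr4⟩ := row_lt (t := t) hE.ell_lt (by omega) hh hn
    simp only [selectWord, wp_seq, wp_assign, Expr.ok_var, Expr.ok_get, Expr.eval_var, Expr.eval_get, ht3,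
      hh3, hwl3, hwb3, hell3, Expr.ok_add, Expr.eval_add, Expr.ok_mul, Expr.eval_mul, Expr.ok_zero,
      Expr.eval_zero, St.set_var, St.set_arr, reduceCtorEq, if_true, if_false]
    refine ⟨trivial, trivial, ⟨⟨⟨trivial, trivial, by omega⟩, trivial, by omega⟩, trivial, by omega⟩, by omega, ?_⟩
    refine wp_for_const (ws h).length (fun k s' => s'.var .d ≤ 1 ∧
      (s'.var .d ≠ 0 ↔ ∃ j, ∃ hj : j < (ws h).length, j < k ∧ C h j ∧ (ws h)[j] = a)) 3 (by simp) (by simp)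
      rfl rfl (by omega) (by simp) ?_ ?_
    · rintro j hj s4 hf4 hj4 ⟨hd4, hI4⟩
      have hrin4 : s4.var .rin = (t + t + h) * ell := by rw [hf4.var _ rfl]; simp
      have hwb4 : s4.var .wb = s.arr .wbase h := by rw [hf4.var _ rfl]; simp
      have ha4 : s4.var .a = a := by rw [hf4.var _ rfl]; simp [ha3]
      have hinp4 : s4.arr .inp = s.arr .inp := by rw [hf4.arr _ rfl]; simp [hinp3]
      have hrow4 : s4.arr .row = s.arr .row := by rw [hf4.arr _ rfl]; simp [hrow3]
      have hCj := hC h hh j hj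
      have hlet := hE.word h hh j hj
      have hnext : ∀ P : Prop, (P ↔ (∃ j', ∃ hj : j' < (ws h).length, j' < j ∧ C h j' ∧ (ws h)[j'] = a) ∨
          (C h j ∧ (ws h)[j] = a)) →
          (P ↔ ∃ j', ∃ hj : j' < (ws h).length, j' < j + 1 ∧ C h j' ∧ (ws h)[j'] = a) := by
        intro P hP
        rw [hP]
        constructor
        · rintro (⟨j', hj', h1, h2⟩ | h1)
          · exact ⟨j', hj', by omega, h2⟩
          · exact ⟨j, hj, by omega, h1⟩
        · rintro ⟨j', hj', h1, h2⟩
          by_cases h3 : j' = j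
          · subst h3; exact Or.inr h2
          · exact Or.inl ⟨j', hj', by omega, h2⟩
      simp only [wp_ite, wp_skip, wp_assign, Expr.ok_var, Expr.ok_get, Expr.eval_var, Expr.eval_get,
        Expr.ok_add, Expr.eval_add, Expr.ok_eqq, Expr.eval_eqq, Expr.ok_one, Expr.eval_one, hrin4, hwb4, ha4,
        hinp4, hrow4, hj4, hlet, St.set_var, St.set_arr, reduceCtorEq, if_true, if_false]
      refine ⟨⟨trivial, trivial, by omega⟩, fun h1 => ⟨⟨⟨trivial, trivial, by omega⟩, trivial⟩, fun h2 => ⟨by omega, by omega, by omega, ?_⟩,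
        fun h2 => ⟨by omega, hd4, ?_⟩⟩, fun h1 => ⟨by omega, hd4, ?_⟩⟩
      · have h2 := Fin.ext (of_ite_ne h2)
        exact hnext _ (iff_of_true (by omega) (Or.inr ⟨hCj.1 h1, h2⟩))
      · refine hnext _ (hI4.trans ⟨Or.inl, ?_⟩)
        rintro (h3 | ⟨-, h3⟩)
        · exact h3
        · exact absurd (congrArg Fin.val h3) (of_ite_eq h2)
      · refine hnext _ (hI4.trans ⟨Or.inl, ?_⟩)
        rintro (h3 | ⟨h3, -⟩)
        · exact h3
        · exact absurd h1 (hCj.2 h3)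
    · rintro s4 t4 hf4 - ⟨hd4, hI4⟩ ht4
      have hh4 : s4.var .h = h := by rw [hf4.var _ rfl]; simp [hh3]
      have hans4 : s4.arr .ans = s3.arr .ans := by rw [hf4.arr _ rfl]; simp
      simp only [wp_store, Expr.ok_var, Expr.eval_var, hh4]
      refine ⟨trivial, trivial, by omega, ?_⟩
      intro k hk
      rw [St.put_arr_self, hans4]
      by_cases hkh : k = h
      · subst hkh
        rw [Function.update_self]
        refine ⟨hI4.trans ?_, hd4⟩
        show _ ↔ ∃ j, ∃ hj : j < (ws k).length, C k j ∧ (ws k)[j] = a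
        constructor
        · rintro ⟨j, hj, -, h2⟩; exact ⟨j, hj, h2⟩
        · rintro ⟨j, hj, h2⟩; exact ⟨j, hj, hj, h2⟩
      · rw [Function.update_of_ne hkh]
        exact hI k (by omega)
  · intro s4 t4 hf4 _ hI ht4
    have ht4' : s4.var .t = t := by rw [hf4.var _ rfl]; simp [ht]
    have ha4 : s4.var .a = a := by rw [hf4.var _ rfl]; simp
    have hr4 : s4.var .res = s.var .res := by rw [hf4.var _ rfl]; simp
    have hv4 : s4.arr .v = s.arr .v := by rw [hf4.arr _ rfl]; rfl
    have hle : ∀ i < 2, s4.arr .ans i ≤ 1 := fun i hi => (hI i hi).2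
    have hck := check_iff p (fun h => Matches (ws h) [] [a] (C h)) (fun i hi => (hI i hi).1) hle
    simp only [wp_ite, wp_skip, wp_assign, wp_store, Expr.ok_var, Expr.eval_var, Expr.ok_add, Expr.eval_add,
      Expr.ok_one, Expr.eval_one, Expr.ok_zero, Expr.eval_zero, ht4', ha4, St.set_var, St.set_arr, St.put_var,
      reduceCtorEq, if_true, if_false]
    refine ⟨check_ok p (by omega) hle, fun h1 => ⟨trivial, ⟨trivial, by omega, by omega⟩, by omega, ?_, ?_⟩,
      fun h1 => ⟨by omega, trivial, ⟨trivial, by omega, by omega⟩, by omega, ?_, ?_⟩⟩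
    · rw [St.put_arr_self, hv4]
    · rw [hr4]
      exact ⟨fun h => ⟨h, hck.1 h1⟩, fun h => h.1⟩
    · rw [St.put_arr_self, St.set_arr, hv4]
    · simp only [ne_eq, not_true_eq_false, false_iff, not_and]
      exact fun _ h => hck.2 h h1

/-- One round of the depth-first search over all words. -/
def dfsBody (p : Problem) : Cmd :=
  .ite (Expr.eqq (.get .v Var.t) Var.sig)
    (.ite Var.t (.t ::= (Var.t : Expr) - 1 ;; .store .v Var.t (.get .v Var.t + 1)) (.go ::= 0))
    (.ite (Expr.eqq Var.t Var.g) (leaf p) (step ;; .t ::= (Var.t : Expr) + 1 ;; .store .v Var.t 0))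

/-- The time for one letter at the depth with the constraints `gs` left. -/
noncomputable def dfsCost (ell : ℕ) {σ : ℕ} : List (RegLenConstraint σ) → ℕ
  | [] => 60 * (ell + 1)
  | c :: gs => 400 * ((ell + 1) * weight c) + 20 + σ * dfsCost ell gs

/-- All words that start with a letter from `b` on are good. -/
def GoodFrom {σ : ℕ} (p : Problem) (ws : ℕ → List (Fin σ)) (gs : List (RegLenConstraint σ))
    (C : ℕ → ℕ → Prop) (b : ℕ) : Prop :=
  ∀ a : Fin σ, b ≤ a → ∀ u : List (Fin σ), u.length = gs.length →
    Good p (Matches (ws 0) (gs.map (RegLenConstraint.lang σ)) (a :: u) (C 0))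
      (Matches (ws 1) (gs.map (RegLenConstraint.lang σ)) (a :: u) (C 1))

theorem goodFrom_self {σ : ℕ} (p : Problem) (ws : ℕ → List (Fin σ)) (gs : List (RegLenConstraint σ))
    (C : ℕ → ℕ → Prop) : GoodFrom p ws gs C σ := fun a ha => absurd a.2 (by omega)

theorem goodFrom_nil {σ : ℕ} (p : Problem) (ws : ℕ → List (Fin σ)) (C : ℕ → ℕ → Prop) (a : Fin σ) :
    GoodFrom p ws [] C a ↔ Good p (Matches (ws 0) [] [a] (C 0)) (Matches (ws 1) [] [a] (C 1)) ∧
      GoodFrom p ws [] C (a + 1) := by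
  constructor
  · intro h
    exact ⟨h a le_rfl [] rfl, fun a' ha' => h a' (by omega)⟩
  · rintro ⟨h1, h2⟩ a' ha' u hu
    by_cases h : a' = a
    · subst h
      rw [List.length_eq_zero_iff.1 hu]
      exact h1
    · exact h2 a' (by have : (a' : ℕ) ≠ a := fun h' => h (Fin.ext h'); omega) u hu

/-- The branching of the search tree: either the first letter is `a`, and the rest is judged with
the advanced rows one level deeper, or it is a later letter. -/
theorem goodFrom_cons {σ : ℕ} (p : Problem) (ws : ℕ → List (Fin σ)) (c : RegLenConstraint σ)
    (gs : List (RegLenConstraint σ)) (C : ℕ → ℕ → Prop) (a : Fin σ) :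
    GoodFrom p ws (c :: gs) C a ↔ GoodFrom p ws gs (fun h => advance (ws h) (c.lang σ) a (C h)) 0 ∧
      GoodFrom p ws (c :: gs) C (a + 1) := by
  constructor
  · intro h
    exact ⟨fun a' _ u hu => h a le_rfl (a' :: u) (by simp [hu]), fun a' ha' => h a' (by omega)⟩
  · rintro ⟨h1, h2⟩ a' ha' u hu
    by_cases h : a' = a
    · subst h
      cases u with
      | nil => simp at hu
      | cons b u => exact h1 b (by omega) u (by simpa using hu)
    · exact h2 a' (by have : (a' : ℕ) ≠ a := fun h' => h (Fin.ext h'); omega) u hu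

/-- The search is one flat loop with the stack `v`, so the rule has the form of a continuation: to
analyse the loop with `v[t] = b`, it suffices to do so once depth `t` has run through its last
letter. The proof is an induction on the remaining constraints and, inside, on the number `m` of
remaining letters. -/
theorem dfs_rule {M Z ell σ : ℕ} {gc : List (RegLenConstraint σ)} {ws : ℕ → List (Fin σ)} (p : Problem)
    (hB : Big M Z) (hσ : σ ≤ M) (gs : List (RegLenConstraint σ)) :
    ∀ (t : ℕ), t ≤ gc.length → gc.drop t = gs → ∀ (m b : ℕ) (C : ℕ → ℕ → Prop) (s : St) (t₀ : ℕ)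
      (Q : St → ℕ → Prop), b + m = σ → Env M ell gc ws s → s.var .t = t → s.arr .v t = b → s.var .go ≠ 0 →
      (∀ h < 2, RowIs ell ws t h (C h) s) →
      (∀ s' t', t' ≤ t₀ + m * dfsCost ell gs → Env M ell gc ws s' → s'.var .t = t → s'.arr .v t = σ →
        s'.var .go ≠ 0 → (∀ i < t, s'.arr .v i = s.arr .v i) →
        (∀ i < (t + t + 2) * ell, s'.arr .row i = s.arr .row i) →
        (s'.var .res ≠ 0 ↔ s.var .res ≠ 0 ∧ GoodFrom p ws gs C b) → wp Z (.loop Var.go (dfsBody p)) Q s' t') →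
      wp Z (.loop Var.go (dfsBody p)) Q s t₀ := by
  have hl := hB.lin
  have hM := hB.le
  induction gs with
  | nil =>
    intro t htg hgs m
    have htg' : t = gc.length := le_antisymm htg (List.drop_eq_nil_iff.1 hgs)
    induction m with
    | zero =>
      intro b C s t₀ Q hb hE ht hv hgo hC hQ
      obtain rfl : b = σ := by omega
      exact hQ s t₀ (by omega) hE ht hv hgo (fun _ _ => rfl) (fun _ _ => rfl) (by simp [goodFrom_self])
    | succ m ih =>
      intro b C s t₀ Q hb hE ht hv hgo hC hQ
      have hbσ : b < σ := by omega
      refine wp_loop_true trivial hgo ?_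
      unfold dfsBody
      simp only [wp_ite, Expr.ok_eqq, Expr.ok_get, Expr.ok_var, Expr.eval_eqq, Expr.eval_get, Expr.eval_var, ht,
        hv, hE.sig_eq, hE.g_eq]
      refine ⟨⟨trivial, trivial⟩, fun h => absurd (of_ite_ne h) hbσ.ne, fun _ => ⟨⟨trivial, trivial⟩, fun _ => ?_,
        fun h => absurd htg' (of_ite_eq h)⟩⟩
      refine wp_call (leaf_spec p hB hE ht htg ⟨b, hbσ⟩ hσ hv hC) ?_
      rintro s1 t1 hf1 ht1 ⟨hv1, hr1⟩
      have hE1 := hE.frame hf1 rfl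
      have hrow1 : s1.arr .row = s.arr .row := hf1.arr _ rfl
      refine ih (b + 1) C s1 t1 Q (by omega) hE1 (by rw [hf1.var _ rfl, ht]) (by rw [hv1]; simp)
        (by rw [hf1.var _ rfl]; exact hgo) (fun h hh => (hC h hh).of_eq hh (hE.len_le h hh)
          (fun i _ => by rw [hrow1])) ?_
      intro s' t' ht' hE' hst' hv' hgo' hvv hrr hres
      refine hQ s' t' ?_ hE' hst' hv' hgo' (fun i hi => ?_) (fun i hi => by rw [hrr i hi, hrow1]) ?_
      · have : dfsCost ell ([] : List (RegLenConstraint σ)) = 60 * (ell + 1) := rfl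
        rw [this] at ht' ⊢
        rw [Nat.add_mul]
        omega
      · rw [hvv i hi, hv1, Function.update_of_ne (by omega)]
      · rw [hres, hr1, goodFrom_nil p ws C ⟨b, hbσ⟩, and_assoc]
  | cons c gs ihg =>
    intro t htg hgs m
    have htg' : t < gc.length := by
      by_contra h
      rw [List.drop_eq_nil_of_le (by omega)] at hgs
      simp at hgs
    have hdrop := List.drop_eq_getElem_cons htg'
    rw [hgs, List.cons.injEq] at hdrop
    obtain ⟨hc, hgs'⟩ := hdrop
    induction m with
    | zero =>
      intro b C s t₀ Q hb hE ht hv hgo hC hQ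
      obtain rfl : b = σ := by omega
      exact hQ s t₀ (by omega) hE ht hv hgo (fun _ _ => rfl) (fun _ _ => rfl) (by simp [goodFrom_self])
    | succ m ih =>
      intro b C s t₀ Q hb hE ht hv hgo hC hQ
      have hbσ : b < σ := by omega
      have hgM := hE.g_lt
      have hrle : (t + t + 2) * ell ≤ (t + 1 + (t + 1) + 2) * ell := Nat.mul_le_mul_right _ (by omega)
      refine wp_loop_true trivial hgo ?_
      rw [dfsBody]
      simp only [wp_ite, Expr.ok_eqq, Expr.ok_get, Expr.ok_var, Expr.eval_eqq, Expr.eval_get, Expr.eval_var, ht,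
        hv, hE.sig_eq, hE.g_eq]
      refine ⟨⟨trivial, trivial⟩, fun h => absurd (of_ite_ne h) hbσ.ne, fun _ => ⟨⟨trivial, trivial⟩,
        fun h => absurd (of_ite_ne h) htg'.ne, fun _ => ?_⟩⟩
      rw [wp_seq]
      refine wp_call (step_spec hB hE ht htg' ⟨b, hbσ⟩ hv hC) ?_
      rintro s1 t1 hf1 ht1 ⟨hr1, hrow1⟩
      rw [← hc] at hr1 ht1
      have hE1 := hE.frame hf1 rfl
      have hst1 : s1.var .t = t := by rw [hf1.var _ rfl, ht]
      have hv1 : s1.arr .v = s.arr .v := hf1.arr _ rfl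
      have hres1 : s1.var .res = s.var .res := hf1.var _ rfl
      have hgo1 : s1.var .go = s.var .go := hf1.var _ rfl
      simp only [wp_seq, wp_assign, wp_store, Expr.ok_var, Expr.ok_add, Expr.ok_one, Expr.ok_zero, Expr.eval_var,
        Expr.eval_add, Expr.eval_one, Expr.eval_zero, hst1, St.set_var, St.set_arr, if_true]
      refine ⟨⟨trivial, by omega, by omega⟩, trivial, by omega, ?_⟩
      generalize hs2 : (s1.set .t (t + 1)).put .v (t + 1) 0 = s2
      have hE2 : Env M ell gc ws s2 := by
        refine hE1.of_eq ?_ (fun d h1 _ _ => by subst hs2; rw [St.put_arr_ne _ _ _ _ _ h1]; simp)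
        rintro x (rfl | rfl | rfl) <;> subst hs2 <;> simp
      have hrow2 : s2.arr .row = s1.arr .row := by subst hs2; rw [St.put_arr_ne _ _ _ _ _ (by simp)]; rfl
      have hv2 : s2.arr .v = Function.update (s.arr .v) (t + 1) 0 := by
        subst hs2; rw [St.put_arr_self, St.set_arr, hv1]
      have hres2 : s2.var .res = s.var .res := by subst hs2; simp [hres1]
      -- Descent: at depth `t + 1` all `σ` letters are still to be tried.
      refine ihg (t + 1) htg' hgs'.symm σ 0 (fun h => advance (ws h) (c.lang σ) (⟨b, hbσ⟩ : Fin σ) (C h)) s2 _ Q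
        (by omega) hE2 (by subst hs2; simp) (by rw [hv2]; simp) (by subst hs2; simp [hgo1, hgo])
        (fun h hh => (hr1 h hh).of_eq hh (hE.len_le h hh) (fun i _ => by rw [hrow2])) ?_
      intro s3 t3 ht3 hE3 hst3 hv3 hgo3 hvv3 hrr3 hres3
      -- Return: depth `t + 1` is exhausted, and the next round goes back to depth `t` and increases
      -- `v[t]`.
      refine wp_loop_true trivial hgo3 ?_
      rw [dfsBody]
      have hvt3 : s3.arr .v t = b := by
        rw [hvv3 t (by omega), hv2, Function.update_of_ne (by omega), hv]
      simp only [wp_ite, wp_seq, wp_assign, wp_store, Expr.ok_eqq, Expr.ok_get, Expr.ok_var, Expr.ok_sub,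
        Expr.ok_one, Expr.ok_add, Expr.ok_zero, Expr.eval_eqq, Expr.eval_get, Expr.eval_var, Expr.eval_sub,
        Expr.eval_one, Expr.eval_add, hst3, hv3, hE3.sig_eq, St.set_var, St.set_arr, if_true,
        Nat.add_sub_cancel, hvt3]
      refine ⟨⟨trivial, trivial⟩, fun _ => ⟨trivial, fun _ => ⟨⟨trivial, by omega⟩, trivial,
        ⟨trivial, by omega, by omega⟩, ?_⟩, fun h => absurd h (by omega)⟩, fun h => absurd h (by omega)⟩
      generalize hs4 : (s3.set .t t).put .v t (b + 1) = s4
      have hE4 : Env M ell gc ws s4 := by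
        refine hE3.of_eq ?_ (fun d h1 _ _ => by subst hs4; rw [St.put_arr_ne _ _ _ _ _ h1]; simp)
        rintro x (rfl | rfl | rfl) <;> subst hs4 <;> simp
      have hrow4 : ∀ i < (t + t + 2) * ell, s4.arr .row i = s.arr .row i := by
        intro i hi
        subst hs4
        rw [St.put_arr_ne _ _ _ _ _ (by simp), St.set_arr, hrr3 i (by omega), hrow2, hrow1 i hi]
      have hv4 : s4.arr .v = Function.update (s3.arr .v) t (b + 1) := by
        subst hs4; rw [St.put_arr_self, St.set_arr]
      have hres4 : s4.var .res = s3.var .res := by subst hs4; simp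
      refine ih (b + 1) C s4 _ Q (by omega) hE4 (by subst hs4; simp) (by rw [hv4]; simp)
        (by subst hs4; simp [hgo3]) (fun h hh => (hC h hh).of_eq hh (hE.len_le h hh) hrow4) ?_
      intro s' t' ht' hE' hst' hv' hgo' hvv hrr hres
      refine hQ s' t' ?_ hE' hst' hv' hgo' (fun i hi => ?_) (fun i hi => by rw [hrr i hi, hrow4 i hi]) ?_
      · have : dfsCost ell (c :: gs) = 400 * ((ell + 1) * weight c) + 20 + σ * dfsCost ell gs := rfl
        rw [Nat.add_mul, one_mul, ← Nat.add_assoc]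
        generalize m * dfsCost ell (c :: gs) = X at *
        omega
      · rw [hvv i hi, hv4, Function.update_of_ne (by omega), hvv3 i (by omega), hv2,
          Function.update_of_ne (by omega)]
      · rw [hres, hres4, hres3, hres2, goodFrom_cons p ws c gs C ⟨b, hbσ⟩, and_assoc]

/-- Depth-first search over all words, with result in `res`. -/
def dfs (p : Problem) : Cmd :=
  .n ::= (Var.ell : Expr) + Var.ell ;;
  .for .j .n (.store .row Var.j 1) ;;
  .t ::= 0 ;; .store .v 0 0 ;; .res ::= 1 ;; .go ::= 1 ;;
  .loop Var.go (dfsBody p)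

theorem dfs_spec {M Z ell σ : ℕ} {gc : List (RegLenConstraint σ)} {ws : ℕ → List (Fin σ)} {s : St}
    (p : Problem) (hB : Big M Z) (hE : Env M ell gc ws s) (hσ : σ ≤ M) :
    wp Z (dfs p) (fun s' u => u ≤ 6 * ell + 20 + σ * dfsCost ell gc ∧
      (s'.var .res ≠ 0 ↔ GoodFrom p ws gc (fun _ _ => True) 0)) s 0 := by
  have hl := hB.lin
  have hM := hB.le
  have heM := hE.ell_lt
  unfold dfs
  simp only [wp_seq, wp_assign, Expr.ok_var, Expr.ok_add, Expr.eval_var, Expr.eval_add, hE.ell_eq]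
  refine ⟨⟨trivial, trivial, by omega⟩, ?_⟩
  -- The first letter may be placed anywhere, so the rows of depth 0 of both strings are constantly
  -- 1; together they occupy `2 * ell` cells.
  refine wp_for_const (ell + ell) (fun k s' => ∀ i < k, s'.arr .row i = 1) 1 (by simp) (by simp) rfl rfl
    (by omega) (by simp) ?_ ?_
  · intro i hi s1 hf1 hj1 hI
    simp only [wp_store, Expr.ok_var, Expr.ok_one, Expr.eval_var, Expr.eval_one, hj1]
    refine ⟨trivial, by omega, by omega, fun k hk => ?_⟩
    rw [St.set_arr, St.put_arr_self, Function.update_apply]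
    split
    · rfl
    · exact hI k (by omega)
  · intro s1 t1 hf1 _ hI ht1
    have hE1 : Env M ell gc ws s1 := by
      refine hE.of_eq ?_ ?_
      · rintro x (rfl | rfl | rfl) <;> rw [hf1.var _ rfl] <;> simp
      · intro d _ hd _
        rw [hf1.arr d (by simp [Cmd.for, Cmd.awr, Ne.symm hd])]
        rfl
    simp only [wp_store, wp_assign, Expr.ok_zero, Expr.ok_one, Expr.eval_zero, Expr.eval_one]
    refine ⟨by omega, by omega, by omega, by omega, by omega, ?_⟩
    generalize hs2 : (((s1.set .t 0).put .v 0 0).set .res 1).set .go 1 = s2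
    have hE2 : Env M ell gc ws s2 := by
      refine hE1.of_eq ?_ (fun d h1 _ _ => by subst hs2; rw [St.set_arr, St.set_arr, St.put_arr_ne _ _ _ _ _ h1]; simp)
      rintro x (rfl | rfl | rfl) <;> subst hs2 <;> simp
    have hrow2 : s2.arr .row = s1.arr .row := by
      subst hs2; rw [St.set_arr, St.set_arr, St.put_arr_ne _ _ _ _ _ (by simp)]; rfl
    have hv2 : s2.arr .v 0 = 0 := by
      subst hs2; rw [St.set_arr, St.set_arr, St.put_arr_self]; simp
    have hres2 : s2.var .res = 1 := by subst hs2; simp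
    refine dfs_rule p hB hσ gc 0 (by omega) rfl σ 0 (fun _ _ => True) s2 _ _ (by omega) hE2
      (by subst hs2; simp) hv2 (by subst hs2; simp) (fun h hh j hj => ?_) ?_
    · have hlen := hE.len_le h hh
      have : (0 + 0 + h) * ell + j < ell + ell := by
        have : h = 0 ∨ h = 1 := by omega
        rcases this with rfl | rfl <;> omega
      rw [hrow2, hI _ this]
      simp
    · intro s3 t3 ht3 hE3 hst3 hv3 hgo3 _ _ hres3
      refine wp_loop_true trivial hgo3 ?_
      rw [dfsBody]
      simp only [wp_ite, wp_assign, Expr.ok_eqq, Expr.ok_get, Expr.ok_var, Expr.eval_eqq, Expr.eval_get,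
        Expr.eval_var, hst3, hv3, hE3.sig_eq, if_true, Expr.ok_zero, Expr.eval_zero]
      refine ⟨⟨trivial, trivial⟩, fun _ => ⟨trivial, fun h => absurd rfl h, fun _ => ⟨by omega, ?_⟩⟩,
        fun h => absurd h (by omega)⟩
      refine wp_loop_false trivial (by simp) ⟨by omega, ?_⟩
      simp only [St.set_var, reduceCtorEq, if_false, hres3, hres2]
      simp

/-! ### Unary alphabets -/

/-- `d` is the least length of a word of `L`, if that is at most `m`, and `m + 1` otherwise. -/
def MinLen (m : ℕ) (L : Language (Fin 1)) (d : ℕ) : Prop :=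
  d ≤ m + 1 ∧ (∀ v ∈ L, v.length ≤ m → d ≤ v.length) ∧ (d ≤ m → ∀ v : List (Fin 1), v.length = d → v ∈ L)

theorem eq_replicate_zero (v : List (Fin 1)) : v = List.replicate v.length 0 :=
  List.eq_replicate_iff.2 ⟨rfl, fun b _ => Subsingleton.elim _ _⟩

/-- Sets of positions of the form `{j | k ≤ j}` are preserved: with shortest admissible gap length
`d`, the positions that can follow are exactly those from `k + 1 + d` on, since each of them is
reached by a gap of length exactly `d`. So only the sum of the shortest lengths matters. The value
`m + 1`, for no admissible length up to `m`, makes the sum too large for `w`. -/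
theorem matches_unary {m : ℕ} {w : List (Fin 1)} (hw : w.length ≤ m) {Ls : List (Language (Fin 1))}
    {ds : List ℕ} (h : List.Forall₂ (MinLen m) Ls ds) (u : List (Fin 1)) (k : ℕ) :
    Matches w Ls u (fun j => k ≤ j) ↔ u.length = Ls.length + 1 ∧ k + ds.sum + Ls.length + 1 ≤ w.length := by
  induction h generalizing u k with
  | nil =>
    constructor
    · intro h
      refine ⟨h.length_eq, ?_⟩
      match u, h with
      | [a], ⟨j, hj, h1, _⟩ => simp; omega
    · rintro ⟨h1, h2⟩
      obtain ⟨a, rfl⟩ := List.length_eq_one_iff.1 h1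
      have h2 : k + 1 ≤ w.length := by simpa using h2
      exact ⟨k, by omega, le_rfl, Subsingleton.elim _ _⟩
  | @cons L d Ls ds hd _ ih =>
    obtain ⟨h1, h2, h3⟩ := hd
    cases u with
    | nil => simp [Matches]
    | cons a u =>
      have : Matches w (L :: Ls) (a :: u) (fun j => k ≤ j) ↔ Matches w Ls u (fun j => k + 1 + d ≤ j) := by
        refine Matches.congr (C := advance w L a fun j => k ≤ j) fun j' hj' => ?_
        constructor
        · rintro ⟨j, hj, h4, h5, h6, h7⟩
          have := h2 _ h7 (by rw [length_gap w hj'.le]; omega)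
          rw [length_gap w hj'.le] at this
          omega
        · intro h4
          exact ⟨j' - 1 - d, by omega, by omega, Subsingleton.elim _ _, by omega,
            h3 (by omega) _ (by rw [length_gap w hj'.le]; omega)⟩
      rw [this, ih]
      simp only [List.length_cons, List.sum_cons]
      omega

/-- Add the least length for the constraint to `sum`. -/
def unaryGap : Cmd :=
  .lo ::= .get .lo Var.i ;; .hi ::= .get .hi Var.i ;; .lm ::= (Var.ell : Expr) + 1 ;;
  .d ::= (Var.ell : Expr) + 1 ;; .s ::= Var.st ;; .tr ::= (Var.ac : Expr) + Var.q ;;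
  .for .u .lm
    (.ite (.get .inp ((Var.ac : Expr) + Var.s))
      (.ite (Expr.ltt Var.u Var.lo) .skip
        (.ite (Expr.ltt Var.hi Var.u) .skip (.ite (Expr.ltt Var.u Var.d) (.d ::= Var.u) .skip))) .skip ;;
     .s ::= .get .inp ((Var.tr : Expr) + Var.s)) ;;
  .sum ::= (Var.sum : Expr) + Var.d

/-- There is one word of each length, so a single run of `ell` letters through the automaton tests
all lengths up to `ell`; the least admissible one is kept. -/
theorem unaryGap_spec {M Z ell i : ℕ} {c : RegLenConstraint 1} {s : St} (hB : Big M Z)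
    (hell : s.var .ell = ell) (hM : ell + 1 ≤ M) (hi : s.var .i = i) (hG : GapAt M c i s) (hI : GapInfo ell c i s)
    (hz : s.arr .zf i = 0) (hq : s.var .q = c.numStates) (hst : s.var .st = c.dfa.start)
    (hac : s.var .ac = s.arr .ac i) (hsum : s.var .sum ≤ 2 * (M * M)) :
    wp Z unaryGap (fun s' t => t ≤ 20 * (ell + 1) ∧
      ∃ d, MinLen ell (c.lang 1) d ∧ s'.var .sum = s.var .sum + d) s 0 := by
  have hl := hB.lin
  have hM16 := hB.le
  have hMM := hB.sq_le
  have hMM' : 16 * M ≤ M * M := Nat.mul_le_mul_right M hM16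
  have hA := hG.aut
  have hAle : s.arr .ac i + c.numStates + c.numStates * 1 ≤ M := hA.le
  have hlo := hI.lo hz
  have hhi := hI.hi hz
  -- The state after `u` letters.
  let S : ℕ → ℕ := fun u => ((List.replicate u (0 : Fin 1)).map Fin.val).foldl (autOf c (s.arr .ac i)).tr
    (autOf c (s.arr .ac i)).st
  have hS0 : S 0 = c.dfa.start := rfl
  have hSS : ∀ u, S (u + 1) = (autOf c (s.arr .ac i)).tr (S u) 0 := by
    intro u
    simp only [S, List.replicate_succ', List.map_append, List.foldl_append]
    rfl
  have hSlt : ∀ u, S u < c.numStates := by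
    intro u
    induction u with
    | zero => exact c.dfa.start.2
    | succ u ih => rw [hSS]; exact hA.trans_lt _ ih 0 (by decide : 0 < 1)
  have hStr : ∀ u, s.arr .inp (s.arr .ac i + c.numStates + S u) = S (u + 1) := by
    intro u
    rw [hSS, ← hA.trans _ (hSlt u) 0 (by decide : 0 < 1)]
    show _ = s.arr .inp (s.arr .ac i + c.numStates + S u * 1 + 0)
    simp
  have hSacc : ∀ u, s.arr .inp (s.arr .ac i + S u) ≠ 0 ↔ List.replicate u 0 ∈ c.dfa.accepts := by
    intro u
    exact (hA.acc _ (hSlt u)).trans (autOf_acc_foldl c _ _)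
  have hmem : ∀ u, u ≤ ell → (List.replicate u 0 ∈ c.lang 1 ↔ s.arr .inp (s.arr .ac i + S u) ≠ 0 ∧
      clip ell c.len.lo ≤ u ∧ u ≤ clip ell c.len.hi) := by
    intro u hu
    rw [RegLenConstraint.mem_lang, hSacc, List.length_replicate, clip_le_iff hu, le_clip_iff hu]
  have hlang : ∀ v : List (Fin 1), v ∈ c.lang 1 ↔ List.replicate v.length 0 ∈ c.lang 1 := by
    intro v
    rw [← eq_replicate_zero]
  unfold unaryGap
  simp only [wp_seq, wp_assign, Expr.ok_var, Expr.ok_get, Expr.ok_add, Expr.ok_one, Expr.eval_var, Expr.eval_get,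
    Expr.eval_add, Expr.eval_one, hell, hi, hlo, hhi, hst, hac, hq, St.set_var, St.set_arr, reduceCtorEq, if_true, if_false]
  refine ⟨trivial, trivial, ⟨trivial, by omega, by omega⟩, ⟨trivial, by omega, by omega⟩, trivial,
    ⟨trivial, trivial, by omega⟩, ?_⟩
  refine wp_for_const (ell + 1) (fun u s' => s'.var .s = S u ∧ s'.var .d ≤ ell + 1 ∧
    (∀ m < u, List.replicate m 0 ∈ c.lang 1 → s'.var .d ≤ m) ∧
    (s'.var .d ≤ ell → List.replicate (s'.var .d) 0 ∈ c.lang 1)) 6 (by simp) (by simp) rfl rfl (by omega)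
    (by simp [hS0]) ?_ ?_
  · rintro u hu s1 hf1 hu1 ⟨hs1, hd1, hm1, hr1⟩
    have hlo1 : s1.var .lo = clip ell c.len.lo := by rw [hf1.var _ rfl]; simp
    have hhi1 : s1.var .hi = clip ell c.len.hi := by rw [hf1.var _ rfl]; simp
    have hac1 : s1.var .ac = s.arr .ac i := by rw [hf1.var _ rfl]; simp [hac]
    have htr1 : s1.var .tr = s.arr .ac i + c.numStates := by rw [hf1.var _ rfl]; simp
    have hinp1 : s1.arr .inp = s.arr .inp := by rw [hf1.arr _ rfl]; simp
    have hmu := hmem u (by omega)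
    have hSu := hSlt u
    have skip : (List.replicate u 0 ∈ c.lang 1 → s1.var .d ≤ u) →
        ∀ m < u + 1, List.replicate m 0 ∈ c.lang 1 → s1.var .d ≤ m := by
      intro h m hm hmem
      by_cases hmu : m = u
      · subst hmu; exact h hmem
      · exact hm1 m (by omega) hmem
    simp only [wp_ite, wp_skip, wp_seq, wp_assign, Expr.ok_var, Expr.ok_get, Expr.ok_add, Expr.ok_ltt,
      Expr.eval_var, Expr.eval_get, Expr.eval_add, Expr.eval_ltt, hlo1, hhi1, hac1, htr1, hinp1, hu1, hs1, hStr,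
      St.set_var, St.set_arr, reduceCtorEq, if_true, if_false]
    refine ⟨⟨trivial, trivial, by omega⟩, fun h1 => ⟨⟨trivial, trivial⟩, fun h2 => ?_, fun h2 =>
      ⟨⟨trivial, trivial⟩, fun h3 => ?_, fun h3 => ⟨⟨trivial, trivial⟩, fun h4 => ?_, fun h4 => ?_⟩⟩⟩, fun h1 => ?_⟩
    · have := of_ite_ne h2
      exact ⟨⟨trivial, trivial, by omega⟩, by omega, trivial, hd1, skip (fun h => by have := (hmu.1 h).2; omega), hr1⟩
    · have := of_ite_ne h3
      exact ⟨⟨trivial, trivial, by omega⟩, by omega, trivial, hd1, skip (fun h => by have := (hmu.1 h).2; omega), hr1⟩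
    · have h2 := of_ite_eq h2
      have h3 := of_ite_eq h3
      have h4 := of_ite_ne h4
      refine ⟨trivial, ⟨trivial, trivial, by omega⟩, by omega, trivial, by omega, fun m hm hmem => ?_,
        fun _ => hmu.2 ⟨h1, by omega, by omega⟩⟩
      by_cases hmu : m = u
      · omega
      · have := hm1 m (by omega) hmem
        omega
    · have h4 := of_ite_eq h4
      exact ⟨⟨trivial, trivial, by omega⟩, by omega, trivial, hd1, skip (fun h => by omega), hr1⟩
    · exact ⟨⟨trivial, trivial, by omega⟩, by omega, trivial, hd1, skip (fun h => absurd h1 (hmu.1 h).1), hr1⟩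
  · rintro s1 t1 hf1 - ⟨hs1, hd1, hm1, hr1⟩ ht1
    have hsum1 : s1.var .sum = s.var .sum := by rw [hf1.var _ rfl]; simp
    simp only [wp_assign, Expr.ok_add, Expr.ok_var, Expr.eval_add, Expr.eval_var, hsum1, St.set_var, if_true]
    refine ⟨⟨trivial, trivial, by omega⟩, by omega, s1.var .d, ⟨hd1, fun v hv hvm => ?_, fun hdm v hv => ?_⟩, rfl⟩
    · exact hm1 _ (by omega) ((hlang v).1 hv)
    · rw [hlang, hv]; exact hr1 hdm

/-- The algorithm for unary alphabets, with result in `res`. -/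
def unary (p : Problem) : Cmd :=
  .sum ::= (Var.g : Expr) + 1 ;;
  .for .i .g (.ite (.get .zf Var.i) .skip (loadGap ;; unaryGap)) ;;
  .two ::= 2 ;;
  .for .h .two (.store .ans Var.h ((1 : Expr) - Expr.ltt (.get .wlen Var.h) Var.sum)) ;;
  .res ::= check p

open Classical in
/-- A bound for the time for one constraint over a unary alphabet. -/
noncomputable def unaryCost (ell : ℕ) {σ : ℕ} (c : RegLenConstraint σ) : ℕ :=
  if c.lang σ = {[]} then 2 else 30 * (ell + 1)

/-- The sum starts with `g + 1`, the number of letters. Constraints `{ε}` contribute 0 at constant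
cost, which replaces the geometric sum that is not available for `σ = 1`. -/
theorem unary_spec {M Z ell : ℕ} {gc : List (RegLenConstraint 1)} {ws : ℕ → List (Fin 1)} {s : St}
    (p : Problem) (hB : Big M Z) (hE : Env M ell gc ws s) :
    wp Z (unary p) (fun s' u =>
      u ≤ ∑ i ∈ Finset.range gc.length, ((gc[i]?.map (unaryCost ell)).getD 0 + 2) + 20 ∧
      (s'.var .res ≠ 0 ↔ GoodFrom p ws gc (fun _ _ => True) 0)) s 0 := by
  have hl := hB.lin
  have hM := hB.le
  have hMM := hB.sq_le
  have hMM' : 16 * M ≤ M * M := Nat.mul_le_mul_right M hM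
  have heM := hE.ell_lt
  have hgM := hE.g_lt
  unfold unary
  simp only [wp_seq, wp_assign, Expr.ok_var, Expr.ok_add, Expr.ok_one, Expr.eval_var, Expr.eval_add,
    Expr.eval_one, hE.g_eq]
  refine ⟨⟨trivial, by omega, by omega⟩, ?_⟩
  refine wp_for gc.length (fun k s' => ∃ ds, List.Forall₂ (MinLen ell) ((gc.take k).map (RegLenConstraint.lang 1)) ds ∧
    s'.var .sum = gc.length + 1 + ds.sum ∧ ds.sum ≤ k * (ell + 1)) (fun i => (gc[i]?.map (unaryCost ell)).getD 0)
    (by simp [hE.g_eq]) (by simp) rfl rfl (by omega) ⟨[], by simp⟩ ?_ ?_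
  · rintro i hi s1 hf1 hi1 ⟨ds, hds, hsum, hle⟩
    have hf0 : Frame (unary p) s (s.set .sum (gc.length + 1)) := by
      refine ⟨fun y hy => ?_, fun _ _ => rfl⟩
      have : y ≠ .sum := by rintro rfl; simp [unary, Cmd.wr] at hy
      simp [this]
    have hE1 := (hE.frame hf0 (by cases p <;> rfl)).frame hf1 rfl
    have hG := hE1.gap i hi
    have hI := hE1.info i hi
    have hcost : (gc[i]?.map (unaryCost ell)).getD 0 = unaryCost ell gc[i] := by simp [hi]
    have htake : (gc.take (i + 1)).map (RegLenConstraint.lang 1) =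
        (gc.take i).map (RegLenConstraint.lang 1) ++ [gc[i].lang 1] := by
      rw [List.take_add_one, List.getElem?_eq_getElem hi, List.map_append]
      rfl
    have happ : ∀ d, MinLen ell (gc[i].lang 1) d →
        List.Forall₂ (MinLen ell) ((gc.take (i + 1)).map (RegLenConstraint.lang 1)) (ds ++ [d]) := by
      intro d hd
      rw [htake]
      exact List.rel_append hds (.cons hd .nil)
    have hle' : i * (ell + 1) ≤ M * M := Nat.mul_le_mul (by omega) heM
    rw [hcost]
    simp only [wp_ite, wp_skip, wp_seq, Expr.ok_get, Expr.ok_var, Expr.eval_get, Expr.eval_var, hi1]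
    refine ⟨trivial, fun hz => ?_, fun hz => ?_⟩
    · have hL := hI.zf.1 hz
      refine ⟨by rw [unaryCost, if_pos hL], ds ++ [0], happ 0 ⟨by omega, fun _ _ _ => by omega, fun _ v hv => ?_⟩, ?_, ?_⟩
      · rw [hL, List.length_eq_zero_iff.1 hv]; rfl
      · simp [hsum]
      · simp [Nat.add_mul]; omega
    · refine wp_call (loadGap_spec hi1 hG) ?_
      rintro s2 t2 hf2 ht2 ⟨e1, e2, e3, e4, e5⟩
      have hE2 := hE1.frame hf2 rfl
      have hi2 : s2.var .i = i := by rw [hf2.var _ rfl, hi1]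
      have hs2 : s2.var .sum = s1.var .sum := hf2.var _ rfl
      refine wp_call (unaryGap_spec hB hE2.ell_eq hE2.ell_lt hi2 (hE2.gap i hi) (hE2.info i hi)
        (by rw [hf2.arr _ rfl]; exact hz) e3 e4 (by rw [e5, hf2.arr _ rfl]) (by rw [hs2, hsum]; omega)) ?_
      rintro s3 t3 hf3 ht3 ⟨d, hd, hsum3⟩
      refine ⟨?_, ds ++ [d], happ d hd, ?_, ?_⟩
      · rw [unaryCost, if_neg (fun h => hI.zf.2 h hz)]; omega
      · simp only [St.set_var, reduceCtorEq, if_false, hsum3, hs2, hsum, List.sum_append, List.sum_singleton]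
        omega
      · have := hd.1
        simp only [List.sum_append, List.sum_singleton, Nat.add_mul]
        omega
  · rintro s1 t1 hf1 - ⟨ds, hds, hsum, hle⟩ ht1
    rw [List.take_length] at hds
    have hwl : ∀ h < 2, s1.arr .wlen h = (ws h).length := by
      intro h hh
      rw [hf1.arr _ rfl]
      exact hE.len h hh
    have hle' : gc.length * (ell + 1) ≤ M * M := Nat.mul_le_mul (by omega) heM
    simp only [wp_assign, Expr.ok_two, Expr.eval_two]
    refine ⟨by omega, ?_⟩
    refine wp_for_const 2 (fun k s' => ∀ h < k, (s'.arr .ans h ≠ 0 ↔ s1.var .sum ≤ (ws h).length) ∧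
      s'.arr .ans h ≤ 1) 1 (by simp) (by simp) rfl rfl (by omega) (by simp) ?_ ?_
    · intro h hh s2 hf2 hh2 hI
      have hs2 : s2.var .sum = s1.var .sum := by rw [hf2.var _ rfl]; simp
      have hwl2 : s2.arr .wlen h = (ws h).length := by rw [hf2.arr _ rfl]; exact hwl h hh
      simp only [wp_store, Expr.ok_var, Expr.ok_sub, Expr.ok_one, Expr.ok_ltt, Expr.ok_get, Expr.eval_var,
        Expr.eval_sub, Expr.eval_one, Expr.eval_ltt, Expr.eval_get, hh2, hs2, hwl2]
      refine ⟨trivial, ⟨by omega, trivial, trivial⟩, by omega, fun k hk => ?_⟩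
      rw [St.set_arr, St.put_arr_self]
      by_cases hkh : k = h
      · subst hkh
        rw [Function.update_self]
        by_cases h5 : (ws k).length < s1.var .sum
        · simp [h5]
        · simp [h5]; omega
      · rw [Function.update_of_ne hkh]
        exact hI k (by omega)
    · intro s2 t2 hf2 _ hI ht2
      have hle2 : ∀ i < 2, s2.arr .ans i ≤ 1 := fun i hi => (hI i hi).2
      have hck := check_iff p _ (fun i hi => (hI i hi).1) hle2
      simp only [wp_assign, St.set_var, if_true]
      refine ⟨check_ok p (by omega) hle2, by omega, hck.trans ?_⟩
      have hm : ∀ h < 2, ∀ u : List (Fin 1), u.length = gc.length + 1 →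
          (Matches (ws h) (gc.map (RegLenConstraint.lang 1)) u (fun _ => True) ↔ s1.var .sum ≤ (ws h).length) := by
        intro h hh u hu
        rw [Matches.congr (C' := fun j => 0 ≤ j) (by simp), matches_unary (hE.len_le h hh) hds, hsum,
          List.length_map]
        omega
      have hgood : ∀ A A' B B' : Prop, (A ↔ A') → (B ↔ B') → (Good p A B ↔ Good p A' B') := by
        intro A A' B B' h1 h2
        rw [propext h1, propext h2]
      constructor
      · intro h a _ u hu
        exact (hgood _ _ _ _ (hm 0 (by omega) _ (by simp [hu])) (hm 1 (by omega) _ (by simp [hu]))).2 h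
      · intro h
        exact (hgood _ _ _ _ (hm 0 (by omega) _ (by simp)) (hm 1 (by omega) _ (by simp))).1
          (h 0 (by omega) (List.replicate gc.length 0) (by simp))

/-! ### Facts on the encoding -/

/-- The encoding of a constraint, with or without its automaton. -/
noncomputable def encodeGap (r : Bool) (σ : ℕ) (c : RegLenConstraint σ) : List ℕ :=
  c.len.encode σ ++ if r then encodeDFA c.dfa else []

/-- A length constraint as a constraint with an automaton that accepts everything. -/
def withDFA (σ : ℕ) (l : LenConstraint) : RegLenConstraint σ where
  len := l
  numStates := 1
  dfa := ⟨fun _ _ => 0, 0, {0}⟩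

theorem withDFA_lang (σ : ℕ) (l : LenConstraint) : (withDFA σ l).lang σ = l.lang σ := by
  ext v
  have : v ∈ (withDFA σ l).dfa.accepts := by
    rw [DFA.mem_accepts]
    exact Subsingleton.elim _ _
  exact ⟨fun h => h.2, fun h => ⟨this, h⟩⟩

theorem storedAt_flatMap {β : Type} {f : ℕ → ℕ} {P : ℕ} {l : List β} {g : β → List ℕ}
    (h : StoredAt f P (l.flatMap g)) (i : ℕ) (hi : i < l.length) :
    StoredAt f (P + ((l.take i).flatMap g).length) (g l[i]) := by
  have h1 : l.flatMap g = (l.take i).flatMap g ++ (g l[i] ++ (l.drop (i + 1)).flatMap g) := by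
    conv_lhs => rw [← List.take_append_drop i l, List.drop_eq_getElem_cons hi]
    rw [List.flatMap_append, List.flatMap_cons]
  rw [h1, storedAt_append, storedAt_append] at h
  exact h.2.1

theorem length_take_flatMap_succ {β : Type} (l : List β) (g : β → List ℕ) (i : ℕ) (hi : i < l.length) :
    ((l.take (i + 1)).flatMap g).length = ((l.take i).flatMap g).length + (g l[i]).length := by
  rw [List.take_add_one, List.getElem?_eq_getElem hi, List.flatMap_append, List.length_append]
  simp [Option.toList]

theorem length_take_flatMap_le {β : Type} (l : List β) (g : β → List ℕ) (i : ℕ) :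
    ((l.take i).flatMap g).length ≤ (l.flatMap g).length := by
  conv_rhs => rw [← List.take_append_drop i l]
  rw [List.flatMap_append, List.length_append]
  omega

theorem length_flatMap_of_eq {β : Type} (l : List β) (g : β → List ℕ) (m : ℕ) (h : ∀ a ∈ l, (g a).length = m) :
    (l.flatMap g).length = l.length * m := by
  induction l with
  | nil => simp
  | cons a l ih =>
    rw [List.flatMap_cons, List.length_append, h a (by simp), ih (fun b hb => h b (by simp [hb])),
      List.length_cons]
    ring

theorem length_encodeDFA {σ q : ℕ} (A : DFA (Fin σ) (Fin q)) : (encodeDFA A).length = 2 + q + q * σ := by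
  unfold encodeDFA
  rw [List.length_append, List.length_append, length_flatMap_of_eq _ _ σ (by simp)]
  simp

/-- The acceptance flags begin two cells later, behind the number of states and the initial state.
-/
theorem autOf_in {M σ P : ℕ} {f : ℕ → ℕ} (c : RegLenConstraint σ) (h : StoredAt f P (encodeDFA c.dfa))
    (hM : P + (encodeDFA c.dfa).length ≤ M) : (autOf c (P + 2)).In M f := by
  rw [length_encodeDFA] at hM
  unfold encodeDFA at h
  rw [storedAt_append, storedAt_append] at h
  obtain ⟨⟨-, h1⟩, h2⟩ := h
  refine ⟨fun x hx => ?_, fun x hx y hy => ?_, fun x hx y hy => ?_, c.dfa.start.2, ?_⟩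
  · have hx : x < c.numStates := hx
    have := h1 x (by simpa using hx)
    rw [show (autOf c (P + 2)).ac + x = P + [c.numStates, (c.dfa.start : ℕ)].length + x from rfl, this]
    have h3 := autOf_acc c (P + 2) ⟨x, hx⟩
    rw [show (autOf c (P + 2)).acc x ↔ _ from h3]
    simp
  · have hx : x < c.numStates := hx
    have hy : y < σ := hy
    have := storedAt_flatMap h2 x (by simpa using hx) y (by simpa using hy)
    have h3 := autOf_tr c (P + 2) ⟨x, hx⟩ ⟨y, hy⟩
    have h3 : (autOf c (P + 2)).tr x y = _ := h3
    rw [h3]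
    rw [length_flatMap_of_eq _ _ σ (by simp)] at this
    simp only [List.length_append, List.length_cons, List.length_nil, List.length_map, List.length_finRange,
      List.length_take, List.getElem_map, List.getElem_finRange] at this
    rw [Nat.min_eq_left hx.le] at this
    show f (P + 2 + c.numStates + x * σ + y) = _
    rw [← Nat.add_assoc, Nat.zero_add] at this
    exact this
  · have hx : x < c.numStates := hx
    have hy : y < σ := hy
    have h3 := autOf_tr c (P + 2) ⟨x, hx⟩ ⟨y, hy⟩
    have h3 : (autOf c (P + 2)).tr x y = _ := h3
    rw [h3]
    exact Fin.isLt _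
  · show P + 2 + c.numStates + c.numStates * σ ≤ M
    omega

/-- A flag 1 followed by `σ` zeros encodes one accepting state with loops. The memory behind the
input is 0, so writing a single 1 there creates this automaton for all length constraints at once.
-/
theorem autOf_withDFA_in {M σ P : ℕ} {f : ℕ → ℕ} (l : LenConstraint) (h1 : f P = 1)
    (h0 : ∀ y < σ, f (P + 1 + y) = 0) (hM : P + 1 + σ ≤ M) : (autOf (withDFA σ l) P).In M f := by
  refine ⟨fun x hx => ?_, fun x hx y hy => ?_, fun x hx y hy => ?_, Nat.one_pos, ?_⟩
  · obtain rfl : x = 0 := Nat.lt_one_iff.1 hx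
    rw [show (autOf (withDFA σ l) P).ac + 0 = P from rfl, h1]
    have := autOf_acc (withDFA σ l) P (0 : Fin 1)
    refine iff_of_true one_ne_zero (this.2 rfl)
  · obtain rfl : x = 0 := Nat.lt_one_iff.1 hx
    have hy : y < σ := hy
    have h3 := autOf_tr (withDFA σ l) P (0 : Fin 1) ⟨y, hy⟩
    have h3 : (autOf (withDFA σ l) P).tr 0 y = 0 := h3
    rw [h3]
    show f (P + 1 + 0 * σ + y) = 0
    rw [Nat.zero_mul, Nat.add_zero]
    exact h0 y hy
  · obtain rfl : x = 0 := Nat.lt_one_iff.1 hx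
    have hy : y < σ := hy
    have h3 := autOf_tr (withDFA σ l) P (0 : Fin 1) ⟨y, hy⟩
    have h3 : (autOf (withDFA σ l) P).tr 0 y = 0 := h3
    rw [h3]
    exact Nat.one_pos
  · show P + 1 + 1 * σ ≤ M
    omega

/-- The entries are bounded in terms of the length of the list. -/
def Small (σ : ℕ) (l : List ℕ) : Prop := ∀ x ∈ l, x ≤ l.length + σ

theorem Small.append {σ : ℕ} {a b : List ℕ} (ha : Small σ a) (hb : Small σ b) : Small σ (a ++ b) := by
  intro x hx
  rw [List.length_append]
  rcases List.mem_append.1 hx with h | h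
  · have := ha x h; omega
  · have := hb x h; omega

theorem Small.flatMap {σ : ℕ} {β : Type} {l : List β} {g : β → List ℕ} (h : ∀ a ∈ l, Small σ (g a)) :
    Small σ (l.flatMap g) := by
  induction l with
  | nil => intro x hx; simp at hx
  | cons a l ih =>
    rw [List.flatMap_cons]
    exact (h a (by simp)).append (ih fun b hb => h b (by simp [hb]))

theorem length_encodeBound_pos (b : ℕ∞) : 1 ≤ (encodeBound b).length := by
  cases b using ENat.recTopCoe with
  | top => exact le_rfl
  | coe n => exact Nat.succ_le_succ (Nat.zero_le _)

theorem small_encodeBound (σ : ℕ) (b : ℕ∞) : Small σ (encodeBound b) := by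
  intro x hx
  cases b using ENat.recTopCoe with
  | top =>
    have hx : x ∈ [1] := hx
    have : (encodeBound ⊤).length = 1 := rfl
    simp at hx
    omega
  | coe n =>
    have hx : x ∈ 0 :: n.bits.length :: n.bits.map Bool.toNat := hx
    have hlen : (encodeBound n).length = n.bits.length + 2 := by
      show (0 :: n.bits.length :: n.bits.map Bool.toNat).length = _
      simp
    rw [hlen]
    simp only [List.mem_cons, List.mem_map] at hx
    rcases hx with rfl | rfl | ⟨d, -, rfl⟩
    · omega
    · omega
    · have := Bool.toNat_le d
      omega

theorem small_encodeDFA {σ q : ℕ} (A : DFA (Fin σ) (Fin q)) : Small σ (encodeDFA A) := by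
  intro x hx
  rw [length_encodeDFA]
  simp only [encodeDFA, List.mem_append, List.mem_cons, List.not_mem_nil, or_false, List.mem_map,
    List.mem_flatMap] at hx
  rcases hx with ((rfl | rfl) | ⟨y, -, rfl⟩) | ⟨y, -, z, -, rfl⟩
  · omega
  · have := A.start.2
    omega
  · split <;> omega
  · have := (A.step y z).2
    omega

theorem small_encodeGap (r : Bool) (σ : ℕ) (c : RegLenConstraint σ) : Small σ (encodeGap r σ c) := by
  refine ((small_encodeBound σ _).append (small_encodeBound σ _)).append ?_
  cases r
  · intro x hx; simp at hx
  · exact small_encodeDFA c.dfa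

theorem encodeWord_eq {σ : ℕ} (w : List (Fin σ)) : encodeWord w = w.length :: w.map Fin.val := by
  unfold encodeWord
  congr 1
  induction w with
  | nil => rfl
  | cons a w ih => exact congrArg _ ih

theorem length_encodeWord {σ : ℕ} (w : List (Fin σ)) : (encodeWord w).length = w.length + 1 := by
  simp [encodeWord_eq]

theorem small_encodeWord {σ : ℕ} (w : List (Fin σ)) : Small σ (encodeWord w) := by
  intro x hx
  simp only [encodeWord_eq, List.mem_cons, List.mem_map] at hx
  simp only [encodeWord_eq, List.length_cons, List.length_map]
  rcases hx with rfl | ⟨a, -, rfl⟩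
  · omega
  · have := a.2; omega

theorem length_encodeGap_pos (r : Bool) (σ : ℕ) (c : RegLenConstraint σ) : 1 ≤ (encodeGap r σ c).length := by
  have := length_encodeBound_pos c.len.lo
  simp only [encodeGap, LenConstraint.encode, List.length_append]
  omega

theorem length_le_flatMap {β : Type} (l : List β) (g : β → List ℕ) (h : ∀ a ∈ l, 1 ≤ (g a).length) :
    l.length ≤ (l.flatMap g).length := by
  induction l with
  | nil => simp
  | cons a l ih =>
    have := h a (by simp)
    have := ih fun b hb => h b (by simp [hb])
    simp
    simp at this
    omega

/-- The strings of an instance; for universality the string is repeated. -/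
def strings {α : Type} : (p : Problem) → p.Words α → ℕ → List α
  | .uni, w, _ => w
  | .con, w, h => if h = 0 then w.1 else w.2
  | .equ, w, h => if h = 0 then w.1 else w.2

/-- The positions of the strings in the encoding. -/
def base {α : Type} : (p : Problem) → p.Words α → ℕ → ℕ
  | .uni, _, _ => 2
  | .con, w, h => if h = 0 then 2 else 3 + w.1.length
  | .equ, w, h => if h = 0 then 2 else 3 + w.1.length

theorem storedAt_encodeWord {σ P : ℕ} {f : ℕ → ℕ} {w : List (Fin σ)} (h : StoredAt f P (encodeWord w)) :
    f P = w.length ∧ ∀ j (hj : j < w.length), f (P + 1 + j) = w[j] := by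
  rw [encodeWord_eq] at h
  obtain ⟨h1, h2⟩ := storedAt_cons.1 h
  refine ⟨h1, fun j hj => ?_⟩
  rw [h2 j (by simpa using hj)]
  simp

theorem storedAt_encodeWords {σ : ℕ} {f : ℕ → ℕ} (p : Problem) (w : p.Words (Fin σ))
    (h : StoredAt f 1 (p.encodeWords w)) (i : ℕ) :
    f (base p w i - 1) = (strings p w i).length ∧
      (∀ j (hj : j < (strings p w i).length), f (base p w i + j) = (strings p w i)[j]) ∧
      base p w i + (strings p w i).length ≤ 1 + (p.encodeWords w).length := by
  have two : ∀ (a b : List (Fin σ)), StoredAt f 1 (encodeWord a ++ encodeWord b) →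
      f ((if i = 0 then 2 else 3 + a.length) - 1) = (if i = 0 then a else b).length ∧
      (∀ j (hj : j < (if i = 0 then a else b).length),
        f ((if i = 0 then 2 else 3 + a.length) + j) = (if i = 0 then a else b)[j]) ∧
      (if i = 0 then 2 else 3 + a.length) + (if i = 0 then a else b).length ≤
        1 + (encodeWord a ++ encodeWord b).length := by
    intro a b h
    rw [storedAt_append] at h
    rw [List.length_append, length_encodeWord, length_encodeWord]
    rw [length_encodeWord] at h
    by_cases hi : i = 0
    · subst hi
      obtain ⟨h1, h2⟩ := storedAt_encodeWord h.1
      simp only [if_true]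
      exact ⟨h1, h2, by omega⟩
    · obtain ⟨h1, h2⟩ := storedAt_encodeWord h.2
      simp only [hi, if_false]
      refine ⟨by rw [← h1]; congr 1; omega, fun j hj => ?_, by omega⟩
      rw [← h2 j hj]
      congr 1
      omega
  cases p with
  | uni =>
    obtain ⟨h1, h2⟩ := storedAt_encodeWord h
    refine ⟨h1, h2, ?_⟩
    show 2 + w.length ≤ 1 + (encodeWord w).length
    have := length_encodeWord w
    omega
  | con => exact two w.1 w.2 h
  | equ => exact two w.1 w.2 h

section
variable {p : Problem} (I : Instance p RegLenConstraint) (r : Bool)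

/-- The position of the constraints in the encoding. -/
def gapBase : ℕ := 2 + (p.encodeWords I.words).length

theorem length_encode : (I.encode (encodeGap r)).length =
    gapBase I + (I.gc.flatMap (encodeGap r I.σ)).length := by
  simp [Instance.encode, gapBase]
  omega

/-- Large bounds are spread over many cells, one binary digit each; all other entries are letters,
states, flags or sizes of lists that are present in the input. So the input length and `σ` bound
every entry. -/
theorem small_encode : Small I.σ (I.encode (encodeGap r)) := by
  have h1 : Small I.σ (p.encodeWords I.words) := by
    obtain ⟨σ, _, w, _⟩ := I
    cases p with
    | uni => exact small_encodeWord w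
    | con => exact (small_encodeWord w.1).append (small_encodeWord w.2)
    | equ => exact (small_encodeWord w.1).append (small_encodeWord w.2)
  have h2 : Small I.σ (I.gc.flatMap (encodeGap r I.σ)) :=
    Small.flatMap fun c _ => small_encodeGap r I.σ c
  have h3 : Small I.σ ([I.gc.length] ++ I.gc.flatMap (encodeGap r I.σ)) := by
    intro x hx
    rcases List.mem_append.1 hx with h | h
    · have := length_le_flatMap I.gc (encodeGap r I.σ) fun c _ => length_encodeGap_pos r I.σ c
      simp only [List.mem_singleton] at h
      simp only [List.length_append, List.length_singleton]
      omega
    · have := h2 x h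
      simp only [List.length_append, List.length_singleton]
      omega
  have h4 : Small I.σ [I.σ] := by
    intro x hx
    simp only [List.mem_singleton] at hx
    omega
  unfold Instance.encode
  rw [List.append_assoc]
  exact (h4.append h1).append h3

theorem ell_eq (h : ℕ) (hh : h < 2) : (strings p I.words h).length ≤ I.ell := by
  obtain ⟨σ, _, w, _⟩ := I
  cases p with
  | uni => exact le_rfl
  | con =>
    show (if h = 0 then w.1 else w.2).length ≤ max w.1.length w.2.length
    split <;> omega
  | equ =>
    show (if h = 0 then w.1 else w.2).length ≤ max w.1.length w.2.length
    split <;> omega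

theorem ell_eq_max : I.ell = max (strings p I.words 0).length (strings p I.words 1).length := by
  obtain ⟨σ, _, w, _⟩ := I
  cases p with
  | uni => exact (max_self _).symm
  | con => rfl
  | equ => rfl

variable {I r} in
theorem storedAt_encode {f : ℕ → ℕ} (h : StoredAt f 0 (I.encode (encodeGap r))) :
    f 0 = I.σ ∧ StoredAt f 1 (p.encodeWords I.words) ∧ f (gapBase I - 1) = I.gc.length ∧
      StoredAt f (gapBase I) (I.gc.flatMap (encodeGap r I.σ)) := by
  unfold Instance.encode at h
  rw [List.append_assoc, List.append_assoc, List.singleton_append, List.singleton_append, storedAt_cons,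
    storedAt_append, storedAt_cons] at h
  obtain ⟨h1, h2, h3, h4⟩ := h
  refine ⟨h1, h2, ?_, ?_⟩
  · rw [← h3]
    congr 1
    unfold gapBase
    omega
  · convert h4 using 1
    unfold gapBase
    omega

/-- All `gc`-subsequences have length `k`, so inclusion and equality of the sets can be tested on
words of this length. -/
theorem isYes_iff : I.IsYes RegLenConstraint.lang ↔
    GoodFrom p (strings p I.words) I.gc (fun _ _ => True) 0 := by
  have hlen : ∀ (w : List (Fin I.σ)) u, u ∈ subseqSet (I.gc.map (RegLenConstraint.lang I.σ)) w →
      u.length = I.gc.length + 1 := by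
    intro w u hu
    rw [mem_subseqSet] at hu
    simpa using hu.length_eq
  have cons : ∀ (Q : List (Fin I.σ) → Prop),
      (∀ a : Fin I.σ, 0 ≤ (a : ℕ) → ∀ u : List (Fin I.σ), u.length = I.gc.length → Q (a :: u)) ↔
        ∀ u, u.length = I.gc.length + 1 → Q u := by
    intro Q
    constructor
    · intro h u hu
      cases u with
      | nil => simp at hu
      | cons a u => exact h a (by omega) u (by simpa using hu)
    · intro h a _ u hu
      exact h (a :: u) (by simp [hu])
  have := cons fun u => Good p (u ∈ subseqSet (I.gc.map (RegLenConstraint.lang I.σ)) (strings p I.words 0))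
    (u ∈ subseqSet (I.gc.map (RegLenConstraint.lang I.σ)) (strings p I.words 1))
  unfold GoodFrom
  simp only [mem_subseqSet] at this
  rw [this]
  simp only [← mem_subseqSet]
  obtain ⟨σ, _, w, gc⟩ := I
  clear this
  cases p with
  | uni =>
    show subseqSet _ w = _ ↔ ∀ u : List (Fin σ), _ → u ∈ subseqSet _ w
    constructor
    · intro h u hu
      rw [h]
      simpa using hu
    · intro h
      ext u
      exact ⟨fun hu => by simpa using hlen _ u hu, fun hu => h u (by simpa using hu)⟩
  | con =>
    show subseqSet _ w.1 ⊆ subseqSet _ w.2 ↔ ∀ u : List (Fin σ), _ → (u ∈ subseqSet _ w.1 → u ∈ subseqSet _ w.2)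
    exact ⟨fun h u _ hu => h hu, fun h u hu => h u (hlen _ u hu) hu⟩
  | equ =>
    show subseqSet _ w.1 = subseqSet _ w.2 ↔ ∀ u : List (Fin σ), _ → (u ∈ subseqSet _ w.1 ↔ u ∈ subseqSet _ w.2)
    constructor
    · intro h u _
      rw [h]
    · intro h
      ext u
      exact ⟨fun hu => (h u (hlen _ u hu)).1 hu, fun hu => (h u (hlen _ u hu)).2 hu⟩

theorem subseqSet_eq_empty {α : Type} {gc : List (Language α)} {w : List α} (h : w.length ≤ gc.length) :
    subseqSet gc w = ∅ := by
  rw [Set.eq_empty_iff_forall_notMem]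
  rintro u ⟨e, ⟨he, -⟩, -⟩
  have := Fintype.card_le_of_injective e he.injective
  simp at this
  omega

/-- The answer if there are no subsequences at all. -/
def trivialAnswer : Problem → ℕ
  | .uni => 0
  | _ => 1

/-- For `k > ℓ` both sets are empty, so inclusion and equality hold, whereas `Σ^k` is not empty.
This case is separated because the bound for length constraints need not cover the time for reading
more than `ℓ` constraints. -/
theorem isYes_of_short (h : I.ell ≤ I.gc.length) :
    I.IsYes RegLenConstraint.lang ∧ trivialAnswer p = 1 ∨
      ¬ I.IsYes RegLenConstraint.lang ∧ trivialAnswer p = 0 := by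
  obtain ⟨σ, hσ, w, gc⟩ := I
  cases p with
  | uni =>
    have h : w.length ≤ gc.length := h
    right
    refine ⟨fun hy => ?_, rfl⟩
    have hy : subseqSet (gc.map (RegLenConstraint.lang σ)) w = {u | u.length = (gc.map (RegLenConstraint.lang σ)).length + 1} := hy
    have he : subseqSet (gc.map (RegLenConstraint.lang σ)) w = ∅ := subseqSet_eq_empty (by simpa using h)
    have hy := he.symm.trans hy
    have : List.replicate (gc.length + 1) (⟨0, hσ⟩ : Fin σ) ∈ (∅ : Set (List (Fin σ))) := by rw [hy]; simp
    exact this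
  | con =>
    have h : max w.1.length w.2.length ≤ gc.length := h
    left
    refine ⟨?_, rfl⟩
    show subseqSet (gc.map (RegLenConstraint.lang σ)) w.1 ⊆ _
    rw [subseqSet_eq_empty (by simp; omega)]
    exact Set.empty_subset _
  | equ =>
    have h : max w.1.length w.2.length ≤ gc.length := h
    left
    refine ⟨?_, rfl⟩
    show subseqSet (gc.map (RegLenConstraint.lang σ)) w.1 = subseqSet (gc.map (RegLenConstraint.lang σ)) w.2
    rw [subseqSet_eq_empty (by simp; omega), subseqSet_eq_empty (by simp; omega)]

end

/-! ### Reading the input -/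

/-- Read everything in front of the constraints. -/
def header : Problem → Cmd
  | .uni =>
    .sig ::= .get .inp 0 ;; .n0 ::= .get .inp 1 ;; .b0 ::= 2 ;; .n1 ::= Var.n0 ;; .b1 ::= 2 ;;
    .p ::= (2 : Expr) + Var.n0 ;; .g ::= .get .inp Var.p ;; .p ::= (Var.p : Expr) + 1 ;; .ell ::= Var.n0 ;;
    .ite (Expr.ltt Var.n0 Var.n1) (.ell ::= Var.n1) .skip ;; .act ::= Expr.ltt Var.g Var.ell
  | _ =>
    .sig ::= .get .inp 0 ;; .n0 ::= .get .inp 1 ;; .b0 ::= 2 ;; .n1 ::= .get .inp ((2 : Expr) + Var.n0) ;;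
    .b1 ::= (2 : Expr) + 1 + Var.n0 ;;
    .p ::= (Var.b1 : Expr) + Var.n1 ;; .g ::= .get .inp Var.p ;; .p ::= (Var.p : Expr) + 1 ;; .ell ::= Var.n0 ;;
    .ite (Expr.ltt Var.n0 Var.n1) (.ell ::= Var.n1) .skip ;; .act ::= Expr.ltt Var.g Var.ell

/-- Skip a bound. -/
def skipBound : Cmd :=
  .ite (.get .inp Var.ptr) (.ptr ::= (Var.ptr : Expr) + 1)
    (.ptr ::= (Var.ptr : Expr) + 2 + .get .inp ((Var.ptr : Expr) + 1))

/-- Skip an automaton. -/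
def skipDFA : Bool → Cmd
  | true => .q ::= .get .inp Var.ptr ;; .ptr ::= (Var.ptr : Expr) + 2 + Var.q + (Var.q : Expr) * Var.sig
  | false => .skip

/-- Find the end of the input. -/
def findEnd (r : Bool) : Cmd :=
  .ptr ::= Var.p ;; .for .i .g (skipBound ;; skipBound ;; skipDFA r) ;;
  .w ::= Var.ptr ;; .big ::= (Var.ptr : Expr) + Var.sig + .lit 16

/-- Enter the automaton into the tables. -/
def enterDFA : Bool → Cmd
  | true => .q ::= .get .inp Var.ptr ;; .store .qq Var.i Var.q ;; .store .st Var.i (.get .inp ((Var.ptr : Expr) + 1)) ;;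
      .store .ac Var.i ((Var.ptr : Expr) + 2) ;; .ptr ::= (Var.ptr : Expr) + 2 + Var.q + (Var.q : Expr) * Var.sig
  | false => .store .qq Var.i 1 ;; .store .st Var.i 0 ;; .store .ac Var.i Var.w

/-- Store the positions of all parts of the input in tables.  If there are no automata, one that accepts
everything is stored behind the input. -/
def setup (r : Bool) : Cmd :=
  .ite (.lit r.toNat) .skip (.store .inp Var.w 1) ;;
  .store .wbase 0 Var.b0 ;; .store .wbase 1 Var.b1 ;; .store .wlen 0 Var.n0 ;; .store .wlen 1 Var.n1 ;;
  .ptr ::= Var.p ;;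
  .for .i .g (.store .lop Var.i Var.ptr ;; skipBound ;; .store .hip Var.i Var.ptr ;; skipBound ;; enterDFA r)

/-- The part of the algorithm that needs the arrays. -/
def main (p : Problem) (r : Bool) : Cmd :=
  setup r ;; classify ;; .ite (Expr.eqq Var.sig 1) (unary p) (dfs p) ;; .ite Var.res (.res ::= 1) .skip

/-- The header of the instance has been read. -/
structure Parsed {p : Problem} (I : Instance p RegLenConstraint) (s : St) : Prop where
  sig_eq : s.var .sig = I.σ
  g_eq : s.var .g = I.gc.length
  ell_eq : s.var .ell = I.ell
  n0_eq : s.var .n0 = (strings p I.words 0).length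
  n1_eq : s.var .n1 = (strings p I.words 1).length
  b0_eq : s.var .b0 = base p I.words 0
  b1_eq : s.var .b1 = base p I.words 1
  p_eq : s.var .p = gapBase I

theorem Parsed.frame {p : Problem} {I : Instance p RegLenConstraint} {s s' : St} {a : Cmd} (h : Parsed I s)
    (hf : Frame a s s') (ha : [Var.sig, .g, .ell, .n0, .n1, .b0, .b1, .p].all (fun x => !a.wr x) = true) :
    Parsed I s' := by
  simp only [List.all_cons, List.all_nil, Bool.and_eq_true, Bool.not_eq_true', Bool.and_true] at ha
  obtain ⟨h1, h2, h3, h4, h5, h6, h7, h8⟩ := ha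
  exact ⟨by rw [hf.var _ h1, h.sig_eq], by rw [hf.var _ h2, h.g_eq], by rw [hf.var _ h3, h.ell_eq],
    by rw [hf.var _ h4, h.n0_eq], by rw [hf.var _ h5, h.n1_eq], by rw [hf.var _ h6, h.b0_eq],
    by rw [hf.var _ h7, h.b1_eq], by rw [hf.var _ h8, h.p_eq]⟩

theorem header_spec {M Z : ℕ} {p : Problem} {I : Instance p RegLenConstraint} {r : Bool} {s : St} (hB : Big M Z)
    (hM : (I.encode (encodeGap r)).length ≤ M) (hI : StoredAt (s.arr .inp) 0 (I.encode (encodeGap r))) :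
    wp Z (header p) (fun s' t => t ≤ 14 ∧ Parsed I s' ∧ (s'.var .act ≠ 0 ↔ I.gc.length < I.ell)) s 0 := by
  have hl := hB.lin
  have hM16 := hB.le
  rw [length_encode] at hM
  obtain ⟨h1, h2, h3, -⟩ := storedAt_encode hI
  have hw0 := storedAt_encodeWords p I.words h2 0
  have hw1 := storedAt_encodeWords p I.words h2 1
  have hell := ell_eq_max I
  obtain ⟨σ, hσ, w, gc⟩ := I
  have hact : ∀ x y : ℕ, ((if x < y then 1 else 0) ≠ 0 ↔ x < y) := by
    intro x y
    split <;> simp [*]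
  -- Containment and equivalence have the same input format and share this computation.
  have two : ∀ (a b : List (Fin σ)) (Q : Problem), Q ≠ .uni →
      s.arr .inp 0 = σ → s.arr .inp 1 = a.length → s.arr .inp (2 + a.length) = b.length →
      s.arr .inp (3 + a.length + b.length) = gc.length → a.length + b.length + 16 ≤ M + 12 →
      wp Z (header Q) (fun s' t => t ≤ 14 ∧ (s'.var .sig = σ ∧ s'.var .g = gc.length ∧
        s'.var .ell = max a.length b.length ∧ s'.var .n0 = a.length ∧ s'.var .n1 = b.length ∧ s'.var .b0 = 2 ∧
        s'.var .b1 = 3 + a.length ∧ s'.var .p = 4 + a.length + b.length) ∧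
        (s'.var .act ≠ 0 ↔ gc.length < max a.length b.length)) s 0 := by
    intro a b Q hQ e1 e2 e3 e4 e5
    have : header Q = header .con := by cases Q <;> first | rfl | exact absurd rfl hQ
    rw [this]
    simp only [header, wp_seq, wp_assign, wp_ite, wp_skip, Expr.ok_get, Expr.ok_zero, Expr.ok_one, Expr.ok_two,
      Expr.ok_var, Expr.ok_add, Expr.ok_ltt, Expr.eval_get, Expr.eval_zero, Expr.eval_one, Expr.eval_two,
      Expr.eval_var, Expr.eval_add, Expr.eval_ltt, e1, e2, e3, e4, St.set_var, St.set_arr, reduceCtorEq, if_true,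
      if_false, Nat.reduceAdd, hact, true_and, and_true]
    refine ⟨by omega, by omega, by omega, by omega, by omega, by omega, by omega, fun h => by omega, fun h => ?_⟩
    have := of_ite_eq h
    omega
  cases p with
  | uni =>
    have hlw := length_encodeWord w
    have hgb : gapBase (p := .uni) ⟨σ, hσ, w, gc⟩ = 3 + w.length := by
      show 2 + (encodeWord w).length = _
      omega
    rw [hgb] at h3 hM
    have e1 : s.arr .inp 0 = σ := h1
    have e2 : s.arr .inp 1 = w.length := hw0.1
    have e3 : s.arr .inp (2 + w.length) = gc.length := by rw [← h3]; congr 1; omega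
    simp only [header, wp_seq, wp_assign, wp_ite, wp_skip, Expr.ok_get, Expr.ok_zero, Expr.ok_one, Expr.ok_two,
      Expr.ok_var, Expr.ok_add, Expr.ok_ltt, Expr.eval_get, Expr.eval_zero, Expr.eval_one, Expr.eval_two,
      Expr.eval_var, Expr.eval_add, Expr.eval_ltt, e1, e2, e3, St.set_var, St.set_arr, reduceCtorEq, if_true,
      if_false, hact, lt_irrefl, true_and, and_true, not_false_eq_true, forall_true_left, false_imp_iff,
      ne_eq, not_true_eq_false]
    refine ⟨by omega, by omega, by omega, by omega, by omega, by omega, by omega, ⟨?_, ?_, ?_, ?_, ?_, ?_, ?_, ?_⟩,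
      Iff.rfl⟩
    all_goals simp only [St.set_var, reduceCtorEq, if_true, if_false, hgb]
    all_goals first | rfl | omega
  | con =>
    have hla := length_encodeWord w.1
    have hlb := length_encodeWord w.2
    have hgb : gapBase (p := .con) ⟨σ, hσ, w, gc⟩ = 4 + w.1.length + w.2.length := by
      show 2 + (encodeWord w.1 ++ encodeWord w.2).length = _
      rw [List.length_append]
      omega
    rw [hgb] at h3 hM
    have hw1 : s.arr .inp (3 + w.1.length - 1) = w.2.length := hw1.1
    refine wp_mono (two w.1 w.2 .con (by simp) h1 hw0.1 (by rw [← hw1]; congr 1; omega)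
      (by rw [← h3]; congr 1; omega) (by omega)) ?_
    rintro s' t - - ⟨ht, ⟨a1, a2, a3, a4, a5, a6, a7, a8⟩, ha⟩
    exact ⟨ht, ⟨a1, a2, a3, a4, a5, a6, a7, by rw [a8, hgb]⟩, ha⟩
  | equ =>
    have hla := length_encodeWord w.1
    have hlb := length_encodeWord w.2
    have hgb : gapBase (p := .equ) ⟨σ, hσ, w, gc⟩ = 4 + w.1.length + w.2.length := by
      show 2 + (encodeWord w.1 ++ encodeWord w.2).length = _
      rw [List.length_append]
      omega
    rw [hgb] at h3 hM
    have hw1 : s.arr .inp (3 + w.1.length - 1) = w.2.length := hw1.1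
    refine wp_mono (two w.1 w.2 .equ (by simp) h1 hw0.1 (by rw [← hw1]; congr 1; omega)
      (by rw [← h3]; congr 1; omega) (by omega)) ?_
    rintro s' t - - ⟨ht, ⟨a1, a2, a3, a4, a5, a6, a7, a8⟩, ha⟩
    exact ⟨ht, ⟨a1, a2, a3, a4, a5, a6, a7, by rw [a8, hgb]⟩, ha⟩

/-- The number of digits is stored in front of them, so a bound of any size is skipped in constant
time. -/
theorem skipBound_spec {M Z P : ℕ} {s : St} (hB : Big M Z) (b : ℕ∞) (hp : s.var .ptr = P)
    (hM : P + (encodeBound b).length ≤ M) (hat : StoredAt (s.arr .inp) P (encodeBound b)) :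
    wp Z skipBound (fun s' t => t ≤ 2 ∧ s'.var .ptr = P + (encodeBound b).length) s 0 := by
  have hl := hB.lin
  have hM16 := hB.le
  unfold skipBound
  cases b using ENat.recTopCoe with
  | top =>
    have h : StoredAt (s.arr .inp) P [1] := hat
    have hlen : (encodeBound ⊤).length = 1 := rfl
    rw [storedAt_cons] at h
    simp only [wp_ite, wp_assign, Expr.ok_get, Expr.ok_var, Expr.ok_add, Expr.ok_one, Expr.eval_get, Expr.eval_var,
      Expr.eval_add, Expr.eval_one, hp, h.1, St.set_var, if_true]
    exact ⟨trivial, fun _ => ⟨⟨trivial, by omega, by omega⟩, by omega, by omega⟩, fun h => absurd h one_ne_zero⟩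
  | coe n =>
    have h : StoredAt (s.arr .inp) P (0 :: n.bits.length :: n.bits.map Bool.toNat) := hat
    have hlen : (encodeBound n).length = n.bits.length + 2 := by
      show (0 :: n.bits.length :: n.bits.map Bool.toNat).length = _
      simp
    rw [storedAt_cons, storedAt_cons] at h
    simp only [wp_ite, wp_assign, Expr.ok_get, Expr.ok_var, Expr.ok_add, Expr.ok_one, Expr.ok_two, Expr.eval_get,
      Expr.eval_var, Expr.eval_add, Expr.eval_one, Expr.eval_two, hp, h.1, h.2.1, St.set_var, if_true]
    exact ⟨trivial, fun h => absurd rfl h, fun _ => ⟨⟨⟨trivial, by omega, by omega⟩, ⟨trivial, by omega, by omega⟩,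
      by omega⟩, by omega, by omega⟩⟩

theorem storedAt_encodeDFA {σ q P : ℕ} {f : ℕ → ℕ} {A : DFA (Fin σ) (Fin q)} (h : StoredAt f P (encodeDFA A)) :
    f P = q ∧ f (P + 1) = A.start := by
  unfold encodeDFA at h
  rw [List.append_assoc, storedAt_append, storedAt_cons, storedAt_cons] at h
  exact ⟨h.1.1, h.1.2.1⟩

theorem skipDFA_spec {M Z P σ : ℕ} {s : St} (hB : Big M Z) (r : Bool) (c : RegLenConstraint σ)
    (hsg : s.var .sig = σ) (hp : s.var .ptr = P)
    (hM : P + (if r then encodeDFA c.dfa else []).length ≤ M)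
    (hat : StoredAt (s.arr .inp) P (if r then encodeDFA c.dfa else [])) :
    wp Z (skipDFA r) (fun s' t => t ≤ 2 ∧
      s'.var .ptr = P + (if r then encodeDFA c.dfa else []).length) s 0 := by
  have hl := hB.lin
  have hM16 := hB.le
  cases r with
  | false => simp [skipDFA, hp]
  | true =>
    simp only [if_true] at hM hat ⊢
    have h := storedAt_encodeDFA hat
    rw [length_encodeDFA] at hM ⊢
    simp only [skipDFA, wp_seq, wp_assign, Expr.ok_get, Expr.ok_var, Expr.ok_add, Expr.ok_mul, Expr.ok_two,
      Expr.eval_get, Expr.eval_var, Expr.eval_add, Expr.eval_mul, Expr.eval_two, hp, h.1, hsg, St.set_var,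
      reduceCtorEq, if_true, if_false]
    exact ⟨trivial, ⟨⟨⟨trivial, by omega, by omega⟩, trivial, by omega⟩, ⟨trivial, trivial, by omega⟩, by omega⟩,
      by omega, by omega⟩

/-- The position of the constraint `i`. -/
noncomputable def gapPos {p : Problem} (I : Instance p RegLenConstraint) (r : Bool) (i : ℕ) : ℕ :=
  gapBase I + ((I.gc.take i).flatMap (encodeGap r I.σ)).length

theorem gapPos_succ {p : Problem} (I : Instance p RegLenConstraint) (r : Bool) {i : ℕ} (h : i < I.gc.length) :
    gapPos I r (i + 1) = gapPos I r i + (encodeBound I.gc[i].len.lo).length + (encodeBound I.gc[i].len.hi).length +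
      (if r then encodeDFA I.gc[i].dfa else []).length := by
  unfold gapPos
  rw [length_take_flatMap_succ _ _ _ h]
  simp only [encodeGap, LenConstraint.encode, List.length_append]
  omega

theorem gapPos_le {p : Problem} (I : Instance p RegLenConstraint) (r : Bool) (i : ℕ) :
    gapPos I r i ≤ (I.encode (encodeGap r)).length := by
  have := length_take_flatMap_le I.gc (encodeGap r I.σ) i
  rw [length_encode]
  unfold gapPos
  omega

theorem gapPos_length {p : Problem} (I : Instance p RegLenConstraint) (r : Bool) :
    gapPos I r I.gc.length = (I.encode (encodeGap r)).length := by
  rw [length_encode]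
  unfold gapPos
  rw [List.take_length]

theorem storedAt_gap {p : Problem} {I : Instance p RegLenConstraint} {r : Bool} {f : ℕ → ℕ}
    (h : StoredAt f 0 (I.encode (encodeGap r))) {i : ℕ} (hi : i < I.gc.length) :
    StoredAt f (gapPos I r i) (encodeBound I.gc[i].len.lo) ∧
      StoredAt f (gapPos I r i + (encodeBound I.gc[i].len.lo).length) (encodeBound I.gc[i].len.hi) ∧
      StoredAt f (gapPos I r i + (encodeBound I.gc[i].len.lo).length + (encodeBound I.gc[i].len.hi).length)
        (if r then encodeDFA I.gc[i].dfa else []) := by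
  have := storedAt_flatMap (storedAt_encode h).2.2.2 i hi
  unfold encodeGap LenConstraint.encode at this
  rw [storedAt_append, storedAt_append, List.length_append, ← Nat.add_assoc] at this
  exact ⟨this.1.1, this.1.2, this.2⟩

/-- The input length is not given; it is found by jumping from constraint to constraint. Until then
the distance of the arrays is unknown, so this part reads `inp` and writes no array. -/
theorem findEnd_spec {M Z : ℕ} {p : Problem} {I : Instance p RegLenConstraint} {r : Bool} {s : St} (hB : Big M Z)
    (hM : (I.encode (encodeGap r)).length + I.σ + 16 = M) (hI : StoredAt (s.arr .inp) 0 (I.encode (encodeGap r)))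
    (hP : Parsed I s) (hg : I.gc.length ≤ M) :
    wp Z (findEnd r) (fun s' t => t ≤ 8 * I.gc.length + 5 ∧ Parsed I s' ∧
      s'.var .w = (I.encode (encodeGap r)).length ∧ s'.var .big = M ∧ s'.arr = s.arr) s 0 := by
  have hl := hB.lin
  have hM16 := hB.le
  unfold findEnd
  simp only [wp_seq, wp_assign, Expr.ok_var, Expr.eval_var, hP.p_eq]
  refine ⟨trivial, ?_⟩
  have hP1 : Parsed I (s.set .ptr (gapBase I)) := by
    refine hP.frame (a := .ptr ::= 0) ⟨fun y hy => ?_, fun _ _ => rfl⟩ rfl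
    have : y ≠ .ptr := by rintro rfl; simp [Cmd.wr] at hy
    simp [this]
  refine wp_for_const I.gc.length (fun i s' => s'.var .ptr = gapPos I r i) 6 (by simp [hP.g_eq]) (by simp)
    (by cases r <;> rfl) (by cases r <;> rfl) (by omega) (by simp [gapPos]) ?_ ?_
  · intro i hi s1 hf1 hi1 hptr
    have hP2 := hP1.frame hf1 (by cases r <;> rfl)
    have hinp : s1.arr .inp = s.arr .inp := by rw [hf1.arr _ (by cases r <;> rfl)]; rfl
    obtain ⟨h1, h2, h3⟩ := storedAt_gap hI hi
    have hs := gapPos_succ I r hi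
    have hle := gapPos_le I r (i + 1)
    rw [wp_seq]
    refine wp_call (skipBound_spec hB I.gc[i].len.lo hptr (by omega) (by rw [hinp]; exact h1)) ?_
    intro s2 t2 hf2 ht2 hp2
    rw [wp_seq]
    refine wp_call (skipBound_spec hB I.gc[i].len.hi hp2 (by omega) (by rw [hf2.arr _ rfl, hinp]; exact h2)) ?_
    intro s3 t3 hf3 ht3 hp3
    refine wp_call (skipDFA_spec hB r I.gc[i] (by rw [hf3.var _ rfl, hf2.var _ rfl, hP2.sig_eq]) hp3 (by omega)
      (by rw [hf3.arr _ rfl, hf2.arr _ rfl, hinp]; exact h3)) ?_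
    intro s4 t4 hf4 ht4 hp4
    exact ⟨by omega, by simp [hp4, hs]⟩
  · intro s1 t1 hf1 _ hptr ht1
    have hP2 := hP1.frame hf1 (by cases r <;> rfl)
    have harr : s1.arr = s.arr := by funext d; rw [hf1.arr d (by cases r <;> rfl)]; rfl
    rw [gapPos_length] at hptr
    simp only [wp_seq, wp_assign, Expr.ok_add, Expr.ok_var, Expr.ok_lit, Expr.eval_add, Expr.eval_var, Expr.eval_lit,
      hptr, hP2.sig_eq, St.set_var, St.set_arr, reduceCtorEq, if_true, if_false, harr]
    refine ⟨trivial, ⟨⟨trivial, trivial, by omega⟩, by omega, by omega⟩, by omega, ?_, trivial, by omega, trivial⟩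
    refine hP2.frame (a := .seq (.w ::= 0) (.big ::= 0)) ⟨fun y hy => ?_, fun _ _ => rfl⟩ rfl
    have h1 : y ≠ .w := by rintro rfl; simp [Cmd.wr] at hy
    have h2 : y ≠ .big := by rintro rfl; simp [Cmd.wr] at hy
    simp [h1, h2]

theorem enterDFA_spec {M Z P σ i n : ℕ} {s : St} (hB : Big M Z) (r : Bool) (c : RegLenConstraint σ)
    (hr : r = false → c = withDFA σ c.len) (hsg : s.var .sig = σ) (hp : s.var .ptr = P) (hi : s.var .i = i)
    (hw : s.var .w = n) (hM : P + (if r then encodeDFA c.dfa else []).length ≤ M)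
    (hat : StoredAt (s.arr .inp) P (if r then encodeDFA c.dfa else [])) :
    wp Z (enterDFA r) (fun s' t => t ≤ 5 ∧ s'.var .ptr = P + (if r then encodeDFA c.dfa else []).length ∧
      s'.arr .qq = Function.update (s.arr .qq) i c.numStates ∧
      s'.arr .st = Function.update (s.arr .st) i c.dfa.start ∧
      s'.arr .ac = Function.update (s.arr .ac) i (if r then P + 2 else n)) s 0 := by
  have hl := hB.lin
  have hM16 := hB.le
  cases r with
  | false =>
    rw [hr rfl]
    simp only [enterDFA, wp_seq, wp_store, Expr.ok_var, Expr.ok_one, Expr.ok_zero, Expr.eval_var, Expr.eval_one,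
      Expr.eval_zero, hi, hw, hp, St.put_var, true_and]
    refine ⟨by omega, by omega, by omega, rfl, ?_, ?_, ?_⟩
    · rw [St.put_arr_ne _ _ _ _ _ (by simp), St.put_arr_ne _ _ _ _ _ (by simp), St.put_arr_self]
      rfl
    · rw [St.put_arr_ne _ _ _ _ _ (by simp), St.put_arr_self, St.put_arr_ne _ _ _ _ _ (by simp)]
      rfl
    · rw [St.put_arr_self, St.put_arr_ne _ _ _ _ _ (by simp), St.put_arr_ne _ _ _ _ _ (by simp)]
      rfl
  | true =>
    simp only [if_true] at hM hat ⊢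
    have h := storedAt_encodeDFA hat
    rw [length_encodeDFA] at hM ⊢
    simp only [enterDFA, wp_seq, wp_assign, wp_store, Expr.ok_get, Expr.ok_var, Expr.ok_add, Expr.ok_mul, Expr.ok_one,
      Expr.ok_two, Expr.eval_get, Expr.eval_var, Expr.eval_add, Expr.eval_mul, Expr.eval_one, Expr.eval_two, hp, h.1,
      hi, hsg, St.set_var, St.set_arr, St.put_var, reduceCtorEq, if_true, if_false, true_and,
      St.put_arr_ne _ _ _ _ .inp (by simp : Arr.inp ≠ .qq), h.2]
    refine ⟨by omega, by omega, by omega, by omega, by omega, ?_, ?_, ?_⟩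
    · rw [St.put_arr_ne _ _ _ _ _ (by simp), St.put_arr_ne _ _ _ _ _ (by simp), St.put_arr_self]
      rfl
    · rw [St.put_arr_ne _ _ _ _ _ (by simp), St.put_arr_self, St.put_arr_ne _ _ _ _ _ (by simp)]
      rfl
    · rw [St.put_arr_self, St.put_arr_ne _ _ _ _ _ (by simp), St.put_arr_ne _ _ _ _ _ (by simp)]
      rfl

/-- The tables for the constraint `i` are filled. -/
def Entered {p : Problem} (I : Instance p RegLenConstraint) (r : Bool) (i : ℕ) (hi : i < I.gc.length) (s : St) :
    Prop :=
  s.arr .lop i = gapPos I r i ∧ s.arr .hip i = gapPos I r i + (encodeBound I.gc[i].len.lo).length ∧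
    s.arr .qq i = I.gc[i].numStates ∧ s.arr .st i = I.gc[i].dfa.start ∧
    s.arr .ac i = if r then
        gapPos I r i + (encodeBound I.gc[i].len.lo).length + (encodeBound I.gc[i].len.hi).length + 2
      else (I.encode (encodeGap r)).length

theorem Entered.gapAt {M : ℕ} {p : Problem} {I : Instance p RegLenConstraint} {r : Bool} {i : ℕ}
    {hi : i < I.gc.length} {s : St} (h : Entered I r i hi s) (hr : r = false → ∀ c ∈ I.gc, c = withDFA I.σ c.len)
    (hM : (I.encode (encodeGap r)).length + I.σ + 16 = M)
    (hI : StoredAt (s.arr .inp) 0 (I.encode (encodeGap r)))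
    (hend : r = false → s.arr .inp (I.encode (encodeGap r)).length = 1 ∧
      ∀ x, (I.encode (encodeGap r)).length < x → s.arr .inp x = 0) : GapAt M I.gc[i] i s := by
  obtain ⟨e1, e2, e3, e4, e5⟩ := h
  obtain ⟨h1, h2, h3⟩ := storedAt_gap hI hi
  have hs := gapPos_succ I r hi
  have hle := gapPos_le I r (i + 1)
  refine ⟨by rwa [e1], by rwa [e2], by rw [e1]; omega, by rw [e2]; omega, e3, e4, ?_⟩
  cases r with
  | true =>
    simp only [if_true] at e5 h3 hs
    rw [e5]
    exact autOf_in _ h3 (by omega)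
  | false =>
    simp only [Bool.false_eq_true, if_false] at e5
    obtain ⟨h4, h5⟩ := hend rfl
    rw [e5]
    have hc := hr rfl I.gc[i] (List.getElem_mem hi)
    rw [hc]
    exact autOf_withDFA_in _ h4 (fun y hy => h5 _ (by omega)) (by omega)

theorem setup_spec {M Z : ℕ} {p : Problem} {I : Instance p RegLenConstraint} {r : Bool} {s : St} (hB : Big M Z)
    (hr : r = false → ∀ c ∈ I.gc, c = withDFA I.σ c.len)
    (hM : (I.encode (encodeGap r)).length + I.σ + 16 = M) (hI : StoredAt (s.arr .inp) 0 (I.encode (encodeGap r)))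
    (hend : ∀ x, (I.encode (encodeGap r)).length ≤ x → s.arr .inp x = 0) (hP : Parsed I s)
    (hw : s.var .w = (I.encode (encodeGap r)).length) (hg : I.gc.length ≤ M) :
    wp Z (setup r) (fun s' t => t ≤ 15 * I.gc.length + 15 ∧ Parsed I s' ∧
      (∀ h < 2, s'.arr .wlen h = (strings p I.words h).length ∧ s'.arr .wbase h = base p I.words h) ∧
      StoredAt (s'.arr .inp) 0 (I.encode (encodeGap r)) ∧
      ∀ i (h : i < I.gc.length), GapAt M I.gc[i] i s') s 0 := by
  have hl := hB.lin
  have hM16 := hB.le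
  have main : ∀ (s1 : St) (t1 : ℕ), t1 ≤ 2 → Frame (.store .inp Var.w 1) s s1 →
      StoredAt (s1.arr .inp) 0 (I.encode (encodeGap r)) →
      (r = false → s1.arr .inp (I.encode (encodeGap r)).length = 1 ∧
        ∀ x, (I.encode (encodeGap r)).length < x → s1.arr .inp x = 0) →
      wp Z (.store .wbase 0 Var.b0 ;; .store .wbase 1 Var.b1 ;; .store .wlen 0 Var.n0 ;; .store .wlen 1 Var.n1 ;;
        .ptr ::= Var.p ;; .for .i .g (.store .lop Var.i Var.ptr ;; skipBound ;; .store .hip Var.i Var.ptr ;;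
        skipBound ;; enterDFA r)) (fun s' t => t ≤ 15 * I.gc.length + 15 ∧ Parsed I s' ∧
      (∀ h < 2, s'.arr .wlen h = (strings p I.words h).length ∧ s'.arr .wbase h = base p I.words h) ∧
      StoredAt (s'.arr .inp) 0 (I.encode (encodeGap r)) ∧
      ∀ i (h : i < I.gc.length), GapAt M I.gc[i] i s') s1 t1 := by
    intro s1 t1 ht1 hf1 hI1 hend1
    have hP1 := hP.frame hf1 rfl
    have hw1 : s1.var .w = (I.encode (encodeGap r)).length := by rw [hf1.var _ rfl, hw]
    simp only [wp_seq, wp_store, wp_assign, Expr.ok_zero, Expr.ok_one, Expr.ok_var, Expr.eval_zero, Expr.eval_one,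
      Expr.eval_var, St.put_var, hP1.b0_eq, hP1.b1_eq, hP1.n0_eq, hP1.n1_eq, hP1.p_eq, true_and]
    refine ⟨by omega, by omega, by omega, by omega, ?_⟩
    generalize hs2 : ((((s1.put .wbase 0 _).put .wbase 1 _).put .wlen 0 _).put .wlen 1 _).set .ptr _ = s2
    have hf2 : Frame (.store .wbase 0 0 ;; .store .wlen 0 0 ;; .ptr ::= 0) s1 s2 := by
      subst hs2
      refine ⟨fun y hy => ?_, fun d hd => ?_⟩
      · have : y ≠ .ptr := by rintro rfl; simp [Cmd.wr] at hy
        simp [this]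
      · have h1 : d ≠ .wbase := by rintro rfl; simp [Cmd.awr] at hd
        have h2 : d ≠ .wlen := by rintro rfl; simp [Cmd.awr] at hd
        rw [St.set_arr, St.put_arr_ne _ _ _ _ _ h2, St.put_arr_ne _ _ _ _ _ h2, St.put_arr_ne _ _ _ _ _ h1,
          St.put_arr_ne _ _ _ _ _ h1]
    have hP2 := hP1.frame hf2 rfl
    have hwl2 : ∀ h < 2, s2.arr .wlen h = (strings p I.words h).length ∧ s2.arr .wbase h = base p I.words h := by
      intro h hh
      have : h = 0 ∨ h = 1 := by omega
      rcases this with rfl | rfl <;> subst hs2 <;> simp [St.put_arr]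
    have hptr2 : s2.var .ptr = gapBase I := by subst hs2; simp
    have hw2 : s2.var .w = (I.encode (encodeGap r)).length := by rw [hf2.var _ rfl, hw1]
    have hinp2 : s2.arr .inp = s1.arr .inp := hf2.arr _ rfl
    clear hs2
    refine wp_for_const I.gc.length (fun k s' => s'.var .ptr = gapPos I r k ∧
      ∀ i (h : i < I.gc.length), i < k → Entered I r i h s') 12 hP2.g_eq (by simp) (by cases r <;> rfl)
      (by cases r <;> rfl) (by omega) ⟨by simp [hptr2, gapPos], by simp⟩ ?_ ?_
    · rintro i hi s3 hf3 hi3 ⟨hptr3, hI3⟩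
      have hP3 := hP2.frame hf3 (by cases r <;> rfl)
      have hinp3 : s3.arr .inp = s1.arr .inp := by rw [hf3.arr _ (by cases r <;> rfl), hinp2]
      have hw3 : s3.var .w = (I.encode (encodeGap r)).length := by rw [hf3.var _ (by cases r <;> rfl), hw2]
      obtain ⟨h1, h2, h3⟩ := storedAt_gap hI1 hi
      have hs := gapPos_succ I r hi
      have hle := gapPos_le I r (i + 1)
      simp only [wp_seq, wp_store, Expr.ok_var, Expr.eval_var, hi3, hptr3, true_and]
      refine wp_call (skipBound_spec (P := gapPos I r i) hB I.gc[i].len.lo (by rw [St.put_var]; exact hptr3) (by omega)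
        (by rw [St.put_arr_ne _ _ _ _ _ (by simp), hinp3]; exact h1)) ?_
      intro s4 t4 hf4 ht4 hp4
      have hi4 : s4.var .i = i := by rw [hf4.var _ rfl, St.put_var, hi3]
      have hinp4 : s4.arr .inp = s1.arr .inp := by
        rw [hf4.arr _ rfl, St.put_arr_ne _ _ _ _ _ (by simp), hinp3]
      simp only [hi4, hp4]
      refine wp_call (skipBound_spec (P := gapPos I r i + (encodeBound I.gc[i].len.lo).length) hB I.gc[i].len.hi (by rw [St.put_var]; exact hp4) (by omega)
        (by rw [St.put_arr_ne _ _ _ _ _ (by simp), hinp4]; exact h2)) ?_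
      intro s5 t5 hf5 ht5 hp5
      have hi5 : s5.var .i = i := by rw [hf5.var _ rfl, St.put_var, hi4]
      refine wp_call (enterDFA_spec (n := (I.encode (encodeGap r)).length) hB r I.gc[i]
        (fun h => hr h _ (List.getElem_mem hi))
        (by rw [hf5.var _ rfl, St.put_var, hf4.var _ rfl, St.put_var, hP3.sig_eq]) hp5 hi5
        (by rw [hf5.var _ rfl, St.put_var, hf4.var _ rfl, St.put_var, hw3]) (by omega)
        (by rw [hf5.arr _ rfl, St.put_arr_ne _ _ _ _ _ (by simp), hinp4]; exact h3)) ?_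
      rintro s6 t6 hf6 ht6 ⟨hp6, hqq, hst, hac⟩
      have hlop : s6.arr .lop = Function.update (s3.arr .lop) i (gapPos I r i) := by
        rw [hf6.arr _ (by cases r <;> rfl), hf5.arr _ rfl, St.put_arr_ne _ _ _ _ _ (by simp), hf4.arr _ rfl,
          St.put_arr_self]
      have hhip : s6.arr .hip = Function.update (s3.arr .hip) i
          (gapPos I r i + (encodeBound I.gc[i].len.lo).length) := by
        rw [hf6.arr _ (by cases r <;> rfl), hf5.arr _ rfl, St.put_arr_self, hf4.arr _ rfl,
          St.put_arr_ne _ _ _ _ _ (by simp)]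
      rw [hf5.arr _ rfl, St.put_arr_ne _ _ _ _ _ (by simp), hf4.arr _ rfl, St.put_arr_ne _ _ _ _ _ (by simp)] at hqq
      rw [hf5.arr _ rfl, St.put_arr_ne _ _ _ _ _ (by simp), hf4.arr _ rfl, St.put_arr_ne _ _ _ _ _ (by simp)] at hst
      rw [hf5.arr _ rfl, St.put_arr_ne _ _ _ _ _ (by simp), hf4.arr _ rfl, St.put_arr_ne _ _ _ _ _ (by simp)] at hac
      refine ⟨by omega, by simp [hp6, hs], fun k hk hki => ?_⟩
      unfold Entered
      rw [St.set_arr, hlop, hhip, hqq, hst, hac]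
      by_cases h : k = i
      · subst h
        simp
      · simp only [Function.update_of_ne h]
        exact hI3 k hk (by omega)
    · rintro s3 t3 hf3 - ⟨-, hI3⟩ ht3
      have hinp3 : s3.arr .inp = s1.arr .inp := by rw [hf3.arr _ (by cases r <;> rfl), hinp2]
      refine ⟨by omega, hP2.frame hf3 (by cases r <;> rfl), ?_, by rwa [hinp3], fun i hi => ?_⟩
      · rw [hf3.arr .wlen (by cases r <;> rfl), hf3.arr .wbase (by cases r <;> rfl)]
        exact hwl2
      · exact (hI3 i hi hi).gapAt hr hM (by rwa [hinp3]) (by rwa [hinp3])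
  unfold setup
  rw [wp_seq]
  have h2 : r.toNat < Z := (Bool.toNat_le r).trans_lt (by omega)
  simp only [wp_ite, wp_skip, wp_store, Expr.ok_lit, Expr.eval_lit, Expr.ok_var, Expr.ok_one, Expr.eval_var,
    Expr.eval_one, hw, true_and]
  refine ⟨h2, fun h => main _ _ (by omega) (Frame.refl _ _) hI (fun h' => absurd (by rw [h']; rfl) h),
    fun h => ⟨by omega, main _ _ (by omega) ⟨fun _ _ => rfl, fun d hd => St.put_arr_ne _ _ _ _ _ (by
      rintro rfl; simp [Cmd.awr] at hd)⟩ ?_ (fun _ => ⟨?_, fun x hx => ?_⟩)⟩⟩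
  · rw [St.put_arr_self]
    intro i hi
    rw [Function.update_of_ne (by omega)]
    exact hI i hi
  · rw [St.put_arr_self, Function.update_self]
  · rw [St.put_arr_self, Function.update_of_ne (by omega)]
    exact hend x (by omega)

theorem sum_getD {β : Type} (l : List β) (f : β → ℕ) :
    ∑ i ∈ Finset.range l.length, ((l[i]?.map f).getD 0 + 2) = (l.map f).sum + 2 * l.length := by
  induction l with
  | nil => rfl
  | cons a l ih =>
    rw [List.length_cons, Finset.sum_range_succ', List.map_cons, List.sum_cons]
    simp only [List.getElem?_cons_succ, List.getElem?_cons_zero, ih, Option.map_some, Option.getD_some]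
    omega

/-- The time for `main`. -/
noncomputable def mainCost {p : Problem} (I : Instance p RegLenConstraint) : ℕ :=
  (I.gc.map (gapCost I.ell)).sum +
    (if I.σ = 1 then (I.gc.map (unaryCost I.ell)).sum else 6 * I.ell + I.σ * dfsCost I.ell I.gc) +
    20 * I.gc.length + 60

theorem main_spec {M Z : ℕ} {p : Problem} {I : Instance p RegLenConstraint} {r : Bool} {s : St} (hB : Big M Z)
    (hr : r = false → ∀ c ∈ I.gc, c = withDFA I.σ c.len)
    (hM : (I.encode (encodeGap r)).length + I.σ + 16 = M) (hI : StoredAt (s.arr .inp) 0 (I.encode (encodeGap r)))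
    (hend : ∀ x, (I.encode (encodeGap r)).length ≤ x → s.arr .inp x = 0) (hP : Parsed I s)
    (hw : s.var .w = (I.encode (encodeGap r)).length) (hg : I.gc.length < I.ell) :
    wp Z (main p r) (fun s' t => t ≤ mainCost I ∧
      (I.IsYes RegLenConstraint.lang ∧ s'.var .res = 1 ∨ ¬ I.IsYes RegLenConstraint.lang ∧ s'.var .res = 0)) s 0 := by
  have hl := hB.lin
  have hM16 := hB.le
  have hlen := length_encode I r
  have hellM : I.ell + 1 ≤ M := by
    have h0 := (storedAt_encodeWords p I.words (storedAt_encode hI).2.1 0).2.2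
    have h1 := (storedAt_encodeWords p I.words (storedAt_encode hI).2.1 1).2.2
    have := ell_eq_max I
    unfold gapBase at hlen
    omega
  unfold main
  rw [wp_seq]
  refine wp_call (setup_spec hB hr hM hI hend hP hw (by omega)) ?_
  rintro s1 t1 hf1 ht1 ⟨hP1, hwl1, hI1, hG1⟩
  rw [wp_seq]
  refine wp_call (classify_spec hB hP1.sig_eq hP1.ell_eq (by omega) hP1.g_eq (by omega) hG1) ?_
  rintro s2 t2 hf2 ht2 hinfo
  rw [sum_getD] at ht2
  have hP2 := hP1.frame hf2 rfl
  have hE : Env M I.ell I.gc (strings p I.words) s2 := by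
    have hinp : s2.arr .inp = s1.arr .inp := hf2.arr _ rfl
    have hwl : s2.arr .wlen = s1.arr .wlen := hf2.arr _ rfl
    have hwb : s2.arr .wbase = s1.arr .wbase := hf2.arr _ rfl
    have hw1 := fun h => storedAt_encodeWords p I.words (storedAt_encode hI1).2.1 h
    refine ⟨hP2.sig_eq, hP2.g_eq, hP2.ell_eq, by omega, hellM, by omega, fun h hh => ?_, ell_eq I, fun h hh j hj => ?_,
      fun h hh => ?_, fun i hi => (hG1 i hi).frame hf2 rfl, hinfo⟩
    · rw [hwl, (hwl1 h hh).1]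
    · rw [hinp, hwb, (hwl1 h hh).2]
      exact (hw1 h).2.1 j hj
    · rw [hwb, (hwl1 h hh).2]
      have := (hw1 h).2.2
      unfold gapBase at hlen
      omega
  have fin : ∀ (s3 : St) (t3 : ℕ), t3 + 2 ≤ mainCost I →
      (s3.var .res ≠ 0 ↔ GoodFrom p (strings p I.words) I.gc (fun _ _ => True) 0) →
      wp Z (.ite Var.res (.res ::= 1) .skip) (fun s' t => t ≤ mainCost I ∧
        (I.IsYes RegLenConstraint.lang ∧ s'.var .res = 1 ∨ ¬ I.IsYes RegLenConstraint.lang ∧ s'.var .res = 0)) s3 t3 := by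
    intro s3 t3 ht3 hres
    rw [← isYes_iff] at hres
    simp only [wp_ite, wp_assign, wp_skip, Expr.ok_var, Expr.ok_one, Expr.eval_var, Expr.eval_one, St.set_var,
      if_true, true_and]
    refine ⟨fun h => ⟨by omega, by omega, Or.inl ⟨hres.1 h, trivial⟩⟩, fun h => ⟨by omega, Or.inr ⟨fun hy => hres.2 hy h, h⟩⟩⟩
  rw [wp_seq, wp_ite]
  simp only [Expr.ok_eqq, Expr.ok_var, Expr.ok_one, Expr.eval_eqq, Expr.eval_var, Expr.eval_one, hE.sig_eq,
    true_and]
  refine ⟨by omega, fun h => ?_, fun h => ?_⟩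
  · have h := of_ite_ne h
    have hc : mainCost I = (I.gc.map (gapCost I.ell)).sum + (I.gc.map (unaryCost I.ell)).sum +
      20 * I.gc.length + 60 := by rw [mainCost, if_pos h]
    clear hr hM hI hend hP hw hlen hP1 hwl1 hI1 hG1 hinfo hP2
    refine wp_call (T := (I.gc.map (unaryCost I.ell)).sum + 2 * I.gc.length + 20)
      (R := fun s' => s'.var .res ≠ 0 ↔ GoodFrom p (strings p I.words) I.gc (fun _ _ => True) 0) ?_ ?_
    -- The instance is taken apart so that 1 can be substituted for its alphabet size in the types.
    · obtain ⟨σ, hσ, w, gc⟩ := I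
      obtain rfl : σ = 1 := h
      have := unary_spec p hB hE
      rw [sum_getD] at this
      exact this
    · intro s3 t3 _ ht3 hres
      exact fin s3 t3 (by omega) hres
  · have h := of_ite_eq h
    have hc : mainCost I = (I.gc.map (gapCost I.ell)).sum + (6 * I.ell + I.σ * dfsCost I.ell I.gc) +
      20 * I.gc.length + 60 := by rw [mainCost, if_neg h]
    refine wp_call (dfs_spec p hB hE (by omega)) ?_
    intro s3 t3 _ ht3 hres
    exact fin s3 t3 (by omega) hres

/-! ### Time bounds -/

open Classical in
/-- The contribution of a constraint to `states`. -/
noncomputable def ownStates {σ : ℕ} (c : RegLenConstraint σ) : ℕ := if c.lang σ = {[]} then 0 else c.numStates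

theorem states_eq {σ : ℕ} (gc : List (RegLenConstraint σ)) : states gc = (gc.map ownStates).sum := by
  unfold states nonZeroGaps
  induction gc with
  | nil => rfl
  | cons c gc ih =>
    rw [List.filter_cons, List.map_cons, List.sum_cons, ← ih]
    by_cases h : c.lang σ = {[]}
    · simp [h, ownStates]
    · simp [h, ownStates]

theorem numStates_pos {σ : ℕ} (c : RegLenConstraint σ) : 1 ≤ c.numStates := Nat.zero_lt_of_lt c.dfa.start.2

theorem weight_le {σ : ℕ} (c : RegLenConstraint σ) : weight c ≤ 1 + ownStates c := by
  unfold weight ownStates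
  split <;> omega

/-- An automaton has at least one state, so the cost of `O(ell)` per constraint other than `{ε}` is
charged to its states. -/
theorem sum_gapCost_le {σ : ℕ} (ell : ℕ) (gc : List (RegLenConstraint σ)) :
    (gc.map (gapCost ell)).sum ≤ 80 * size gc + 18 * (ell + 1) * states gc := by
  rw [states_eq]
  unfold size
  induction gc with
  | nil => simp
  | cons c gc ih =>
    simp only [List.map_cons, List.sum_cons, Nat.mul_add]
    have : gapCost ell c ≤ 80 * (c.numStates * (σ + 1)) + 18 * (ell + 1) * ownStates c := by
      unfold gapCost ownStates
      split
      · simp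
      · have := Nat.mul_le_mul_left (18 * (ell + 1)) (numStates_pos c)
        omega
    simp only [Nat.mul_add] at this ih
    omega

theorem sum_unaryCost_le {σ : ℕ} (ell : ℕ) (gc : List (RegLenConstraint σ)) :
    (gc.map (unaryCost ell)).sum ≤ 2 * gc.length + 30 * (ell + 1) * states gc := by
  rw [states_eq]
  induction gc with
  | nil => simp
  | cons c gc ih =>
    simp only [List.map_cons, List.sum_cons, Nat.mul_add, List.length_cons]
    have : unaryCost ell c ≤ 2 + 30 * (ell + 1) * ownStates c := by
      unfold unaryCost ownStates
      split
      · simp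
      · have := Nat.mul_le_mul_left (30 * (ell + 1)) (numStates_pos c)
        omega
    simp only [Nat.mul_add] at this ih
    omega

/-- A geometric sum. The term `E = 400 * (ell + 1) + 20` on the left makes the induction work: a
level costs at most `E` plus the part charged to states, and the `2 * E` needed in the step are
covered by `σ * E` from the level below. This is where `σ ≥ 2` enters. -/
theorem dfsCost_le {σ : ℕ} (hσ : 2 ≤ σ) (ell : ℕ) (gc : List (RegLenConstraint σ)) :
    dfsCost ell gc + (400 * (ell + 1) + 20) ≤
      σ ^ gc.length * (400 * (ell + 1) * states gc + 480 * (ell + 1)) := by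
  rw [states_eq]
  induction gc with
  | nil => simp [dfsCost]; omega
  | cons c gc ih =>
    simp only [dfsCost, List.map_cons, List.sum_cons, List.length_cons]
    have hw : 400 * ((ell + 1) * weight c) ≤ 400 * (ell + 1) + 400 * (ell + 1) * ownStates c := by
      have := Nat.mul_le_mul_left (400 * (ell + 1)) (weight_le c)
      rw [← Nat.mul_assoc]
      calc _ ≤ _ := this
        _ = _ := by ring
    generalize (gc.map ownStates).sum = S at *
    generalize dfsCost ell gc = F at *
    generalize ownStates c = o at *
    have h1 := Nat.mul_le_mul_left σ ih
    have h2 : 2 * (400 * (ell + 1) + 20) ≤ σ * (400 * (ell + 1) + 20) := Nat.mul_le_mul_right _ hσ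
    have h3 : 400 * (ell + 1) * o ≤ σ ^ (gc.length + 1) * (400 * (ell + 1) * o) :=
      Nat.le_mul_of_pos_left _ (Nat.pow_pos (by omega))
    have h4 : σ ^ (gc.length + 1) * (400 * (ell + 1) * (o + S) + 480 * (ell + 1)) =
        σ ^ (gc.length + 1) * (400 * (ell + 1) * o) +
          σ * (σ ^ gc.length * (400 * (ell + 1) * S + 480 * (ell + 1))) := by ring
    rw [h4]
    rw [Nat.mul_add σ F] at h1
    generalize σ ^ (gc.length + 1) * (400 * (ell + 1) * o) = A at h3 ⊢
    generalize σ * (σ ^ gc.length * (400 * (ell + 1) * S + 480 * (ell + 1))) = B at h1 ⊢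
    generalize 400 * (ell + 1) * o = c at hw h3
    generalize 400 * (ell + 1) = e at hw h1 h2 ⊢
    clear ih h4
    generalize σ * (e + 20) = D at h1 h2
    omega

theorem mainCost_le {p : Problem} (I : Instance p RegLenConstraint) (hg : I.gc.length < I.ell) :
    mainCost I ≤ 2500 * (I.σ ^ I.k * max 1 (states I.gc) * max 1 I.ell + size I.gc) := by
  have hσ := I.σ_pos
  have hell : max 1 I.ell = I.ell := max_eq_right (by omega)
  have h1 := sum_gapCost_le I.ell I.gc
  have h2 := sum_unaryCost_le I.ell I.gc
  have hS : states I.gc ≤ max 1 (states I.gc) := le_max_right _ _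
  have hS1 : 1 ≤ max 1 (states I.gc) := le_max_left _ _
  rw [hell]
  have hk : I.k = I.gc.length + 1 := rfl
  have hp : 1 ≤ I.σ ^ I.k := Nat.pow_pos hσ
  have hSl : (I.ell + 1) * states I.gc ≤ 2 * (max 1 (states I.gc) * I.ell) := by
    calc (I.ell + 1) * states I.gc ≤ (2 * I.ell) * max 1 (states I.gc) := Nat.mul_le_mul (by omega) hS
      _ = _ := by ring
  have hY : I.ell ≤ max 1 (states I.gc) * I.ell := Nat.le_mul_of_pos_left _ hS1
  have hX : max 1 (states I.gc) * I.ell ≤ I.σ ^ I.k * max 1 (states I.gc) * I.ell := by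
    rw [Nat.mul_assoc]
    exact Nat.le_mul_of_pos_left _ hp
  unfold mainCost
  rw [Nat.mul_assoc] at h1 h2
  by_cases hs : I.σ = 1
  · rw [if_pos hs]
    omega
  · rw [if_neg hs]
    -- Since `ell + 1 ≤ 2 * ell`, the two terms are at most 800 and 960 times the product.
    have h5 : 400 * ((I.ell + 1) * states I.gc) + 480 * (I.ell + 1) ≤ 1760 * (max 1 (states I.gc) * I.ell) := by omega
    have h3 := dfsCost_le (show 2 ≤ I.σ by omega) I.ell I.gc
    have h4 : I.σ * dfsCost I.ell I.gc ≤ 1760 * (I.σ ^ I.k * max 1 (states I.gc) * I.ell) := by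
      calc I.σ * dfsCost I.ell I.gc ≤
          I.σ * (I.σ ^ I.gc.length * (400 * (I.ell + 1) * states I.gc + 480 * (I.ell + 1))) :=
            Nat.mul_le_mul_left _ ((Nat.le_add_right _ _).trans h3)
        _ = I.σ ^ I.k * (400 * ((I.ell + 1) * states I.gc) + 480 * (I.ell + 1)) := by rw [hk]; ring
        _ ≤ I.σ ^ I.k * (1760 * (max 1 (states I.gc) * I.ell)) := Nat.mul_le_mul_left _ h5
        _ = _ := by ring
    clear h3
    omega

/-! ### The program -/

open RAM in
/-- Compute the distance of the arrays. -/
def setStride : Prog := .seq (.op .mul 1 Var.big.reg Var.big.reg) (.op .mul 1 1 Var.big.reg)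

open RAM in
/-- The complete program. -/
def program (p : Problem) (r : Bool) : Prog :=
  .seq (header p).comp (.seq
    (.ite Var.act.reg (.seq (findEnd r).comp (.seq setStride (main p r).comp))
      (Var.res ::= .lit (trivialAnswer p)).comp)
    (.op .land 0 Var.res.reg Var.res.reg))

theorem far_header (p : Problem) : (header p).far = false := by cases p <;> rfl

theorem far_findEnd (r : Bool) : (findEnd r).far = false := by cases r <;> rfl

theorem getD_encode {l : List ℕ} : StoredAt (fun i => l.getD i 0) 0 l := by
  intro i hi
  simp [hi]

theorem le_foldr_max {l : List ℕ} {x : ℕ} (h : x ∈ l) : x ≤ l.foldr max 0 := by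
  induction l with
  | nil => simp at h
  | cons a l ih =>
    rw [List.foldr_cons]
    rcases List.mem_cons.1 h with rfl | h
    · exact le_max_left _ _
    · exact (ih h).trans (le_max_right _ _)

/-- A bound for the running time of the program. -/
noncomputable def runTime {p : Problem} (I : Instance p RegLenConstraint) : ℕ :=
  if I.gc.length < I.ell then I.σ ^ I.k * max 1 (states I.gc) * max 1 I.ell + size I.gc else 1

/-- One program for each problem and input format. The array-free parts run first, then the distance
of the arrays is put into register 1, and only then is the main part executed. -/
theorem program_spec (p : Problem) (r : Bool) : ∃ K : ℕ, ∀ I : Instance p RegLenConstraint,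
    (r = false → ∀ c ∈ I.gc, c = withDFA I.σ c.len) →
    ∃ (t : ℕ) (s : RAM.State), RAM.Exec (RAM.wordBits 9 (I.encode (encodeGap r))) (program p r)
      (RAM.startState (I.encode (encodeGap r))) t s ∧ t ≤ K * runTime I ∧
        (I.IsYes RegLenConstraint.lang ∧ s.reg 0 = 1 ∨ ¬ I.IsYes RegLenConstraint.lang ∧ s.reg 0 = 0) := by
  -- Each part contributes its step bound times the slowdown of the compilation; 13 comes from `8 *
  -- g + 5`, and 2500 from `mainCost_le`.
  refine ⟨(header p).slow * 14 + (findEnd r).slow * 13 + (main p r).slow * 2500 + 10, fun I hr => ?_⟩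
  set l := I.encode (encodeGap r) with hl
  obtain ⟨M, hM⟩ : ∃ M, l.length + I.σ + 16 = M := ⟨_, rfl⟩
  set b := RAM.wordBits 9 l with hb
  -- The tables have a size of order `M * M`; since `16 ≤ M`, the cube exceeds all indices and
  -- values that occur.
  set Z := M * M * M with hZ
  have hlen := length_encode I r
  have hsmall := small_encode I r
  rw [← hl] at hlen hsmall
  have hMM : 16 * (M * M) ≤ Z := by rw [hZ, Nat.mul_comm (M * M)]; exact Nat.mul_le_mul_right _ (by omega)
  have hB : Big M Z := ⟨by omega, hMM⟩
  have hlin := hB.lin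
  have hσ := I.σ_pos
  have hglen : I.gc.length ≤ l.length := by
    have := length_le_flatMap I.gc (encodeGap r I.σ) fun c _ => length_encodeGap_pos r I.σ c
    omega
  have hlen3 : 3 ≤ l.length := by
    have h0 := (storedAt_encodeWords p I.words (storedAt_encode (getD_encode (l := l))).2.1 0).2.2
    have : 2 ≤ base p I.words 0 := by cases p <;> simp [base]
    unfold gapBase at hlen
    omega
  -- With `y` the power of two just above `N`, the input gives `y ≥ 5` and `M ≤ y + 15 ≤ y ^ 2`. So
  -- `64 * M ^ 3 ≤ y ^ 3 * y ^ 6`, whence the factor 9 in the word size.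
  have hbit : 64 * Z ≤ 2 ^ b := by
    have hmax : I.σ ≤ l.foldr max 0 := le_foldr_max (by rw [hl]; simp [Instance.encode])
    have hN := Nat.lt_size_self (l.length + l.foldr max 0)
    have hb' : 2 ^ b = (2 ^ (l.length + l.foldr max 0).size) ^ 9 := by
      rw [hb, RAM.wordBits, Nat.mul_comm, Nat.pow_mul]
    rw [hb']
    generalize 2 ^ (l.length + l.foldr max 0).size = y at *
    have hy : 5 ≤ y := by omega
    have hMy : M ≤ y * y := by
      have := Nat.mul_le_mul_right y hy
      omega
    calc 64 * Z ≤ (5 * 5 * 5) * (M * M * M) := by rw [hZ]; exact Nat.mul_le_mul_right _ (by omega)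
      _ ≤ (y * y * y) * ((y * y) * (y * y) * (y * y)) := by gcongr
      _ = y ^ 9 := by ring
  -- The input is shorter than `Z`, so all arrays other than `inp` lie in cells that contain 0.
  have hrel : Rel Z (RAM.startState l) ⟨fun _ => 0, fun c i => if c = .inp then l.getD i 0 else 0⟩ := by
    refine ⟨fun _ => rfl, fun _ => by show 0 < Z; omega, fun c i hi => ?_, fun c i hi => ?_⟩
    · show l.getD (c.idx * Z + i) 0 = _
      by_cases hc : c = .inp
      · subst hc; simp [Arr.idx]
      · have : c.idx ≠ 0 := fun h => hc (Arr.idx_inj (y := .inp) h)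
        have : 1 * Z ≤ c.idx * Z := Nat.mul_le_mul_right _ (by omega)
        rw [List.getD_eq_default _ _ (by omega)]
        exact (if_neg hc).symm
    · show (if c = .inp then l.getD i 0 else 0) < Z
      split
      · by_cases h : i < l.length
        · have := hsmall l[i] (List.getElem_mem h)
          rw [List.getD_eq_getElem _ _ h]
          omega
        · rw [List.getD_eq_default _ _ (by omega)]; omega
      · omega
  obtain ⟨u1, s1, run1, hu1, hP1, hact⟩ := header_spec (r := r) (I := I) hB
    (show l.length ≤ M by omega)
    (s := ⟨fun _ => 0, fun c i => if c = .inp then l.getD i 0 else 0⟩) (by simpa using getD_encode)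
  have harr1 : s1.arr = fun c i => if c = .inp then l.getD i 0 else 0 := by
    funext d; exact run1.frame.arr d (by cases p <;> rfl)
  obtain ⟨t1, r1, e1, ht1, hr1, -⟩ := exec_cmd (by omega) hbit run1 _ hrel (by simp [far_header])
  have ht1 : t1 ≤ (header p).slow * 14 := ht1.trans (Nat.mul_le_mul_left _ (by omega))
  have out : ∀ (r3 : RAM.State) (s3 : St), Rel Z r3 s3 → ∃ r4,
      RAM.Exec b (.op .land 0 Var.res.reg Var.res.reg) r3 1 r4 ∧ r4.reg 0 = s3.var .res := by
    intro r3 s3 h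
    refine ⟨_, .op _ _ _ _ _, ?_⟩
    have := h.var_lt .res
    simp only [setReg_reg, if_true, RAM.Op.eval, Nat.and_self, h.var_eq]
    exact Nat.mod_eq_of_lt (by omega)
  by_cases hg : I.gc.length < I.ell
  · obtain ⟨u2, s2, run2, hu2, hP2, hw2, hbig2, harr2⟩ := findEnd_spec (r := r) hB hM
      (by rw [harr1]; simpa using getD_encode) hP1 (by omega)
    obtain ⟨t2, r2, e2, ht2, hr2, -⟩ := exec_cmd (by omega) hbit run2 _ hr1 (by simp [far_findEnd])
    have hbr : r2.reg Var.big.reg = M := by rw [hr2.var_eq, hbig2]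
    obtain ⟨r3, e3, hz3, hr3⟩ : ∃ r3, RAM.Exec b setStride r2 2 r3 ∧ r3.reg 1 = Z ∧ Rel Z r3 s2 := by
      refine ⟨_, .seq (t := 1) (t' := 1) (.op _ _ _ _ _) (.op _ _ _ _ _), ?_, ?_, hr2.var_lt, hr2.mem_eq, hr2.arr_lt⟩
      · have h1 : Var.big.reg ≠ 1 := by decide
        simp only [setReg_reg, if_true, h1, if_false, RAM.Op.eval, hbr]
        rw [Nat.mod_eq_of_lt (a := M * M) (by omega), Nat.mod_eq_of_lt (by omega)]
      · intro x
        have h1 : x.reg ≠ 1 := by unfold Var.reg; omega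
        simp only [setReg_reg, h1, if_false, hr2.var_eq]
    obtain ⟨u4, s4, run4, hu4, hres⟩ := main_spec (r := r) hB hr hM (by rw [harr2, harr1]; simpa using getD_encode)
      (fun x hx => by rw [harr2, harr1]; simpa using List.getD_eq_default _ _ hx) hP2 hw2 hg
    obtain ⟨t4, r4, e4, ht4, hr4, -⟩ := exec_cmd (by omega) hbit run4 _ hr3 (fun _ => hz3)
    obtain ⟨r5, e5, hr5⟩ := out _ _ hr4
    refine ⟨_, r5, .seq e1 (.seq (.ite_true (by rw [hr1.var_eq]; exact hact.2 hg) (.seq e2 (.seq e3 e4))) e5), ?_, ?_⟩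
    · have hc := mainCost_le I hg
      have hrt : runTime I = I.σ ^ I.k * max 1 (states I.gc) * max 1 I.ell + size I.gc := if_pos hg
      rw [← hrt] at hc
      -- Since `g < ell`, this pays for the passes over the list of constraints.
      have hge : I.ell ≤ runTime I := by
        rw [hrt, Nat.mul_assoc]
        have h1 : 1 * (1 * I.ell) ≤ I.σ ^ I.k * (max 1 (states I.gc) * max 1 I.ell) :=
          Nat.mul_le_mul (Nat.pow_pos hσ) (Nat.mul_le_mul (le_max_left _ _) (le_max_right _ _))
        omega
      have h1 : (header p).slow * 14 ≤ (header p).slow * 14 * runTime I := Nat.le_mul_of_pos_right _ (by omega)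
      have h2 : t2 ≤ (findEnd r).slow * 13 * runTime I := by
        rw [Nat.mul_assoc]
        exact ht2.trans (Nat.mul_le_mul_left _ (by omega))
      have h4 : t4 ≤ (main p r).slow * 2500 * runTime I := by
        rw [Nat.mul_assoc]
        exact ht4.trans (Nat.mul_le_mul_left _ (by omega))
      simp only [Nat.add_mul]
      omega
    · rw [hr5]; exact hres
  · obtain ⟨t2, r2, e2, ht2, hr2, -⟩ := exec_cmd (by omega) hbit
      (Run.assign (x := .res) (e := .lit (trivialAnswer p)) (s := s1)
        (show trivialAnswer p < Z by cases p <;> simp [trivialAnswer] <;> omega)) _ hr1 (by simp [Cmd.far, Expr.far])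
    obtain ⟨r5, e5, hr5⟩ := out _ _ hr2
    refine ⟨_, r5, .seq e1 (.seq (.ite_false (by
      rw [hr1.var_eq]
      by_contra h
      exact hg (hact.1 h)) e2) e5), ?_, ?_⟩
    · have hrt : runTime I = 1 := if_neg hg
      rw [hrt]
      have : t2 ≤ 2 := ht2
      omega
    · rw [hr5]
      simpa using isYes_of_short I (by omega)

/-! ### Length constraints -/

/-- Add automata to an instance with length constraints. -/
def addDFAs {p : Problem} (J : Instance p fun _ => LenConstraint) : Instance p RegLenConstraint :=
  ⟨J.σ, J.σ_pos, J.words, J.gc.map (withDFA J.σ)⟩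

section
variable {p : Problem} (J : Instance p fun _ => LenConstraint)

/-- With the flag `false` the automata are not part of the encoding, so the machine receives the
original input. -/
theorem encode_addDFAs : (addDFAs J).encode (encodeGap false) = J.encode LenConstraint.encode := by
  unfold Instance.encode addDFAs
  simp only [List.length_map, List.flatMap_map, encodeGap, Bool.false_eq_true, if_false, List.append_nil]
  rfl

theorem isYes_addDFAs : (addDFAs J).IsYes RegLenConstraint.lang ↔ J.IsYes LenConstraint.lang := by
  unfold Instance.IsYes addDFAs
  simp only [List.map_map]
  have : RegLenConstraint.lang J.σ ∘ withDFA J.σ = LenConstraint.lang J.σ := by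
    funext l
    exact withDFA_lang J.σ l
  rw [this]

/-- Each added automaton has one state and does not change the language. -/
theorem states_addDFAs : states (addDFAs J).gc = nz LenConstraint.lang (σ := J.σ) J.gc := by
  rw [states_eq]
  show ((J.gc.map (withDFA J.σ)).map ownStates).sum = _
  unfold nz nonZeroGaps
  rw [List.map_map]
  generalize J.gc = gc
  induction gc with
  | nil => rfl
  | cons c gc ih =>
    rw [List.filter_cons, List.map_cons, List.sum_cons, ih]
    by_cases h : c.lang J.σ = {[]}
    · simp [h, ownStates, withDFA_lang]
    · rw [if_pos (by simp [h]), List.length_cons, Nat.add_comm]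
      congr 1
      show ownStates (withDFA J.σ c) = 1
      rw [ownStates, if_neg (by rwa [withDFA_lang])]
      rfl

/-- The virtual automata have size `σ + 1 ≤ 2 * σ ^ k` each, and there are fewer than `ell` of them;
so the additional term disappears in the main one. -/
theorem size_addDFAs_le (h : J.gc.length < J.ell) : size (addDFAs J).gc ≤ 2 * (J.σ ^ J.k * J.ell) := by
  have hsize : size (addDFAs J).gc = J.gc.length * (J.σ + 1) := by
    show ((J.gc.map (withDFA J.σ)).map fun c => c.numStates * (J.σ + 1)).sum = _
    rw [List.map_map]
    generalize J.gc = gc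
    induction gc with
    | nil => simp
    | cons c gc ih =>
      rw [List.map_cons, List.sum_cons, ih, List.length_cons, Nat.add_mul, Nat.add_comm]
      rfl
  rw [hsize]
  have hσ := J.σ_pos
  calc J.gc.length * (J.σ + 1) ≤ J.ell * (2 * J.σ ^ J.k) := by
        refine Nat.mul_le_mul h.le ?_
        have : J.σ ≤ J.σ ^ J.k := Nat.le_self_pow (Nat.succ_ne_zero _) _
        omega
    _ = _ := by ring

theorem runTime_addDFAs_le : runTime (addDFAs J) ≤
    3 * (J.σ ^ J.k * max 1 (nz LenConstraint.lang (σ := J.σ) J.gc) * max 1 J.ell) := by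
  have hp : 1 ≤ J.σ ^ J.k := Nat.pow_pos J.σ_pos
  have hk : (addDFAs J).k = J.k := by simp [Instance.k, addDFAs]
  have hlen : (addDFAs J).gc.length = J.gc.length := by simp [addDFAs]
  have hn : 1 ≤ max 1 (nz LenConstraint.lang (σ := J.σ) J.gc) := le_max_left _ _
  have hX : J.σ ^ J.k * max 1 J.ell ≤ J.σ ^ J.k * max 1 (nz LenConstraint.lang (σ := J.σ) J.gc) * max 1 J.ell :=
    Nat.mul_le_mul_right _ (Nat.le_mul_of_pos_right _ hn)
  unfold runTime
  show (if (addDFAs J).gc.length < J.ell then J.σ ^ (addDFAs J).k * max 1 (states (addDFAs J).gc) * max 1 J.ell +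
    size (addDFAs J).gc else 1) ≤ _
  rw [hk, hlen, states_addDFAs]
  split
  · have h1 := size_addDFAs_le J (by assumption)
    have h2 : J.σ ^ J.k * J.ell ≤ J.σ ^ J.k * max 1 J.ell := Nat.mul_le_mul_left _ (le_max_right _ _)
    omega
  · have : 1 * 1 ≤ J.σ ^ J.k * max 1 J.ell := Nat.mul_le_mul hp (le_max_left _ _)
    omega

end

/-! ### The bounds for arbitrary and for fixed alphabets -/

theorem encodeGap_true : encodeGap true = RegLenConstraint.encode := by
  funext σ c
  simp [encodeGap, RegLenConstraint.encode]

theorem runTime_le {p : Problem} (I : Instance p RegLenConstraint) :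
    runTime I ≤ I.σ ^ I.k * max 1 (states I.gc) * max 1 I.ell + size I.gc := by
  unfold runTime
  split
  · exact le_rfl
  · have : 1 * 1 * 1 ≤ I.σ ^ I.k * max 1 (states I.gc) * max 1 I.ell :=
      Nat.mul_le_mul (Nat.mul_le_mul (Nat.pow_pos I.σ_pos) (le_max_left _ _)) (le_max_left _ _)
    omega

theorem lenSolvable (p : Problem) : ∃ C : ℕ, LenSolvable p Set.univ fun J =>
    C * (J.σ ^ J.k * max 1 (nz LenConstraint.lang (σ := J.σ) J.gc) * max 1 J.ell) := by
  obtain ⟨K, hK⟩ := program_spec p false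
  refine ⟨K * 3, program p false, 9, fun J _ => ?_⟩
  obtain ⟨t, s, h1, h2, h3⟩ := hK (addDFAs J) (fun _ c hc => by
    obtain ⟨l, -, rfl⟩ := List.mem_map.1 hc
    rfl)
  rw [encode_addDFAs] at h1
  rw [isYes_addDFAs] at h3
  refine ⟨t, s, h1, h2.trans ?_, h3⟩
  beta_reduce
  rw [Nat.mul_assoc]
  exact Nat.mul_le_mul_left _ (runTime_addDFAs_le J)

theorem regLenSolvable (p : Problem) : ∃ C : ℕ, RegLenSolvable p Set.univ fun I =>
    C * (I.σ ^ I.k * max 1 (states I.gc) * max 1 I.ell + size I.gc) := by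
  obtain ⟨K, hK⟩ := program_spec p true
  refine ⟨K, program p true, 9, fun I _ => ?_⟩
  obtain ⟨t, s, h1, h2, h3⟩ := hK I (by simp)
  rw [encodeGap_true] at h1
  exact ⟨t, s, h1, h2.trans (Nat.mul_le_mul_left _ (runTime_le I)), h3⟩

/-- Constant factors and powers with bounded base are at most exponential. -/
theorem mul_pow_le_two_pow (C σ : ℕ) {k : ℕ} (hk : 1 ≤ k) : C * σ ^ k ≤ 2 ^ ((C + σ) * k) := by
  rw [Nat.add_mul, Nat.pow_add]
  refine Nat.mul_le_mul ?_ ?_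
  · exact Nat.lt_two_pow_self.le.trans (Nat.pow_le_pow_right (by omega) (Nat.le_mul_of_pos_right _ hk))
  · rw [Nat.pow_mul]
    exact Nat.pow_le_pow_left Nat.lt_two_pow_self.le _

end While

theorem theorem3 :
    -- (1) arbitrary alphabets, given with the input
    (∀ p : GapSubseq.Problem,
      (∃ C : ℕ, GapSubseq.LenSolvable p Set.univ fun I =>
        C * (I.σ ^ I.k * max 1 (GapSubseq.nz GapSubseq.LenConstraint.lang (σ := I.σ) I.gc) *
          max 1 I.ell)) ∧
      (∃ C : ℕ, GapSubseq.RegLenSolvable p Set.univ fun I =>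
        C * (I.σ ^ I.k * max 1 (GapSubseq.states I.gc) * max 1 I.ell + GapSubseq.size I.gc))) ∧
    -- (2) a fixed alphabet
    (∀ (p : GapSubseq.Problem) (σ : ℕ), 0 < σ →
      (∃ c : ℕ, GapSubseq.LenSolvable p {I | I.σ = σ} fun I =>
        2 ^ (c * I.k) * max 1 (GapSubseq.nz GapSubseq.LenConstraint.lang (σ := I.σ) I.gc) *
          max 1 I.ell) ∧
      (∃ c : ℕ, GapSubseq.RegLenSolvable p {I | I.σ = σ} fun I =>
        2 ^ (c * I.k) * max 1 (GapSubseq.states I.gc) * max 1 I.ell +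
          c * GapSubseq.size I.gc)) := by
  refine ⟨fun p => ⟨While.lenSolvable p, While.regLenSolvable p⟩, fun p σ _ => ⟨?_, ?_⟩⟩
  · obtain ⟨C, P, d, h⟩ := While.lenSolvable p
    refine ⟨C + σ, P, d, fun I hI => ?_⟩
    obtain ⟨t, s, h1, h2, h3⟩ := h I (Set.mem_univ _)
    refine ⟨t, s, h1, h2.trans ?_, h3⟩
    have hI : I.σ = σ := hI
    have := While.mul_pow_le_two_pow C σ (show 1 ≤ I.k from Nat.succ_pos _)
    beta_reduce
    rw [← Nat.mul_assoc, ← Nat.mul_assoc]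
    refine Nat.mul_le_mul_right _ (Nat.mul_le_mul_right _ ?_)
    rw [hI]
    exact this
  · obtain ⟨C, P, d, h⟩ := While.regLenSolvable p
    -- The exponent `(C + σ) * k` absorbs both `C` and `σ ^ k`, and `C ≤ C + σ` takes care of the
    -- term with `size`.
    refine ⟨C + σ, P, d, fun I hI => ?_⟩
    obtain ⟨t, s, h1, h2, h3⟩ := h I (Set.mem_univ _)
    refine ⟨t, s, h1, h2.trans ?_, h3⟩
    have hI : I.σ = σ := hI
    have := While.mul_pow_le_two_pow C σ (show 1 ≤ I.k from Nat.succ_pos _)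
    beta_reduce
    rw [Nat.mul_add, ← Nat.mul_assoc, ← Nat.mul_assoc]
    refine Nat.add_le_add (Nat.mul_le_mul_right _ (Nat.mul_le_mul_right _ ?_)) (Nat.mul_le_mul_right _ (by omega))
    rw [hI]
    exact this
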